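/- **Setting.** Particles are of types $(a,b,m)\in S=\mathbb N\times\mathbb N\times\mathbb N^*$ ($a$ male arms, $b$ female arms, mass $m$); for $p=(a,b,m)$ and $p'=(a',b',m')$ write $p\cdot p'=a'b+ab'$ and $p\circ p'=(a+a'-1,\,b+b'-1,\,m+m')$. Write $p'\preceq p$ if $a'\le a+1$, $b'\le b+1$, $m'\le m-1$, and then $p\backslash p'=(a+1-a',\,b+1-b',\,m-m')$. Put $\langle c,f\rangle=\sum_{p\in S}c(p)f(p)$. A solution on $[0,\infty)$, started from $c_0$, of Smoluchowski's equation $$\frac{\mathrm d}{\mathrm dt}c_t(p)=\frac12\sum_{p'\preceq p}p'\cdot(p\backslash p')\,c_t(p')\,c_t(p\backslash p')-c_t(p)\sum_{p'\in S}p\cdot p'\,c_t(p')\qquad(p\in S,\ t\ge 0)$$ is a family of differentiable real functions $t\mapsto c_t(p)$ satisfying it, with initial value $c_0$, such that $\langle a+b,|c_t|\rangle$ is finite for every $t\ge0$ and is a locally integrable function of $t$, and $\langle a^2+b^2,|c_t|\rangle<\infty$ for $t$ in a neighbourhood of $0$ in $[0,\infty)$. Let $\mu\ge 0$ be a finite measure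 on $\mathbb N\times\mathbb N$ with $\sum a\,\mu(a,b)=\sum b\,\mu(a,b)=1$ and $\sum(a^2+b^2)\mu(a,b)<\infty$, and let $c_0(a,b,m)=\mu(a,b)\mathbf 1_{\{m=1\}}$ (monodisperse initial data). Put $M=\langle c_0,ab\rangle+\sqrt{\langle c_0,a^2-a\rangle\langle c_0,b^2-b\rangle}$ and $T_c=\infty$ if $M\le1$, $T_c=1/(M-1)$ if $M>1$. Assume $T_c=\infty$. Let $T(\nu_m,\nu_f)\in\mathbb N\cup\{\infty\}$ be the total progeny (ancestors included) of a two-type (male/female) Galton–Watson process started from one male and one female ancestor, in which a male has $a$ male and $b$ female children with probability $\nu_m(a,b)=(b+1)\mu(a,b+1)$, and a female with probability $\nu_f(a,b)=(a+1)\mu(a+1,b)$, all individuals reproducing independently. Call $\mu$ degenerate if, outside the point $(0,0)$, it is supported in $\{a=1\}$, or in $\{b=1\}$, or in $\{(1,1),(2,0),(0,2)\}$. **Statement.** (i) Smoluchowski's equation started from $c_0$ has a solution on $[0,\infty)$. For every such solution $(c_t)_{t\ge0}$ there are limiting concentrations $(c_\infty(m))_{m\ge1}$ with $c_t(a,b,m)\to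 c_\infty(m)\mathbf 1_{\{a=b=0\}}$ in $\ell^1(\mathbb N\times\mathbb N\times\mathbb N^*)$ as $t\to\infty$, and for all $m\ge2$ $$\mathbb P\big(T(\nu_m,\nu_f)=m\big)=(m-1)\,c_\infty(m).$$ (ii) If $\mu$ is not degenerate, then $T(\nu_m,\nu_f)<\infty$ almost surely. -/

import Mathlib

open MeasureTheory ProbabilityTheory Filter Topology
open scoped ENNReal

noncomputable section

/-! ### Particles and the coagulation equation -/

/-- The type `(a, b, m)` of a particle: `a` male arms, `b` female arms, mass `m ≥ 1`. -/
abbrev Particle : Type := ℕ × ℕ × ℕ+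

namespace Particle

/-- Number of male arms, as a real number. -/
def male (p : Particle) : ℝ := p.1

/-- Number of female arms, as a real number. -/
def female (p : Particle) : ℝ := p.2.1

/-- The coagulation rate `a' b + a b'` of two particles. -/
def rate (p q : Particle) : ℝ := q.male * p.female + p.male * q.female

/-- The types `p' = (a', b', m')` with `a' ≤ a + 1`, `b' ≤ b + 1` and `m' ≤ m - 1`:
the possible constituents of a freshly formed particle of type `p = (a, b, m)`. -/
def parts (p : Particle) : Finset Particle :=
  Finset.range (p.1 + 2) ×ˢ (Finset.range (p.2.1 + 2) ×ˢ Finset.Ico 1 p.2.2)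

/-- The other constituent `(a + 1 - a', b + 1 - b', m - m')`. It is only used for `p' ∈ parts p`,
where no subtraction is truncated. -/
def rest (p p' : Particle) : Particle :=
  (p.1 + 1 - p'.1, p.2.1 + 1 - p'.2.1, p.2.2 - p'.2.2)

end Particle

open Particle

/-- The pairing `⟨c, f⟩ = ∑ c(p) f(p)`. -/
def pairing (c f : Particle → ℝ) : ℝ := ∑' p, c p * f p

/-- The right-hand side of the coagulation equation for the type `p`. -/
def coagulationRHS (c : Particle → ℝ) (p : Particle) : ℝ :=
  (1 / 2) * ∑ p' ∈ parts p, rate p' (rest p p') * c p' * c (rest p p')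
    - c p * ∑' p' : Particle, rate p p' * c p'

/-- `c` is a solution on `[0, T)` of the coagulation equation started from `c₀`. Concentrations are
real-valued here; nothing is assumed about their sign at positive times. -/
structure IsSolution (c₀ : Particle → ℝ) (T : ℝ≥0∞) (c : ℝ → Particle → ℝ) : Prop where
  init : ∀ p, c 0 p = c₀ p
  /-- The total number of arms `⟨a + b, |c_t|⟩` is finite at every time. -/
  arms_summable : ∀ t : ℝ, 0 ≤ t → ENNReal.ofReal t < T →
    Summable fun p : Particle => |c t p| * (p.male + p.female)
  /-- The total number of arms is locally integrable in time, so that the loss term of the equation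
  can be integrated over `[0, t]`. -/
  arms_integrable : ∀ t : ℝ, 0 ≤ t → ENNReal.ofReal t < T →
    IntervalIntegrable
      (fun s => ∑' p : Particle, |c s p| * (p.male + p.female)) volume 0 t
  /-- The second moments `⟨a² + b², |c_t|⟩` are finite for `t` in a neighbourhood of `0`. -/
  second_moments : ∃ ε : ℝ, 0 < ε ∧ ∀ t : ℝ, 0 ≤ t → t < ε → ENNReal.ofReal t < T →
    Summable fun p : Particle => |c t p| * (p.male ^ 2 + p.female ^ 2)
  /-- The equation holds (with a one-sided derivative at `t = 0`). -/
  equation : ∀ t : ℝ, 0 ≤ t → ENNReal.ofReal t < T → ∀ p : Particle,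
    HasDerivWithinAt (fun s => c s p) (coagulationRHS (c t) p) (Set.Ici 0) t

/-- The standing assumptions on the initial concentrations. -/
structure IsAdmissible (c₀ : Particle → ℝ) : Prop where
  nonneg : ∀ p, 0 ≤ c₀ p
  summable : Summable c₀
  male_arms : HasSum (fun p : Particle => c₀ p * p.male) 1
  female_arms : HasSum (fun p : Particle => c₀ p * p.female) 1
  second_moments : Summable fun p : Particle => c₀ p * (p.male ^ 2 + p.female ^ 2)

/-- `M = ⟨ab, c₀⟩ + √(⟨a² - a, c₀⟩ ⟨b² - b, c₀⟩)`. -/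
def criticalParameter (c₀ : Particle → ℝ) : ℝ :=
  pairing c₀ (fun p => p.male * p.female) +
    √(pairing c₀ (fun p => p.male ^ 2 - p.male) * pairing c₀ (fun p => p.female ^ 2 - p.female))

open Classical in
/-- The critical time: `∞` if `M ≤ 1`, and `1 / (M - 1)` if `M > 1`. -/
def criticalTime (c₀ : Particle → ℝ) : ℝ≥0∞ :=
  if criticalParameter c₀ ≤ 1 then ⊤ else ENNReal.ofReal (1 / (criticalParameter c₀ - 1))

/-- Monodisperse initial concentrations: all particles have mass `1`, and `μ (a, b)` is the
concentration of those with `a` male and `b` female arms. -/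
def monodisperse (μ : ℕ × ℕ → ℝ) (p : Particle) : ℝ :=
  if p.2.2 = 1 then μ (p.1, p.2.1) else 0

/-- The concentrations in which particles with arms have disappeared and armless particles of
mass `m` have concentration `k m`. -/
def armless (k : ℕ+ → ℝ) (p : Particle) : ℝ :=
  if p.1 = 0 ∧ p.2.1 = 0 then k p.2.2 else 0

/-- `c_t → d` in `ℓ¹` as `t → ∞`. -/
def TendstoL1 (c : ℝ → Particle → ℝ) (d : Particle → ℝ) : Prop :=
  Tendsto (fun t => ∑' p, ENNReal.ofReal |c t p - d p|) atTop (𝓝 0)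

/-- `μ` is degenerate if, apart from particles without arms, it only charges types with exactly one
male arm, or only types with exactly one female arm, or only the types `(1, 1)`, `(2, 0)` and
`(0, 2)`. -/
def IsDegenerate (μ : ℕ × ℕ → ℝ) : Prop :=
  (∀ a b : ℕ, (a, b) ≠ (0, 0) → a ≠ 1 → μ (a, b) = 0) ∨
  (∀ a b : ℕ, (a, b) ≠ (0, 0) → b ≠ 1 → μ (a, b) = 0) ∨
  (∀ a b : ℕ, (a, b) ≠ (0, 0) → (a, b) ≠ (1, 1) → (a, b) ≠ (2, 0) → (a, b) ≠ (0, 2) →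
    μ (a, b) = 0)

/-! ### Two-type Galton–Watson processes -/

/-- The two types of individuals. -/
inductive Gender : Type
  | male
  | female

/-- The offspring laws: a male has `a` male and `b` female children with probability
`(b + 1) μ (a, b + 1)`, a female with probability `(a + 1) μ (a + 1, b)`. -/
def offspringLaw (μ : ℕ × ℕ → ℝ) : Gender → Measure (ℕ × ℕ)
  | .male => Measure.count.withDensity fun x =>
      ENNReal.ofReal (((x.2 : ℝ) + 1) * μ (x.1, x.2 + 1))
  | .female => Measure.count.withDensity fun x =>
      ENNReal.ofReal (((x.1 : ℝ) + 1) * μ (x.1 + 1, x.2))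

/-- The variables `ξ (g, n, i)`, giving the numbers of male and female children of the `i`-th
individual of gender `g` in generation `n`, are independent, with law `ν g`. -/
structure IsOffspringFamily {Ω : Type*} [MeasurableSpace Ω] (ν : Gender → Measure (ℕ × ℕ))
    (ξ : Gender × ℕ × ℕ → Ω → ℕ × ℕ) (P : Measure Ω) : Prop where
  law : ∀ j, HasLaw (ξ j) (ν j.1) P
  indep : iIndepFun ξ P

/-- The numbers of males and females in the successive generations of the two-type Galton–Watson
process with offspring variables `ξ`, started from `z.1` males and `z.2` females. -/
def galtonWatson {Ω : Type*} (ξ : Gender × ℕ × ℕ → Ω → ℕ × ℕ) (z : ℕ × ℕ) : ℕ → Ω → ℕ × ℕ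
  | 0, _ => z
  | n + 1, ω =>
      ∑ i ∈ Finset.range (galtonWatson ξ z n ω).1, ξ (.male, n, i) ω +
        ∑ i ∈ Finset.range (galtonWatson ξ z n ω).2, ξ (.female, n, i) ω

/-- The total progeny (ancestors included), possibly infinite. -/
def totalProgeny {Ω : Type*} (ξ : Gender × ℕ × ℕ → Ω → ℕ × ℕ) (z : ℕ × ℕ) (ω : Ω) : ℝ≥0∞ :=
  ∑' n, (((galtonWatson ξ z n ω).1 : ℝ≥0∞) + ((galtonWatson ξ z n ω).2 : ℝ≥0∞))

end

open scoped NNReal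
open Finset.HasAntidiagonal (antidiagonal)
open Finsupp (single)

noncomputable section

/-! ### The formal solution of `∂ₜ G = ∂ₓ G ∂ᵧ G` -/

/-! Write `G(x, y, t) = ∑ K(a, b, m) xᵃ yᵇ t^(m-1)` for the formal solution of `∂ₜG = ∂ₓG ∂ᵧG` with
initial value `∑ μ(a, b) xᵃ yᵇ`, and `P = ∂ₓG`, `Q = ∂ᵧG`. In Smoluchowski's equation the loss term
involves only the total numbers of male and female arms. Removing it by an integrating factor, and
inducting on the mass, shows that every solution is `c_t(a, b, m) = K(a, b, m) Xᵃ Yᵇ τ^(m-1)`, where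
`X`, `Y` are the probabilities that a male or a female arm is still free and `τ = ∫ X Y`
(`IsSolution.eq_scaledConc`). It remains to find `X`, `Y` and `τ`.

Both `P` and `Q` are constant along the characteristics of the equation, so with `g = ∑ μ(a, b) xᵃ
yᵇ` they satisfy `P = ∂ₓg (x + tQ, y + tP)` and `Q = ∂ᵧg (x + tQ, y + tP)`. Evaluated in `[0, ∞]`
they are the least solution of this system (`evalSeries_le_of_supersolution`). The derivatives of
`g` are the offspring generating functions, and `T_c = ∞` says that their mean matrix has spectral
radius at most one. For `t < 1` the system is therefore rigid: it has only one solution in the unit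
square (`IsFixedPoint.unique`). At `x = y = 1 - t` this solution is `(1, 1)`, so both totals of arms
are `1 - t` there. The choice `X = Y = 1 - τ`, `τ = t / (1 + t)` thus gives a solution for all
times.

For uniqueness, truncated sums show that the totals of arms never exceed `X` and `Y`
(`IsSolution.maleArms_le`, `IsSolution.femaleArms_le`), hence `X, Y ≥ 1 - τ`. Since `P` and `Q`
increase with `x` and `y`, they are at least `1` at `(X, Y, τ)`, which is the opposite inequality.
The factors are then forced to be the explicit ones (`IsSolution.eq_explicitSolution`). As `t → ∞`,
`τ → 1` and the arms vanish, which leaves `c_∞(m) = K(0, 0, m)`.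

Finally `∑ (m - 1) c_∞(m) s^m = s² P(0, 0, s) Q(0, 0, s)`. The generating function of the total
progeny is a product `a b` with `a = s ∂ᵧg(a, b)` and `b = s ∂ₓg(a, b)`. This is the same system
with `a = sQ`, `b = sP`, so uniqueness and comparison of coefficients identify the two laws
(`IsSubcritical.measureReal_totalProgeny_eq`). Letting `s → 1`, finiteness of the progeny reduces to
showing that `(1, 1)` is the only fixed point of the offspring generating functions in the unit
square; the equality case of the linear bounds shows that this fails only for degenerate `μ`
(`IsSubcritical.fixedPoint_eq_one`). -/

/-- Formal power series in `x`, `y` (arms) and `t` (mass minus one). -/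
abbrev ArmSeries : Type := MvPowerSeries (Fin 3) ℝ≥0

/-- Coefficients of the solution of `∂ₜ G = ∂ₓ G ∂ᵧ G` with initial value `∑ ν (a, b) xᵃ yᵇ`. -/
def treeCoeff (ν : ℕ × ℕ → ℝ≥0) (d : Fin 3 →₀ ℕ) : ℝ≥0 :=
  if _h : d 2 = 0 then ν (d 0, d 1) else
    (d 2 : ℝ≥0)⁻¹ * ∑ ef ∈ (antidiagonal (d - single 2 1 : Fin 3 →₀ ℕ)).attach,
      (treeCoeff ν (ef.1.1 + single 0 1) * (ef.1.1 0 + 1)) *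
        (treeCoeff ν (ef.1.2 + single 1 1) * (ef.1.2 1 + 1))
termination_by d 2
decreasing_by
  all_goals
    have h := DFunLike.congr_fun (Finset.HasAntidiagonal.mem_antidiagonal.1 ef.2) 2
    simp at h ⊢
    omega

/-- The formal solution of `∂ₜ G = ∂ₓ G ∂ᵧ G` with initial value `∑ ν (a, b) xᵃ yᵇ`. -/
def treeSeries (ν : ℕ × ℕ → ℝ≥0) : ArmSeries := treeCoeff ν

/-- The derivative of `treeSeries` in the male variable. -/
def treeSeriesMale (ν : ℕ × ℕ → ℝ≥0) : ArmSeries := MvPowerSeries.pderiv ℝ≥0 0 (treeSeries ν)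

/-- The derivative of `treeSeries` in the female variable. -/
def treeSeriesFemale (ν : ℕ × ℕ → ℝ≥0) : ArmSeries := MvPowerSeries.pderiv ℝ≥0 1 (treeSeries ν)

variable {ν : ℕ × ℕ → ℝ≥0}

lemma coeff_treeSeries (d : Fin 3 →₀ ℕ) :
    MvPowerSeries.coeff d (treeSeries ν) = treeCoeff ν d := rfl

lemma pderiv_two_treeSeries :
    MvPowerSeries.pderiv ℝ≥0 2 (treeSeries ν) = treeSeriesMale ν * treeSeriesFemale ν := by
  classical
  ext1 d
  rw [MvPowerSeries.coeff_mul, MvPowerSeries.coeff_pderiv, coeff_treeSeries, treeCoeff]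
  have h0 : (d + single 2 1 : Fin 3 →₀ ℕ) 2 = d 2 + 1 := by simp
  rw [dif_neg (by omega), h0, mul_comm, ← mul_assoc, Nat.cast_succ,
    mul_inv_cancel₀ (by positivity), one_mul, add_tsub_cancel_right]
  rw [Finset.sum_attach _ (fun ef : (Fin 3 →₀ ℕ) × (Fin 3 →₀ ℕ) =>
    (treeCoeff ν (ef.1 + single 0 1) * ((ef.1 0 : ℝ≥0) + 1)) *
        (treeCoeff ν (ef.2 + single 1 1) * ((ef.2 1 : ℝ≥0) + 1)))]
  refine Finset.sum_congr rfl fun ef _ => ?_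
  simp only [treeSeriesMale, treeSeriesFemale, MvPowerSeries.coeff_pderiv, coeff_treeSeries]

lemma MvPowerSeries.pderiv_comm {σ R : Type*} [CommSemiring R] (i j : σ) (f : MvPowerSeries σ R) :
    pderiv R i (pderiv R j f) = pderiv R j (pderiv R i f) := by
  rcases eq_or_ne i j with rfl | hij
  · rfl
  ext1 d
  simp only [coeff_pderiv, Finsupp.add_apply, Finsupp.single_eq_of_ne hij,
    Finsupp.single_eq_of_ne hij.symm, add_zero]
  rw [add_right_comm, mul_right_comm]

/-- Series that are constant along the characteristics of `∂ₜ G = ∂ₓ G ∂ᵧ G`. -/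
def IsTransported (ν : ℕ × ℕ → ℝ≥0) (f : ArmSeries) : Prop :=
  MvPowerSeries.pderiv ℝ≥0 2 f = treeSeriesFemale ν * MvPowerSeries.pderiv ℝ≥0 0 f +
    treeSeriesMale ν * MvPowerSeries.pderiv ℝ≥0 1 f

namespace IsTransported

lemma add {f g : ArmSeries} (hf : IsTransported ν f) (hg : IsTransported ν g) :
    IsTransported ν (f + g) := by
  unfold IsTransported at *
  simp only [map_add, hf, hg]
  ring

lemma mul {f g : ArmSeries} (hf : IsTransported ν f) (hg : IsTransported ν g) :
    IsTransported ν (f * g) := by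
  unfold IsTransported at *
  simp only [Derivation.leibniz, hf, hg, smul_eq_mul]
  ring

lemma const (r : ℝ≥0) : IsTransported ν (MvPowerSeries.C r) := by
  simp [IsTransported]

lemma pow {f : ArmSeries} (hf : IsTransported ν f) (n : ℕ) : IsTransported ν (f ^ n) := by
  induction n with
  | zero => simpa using const 1
  | succ n ih => rw [pow_succ]; exact ih.mul hf

lemma sum {ι : Type*} (s : Finset ι) {f : ι → ArmSeries} (hf : ∀ i, IsTransported ν (f i)) :
    IsTransported ν (∑ i ∈ s, f i) := by
  classical
  induction s using Finset.induction_on with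
  | empty => simpa using const 0
  | insert i s hi ih => rw [Finset.sum_insert hi]; exact (hf i).add ih

/-- Differentiating `∂ₜG = P Q` in `x` gives `∂ₜP = Q ∂ₓP + P ∂ₓQ`, and `∂ₓQ = ∂ᵧP` because
derivatives commute. -/
lemma male : IsTransported ν (treeSeriesMale ν) := by
  unfold IsTransported
  conv_lhs => rw [treeSeriesMale, MvPowerSeries.pderiv_comm, pderiv_two_treeSeries]
  conv_rhs => rw [treeSeriesMale, MvPowerSeries.pderiv_comm 1 0]
  rw [Derivation.leibniz]
  simp only [smul_eq_mul, treeSeriesFemale, treeSeriesMale]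
  ring

lemma female : IsTransported ν (treeSeriesFemale ν) := by
  unfold IsTransported
  conv_lhs => rw [treeSeriesFemale, MvPowerSeries.pderiv_comm, pderiv_two_treeSeries]
  conv_rhs => rw [treeSeriesFemale, MvPowerSeries.pderiv_comm 0 1]
  rw [Derivation.leibniz]
  simp only [smul_eq_mul, treeSeriesFemale, treeSeriesMale]
  ring

/-- A characteristic moves with velocity `(-Q, -P)`, on which `Q` is constant; `x + tQ` is the
abscissa from which it started at time `0`. -/
lemma male_start :
    IsTransported ν (MvPowerSeries.X 0 + MvPowerSeries.X 2 * treeSeriesFemale ν) := by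
  have h := female (ν := ν)
  unfold IsTransported at *
  simp only [map_add, Derivation.leibniz, smul_eq_mul, h, MvPowerSeries.pderiv_X_self,
    MvPowerSeries.pderiv_X_of_ne (R := ℝ≥0) (show (0 : Fin 3) ≠ 2 by decide),
    MvPowerSeries.pderiv_X_of_ne (R := ℝ≥0) (show (0 : Fin 3) ≠ 1 by decide),
    MvPowerSeries.pderiv_X_of_ne (R := ℝ≥0) (show (2 : Fin 3) ≠ 0 by decide),
    MvPowerSeries.pderiv_X_of_ne (R := ℝ≥0) (show (2 : Fin 3) ≠ 1 by decide)]
  ring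

lemma female_start :
    IsTransported ν (MvPowerSeries.X 1 + MvPowerSeries.X 2 * treeSeriesMale ν) := by
  have h := male (ν := ν)
  unfold IsTransported at *
  simp only [map_add, Derivation.leibniz, smul_eq_mul, h, MvPowerSeries.pderiv_X_self,
    MvPowerSeries.pderiv_X_of_ne (R := ℝ≥0) (show (1 : Fin 3) ≠ 2 by decide),
    MvPowerSeries.pderiv_X_of_ne (R := ℝ≥0) (show (1 : Fin 3) ≠ 0 by decide),
    MvPowerSeries.pderiv_X_of_ne (R := ℝ≥0) (show (2 : Fin 3) ≠ 0 by decide),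
    MvPowerSeries.pderiv_X_of_ne (R := ℝ≥0) (show (2 : Fin 3) ≠ 1 by decide)]
  ring

/-- A transported series is determined by its values at `t = 0`, degree by degree. -/
lemma coeff_eq {f g : ArmSeries} (hf : IsTransported ν f) (hg : IsTransported ν g) {K : ℕ}
    (h0 : ∀ d : Fin 3 →₀ ℕ, d 2 = 0 → d 0 + d 1 < K →
      MvPowerSeries.coeff d f = MvPowerSeries.coeff d g) (d : Fin 3 →₀ ℕ)
    (hd : d 0 + d 1 + d 2 < K) : MvPowerSeries.coeff d f = MvPowerSeries.coeff d g := by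
  classical
  -- The coefficient of `Q ∂ₓf + P ∂ᵧf` just below `d` in `t` involves only lower orders in `t`. The
  -- derivative in `x` or `y` trades a power of `t` for a power of that variable, so the bound on
  -- the total degree survives.
  induction hn : d 2 using Nat.strong_induction_on generalizing d with
  | _ n ih =>
    rcases Nat.eq_zero_or_pos n with rfl | hpos
    · exact h0 d hn (by omega)
    obtain ⟨e, rfl⟩ : ∃ e : Fin 3 →₀ ℕ, d = e + single 2 1 := by
      refine ⟨d - single 2 1, (tsub_add_cancel_of_le ?_).symm⟩
      simp only [Finsupp.single_le_iff]
      omega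
    have e0 : (e + single 2 1 : Fin 3 →₀ ℕ) 0 = e 0 := by simp
    have e1 : (e + single 2 1 : Fin 3 →₀ ℕ) 1 = e 1 := by simp
    have e2 : (e + single 2 1 : Fin 3 →₀ ℕ) 2 = e 2 + 1 := by simp
    rw [e0, e1, e2] at hd
    rw [e2] at hn
    have key : MvPowerSeries.coeff e (MvPowerSeries.pderiv ℝ≥0 2 f) =
        MvPowerSeries.coeff e (MvPowerSeries.pderiv ℝ≥0 2 g) := by
      have hf' := hf
      have hg' := hg
      unfold IsTransported at hf' hg'
      rw [hf', hg', map_add, map_add]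
      have aux : ∀ i : Fin 3, i ≠ 2 → ∀ q : ArmSeries,
          MvPowerSeries.coeff e (q * MvPowerSeries.pderiv ℝ≥0 i f) =
          MvPowerSeries.coeff e (q * MvPowerSeries.pderiv ℝ≥0 i g) := by
        intro i hi q
        rw [MvPowerSeries.coeff_mul, MvPowerSeries.coeff_mul]
        refine Finset.sum_congr rfl fun p hp => ?_
        rw [MvPowerSeries.coeff_pderiv, MvPowerSeries.coeff_pderiv]
        have hp' := Finset.HasAntidiagonal.mem_antidiagonal.1 hp
        have q0 := DFunLike.congr_fun hp' 0
        have q1 := DFunLike.congr_fun hp' 1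
        have q2 := DFunLike.congr_fun hp' 2
        simp only [Finsupp.add_apply] at q0 q1 q2
        congr 2
        refine ih (p.2 2) (by omega) _ ?_ ?_
        · fin_cases i <;> simp at hi ⊢ <;> omega
        · simp [hi]
      rw [aux 0 (by decide), aux 1 (by decide)]
    rw [MvPowerSeries.coeff_pderiv, MvPowerSeries.coeff_pderiv] at key
    exact mul_right_cancel₀ (by positivity) key

end IsTransported

/-! ### Agreement of series up to a given order in `t` -/

/-- `f` and `g` have the same coefficients of order less than `N` in `t`. -/
def AgreeBelow (N : ℕ) (f g : ArmSeries) : Prop :=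
  ∀ d : Fin 3 →₀ ℕ, d 2 < N → MvPowerSeries.coeff d f = MvPowerSeries.coeff d g

namespace AgreeBelow

variable {N : ℕ} {f f' g g' : ArmSeries}

lemma refl (f : ArmSeries) : AgreeBelow N f f := fun _ _ => rfl

lemma add (h : AgreeBelow N f f') (h' : AgreeBelow N g g') : AgreeBelow N (f + g) (f' + g') :=
  fun d hd => by rw [map_add, map_add, h d hd, h' d hd]

lemma mul (h : AgreeBelow N f f') (h' : AgreeBelow N g g') :
    AgreeBelow N (f * g) (f' * g') := fun d hd => by
  classical
  rw [MvPowerSeries.coeff_mul, MvPowerSeries.coeff_mul]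
  refine Finset.sum_congr rfl fun p hp => ?_
  have q2 := DFunLike.congr_fun (Finset.HasAntidiagonal.mem_antidiagonal.1 hp) 2
  simp only [Finsupp.add_apply] at q2
  rw [h _ (by omega), h' _ (by omega)]

lemma pow (h : AgreeBelow N f f') (n : ℕ) : AgreeBelow N (f ^ n) (f' ^ n) := by
  induction n with
  | zero => simpa using refl 1
  | succ n ih => rw [pow_succ, pow_succ]; exact ih.mul h

lemma X_two_mul (h : AgreeBelow N f f') :
    AgreeBelow (N + 1) (MvPowerSeries.X 2 * f) (MvPowerSeries.X 2 * f') := fun d hd => by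
  classical
  rw [MvPowerSeries.X, MvPowerSeries.coeff_monomial_mul, MvPowerSeries.coeff_monomial_mul]
  split_ifs with hle
  · rw [h]
    have := Finsupp.single_le_iff.1 hle
    simp
    omega
  · rfl

end AgreeBelow

/-! ### The formal fixed point equations -/

lemma coeff_X_pow_mul_X_pow (a b : ℕ) (d : Fin 3 →₀ ℕ) (hd : d 2 = 0) :
    MvPowerSeries.coeff d
      ((MvPowerSeries.X 0 : ArmSeries) ^ a * (MvPowerSeries.X 1 : ArmSeries) ^ b) =
      if (d 0, d 1) = (a, b) then 1 else 0 := by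
  classical
  rw [MvPowerSeries.X_pow_eq, MvPowerSeries.X_pow_eq, MvPowerSeries.monomial_mul_monomial,
    MvPowerSeries.coeff_monomial, mul_one]
  refine if_congr ?_ rfl rfl
  rw [Finsupp.ext_iff, Fin.forall_fin_succ, Fin.forall_fin_succ, Fin.forall_fin_succ]
  simp [hd, Finsupp.single_apply]

/-- At `t = 0` each product reduces to its monomial `xᵃ yᵇ`. The cut-off at `K` keeps the sum
finite, hence a legitimate formal series, without affecting degrees below `K`. -/
lemma coeff_sum_start (ψ : ℕ × ℕ → ℝ≥0) {K : ℕ} (d : Fin 3 →₀ ℕ) (hd : d 2 = 0)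
    (hK : d 0 + d 1 < K) :
    MvPowerSeries.coeff d (∑ x ∈ Finset.range K ×ˢ Finset.range K, MvPowerSeries.C (ψ x) *
      ((MvPowerSeries.X 0 + MvPowerSeries.X 2 * treeSeriesFemale ν) ^ x.1 *
        (MvPowerSeries.X 1 + MvPowerSeries.X 2 * treeSeriesMale ν) ^ x.2)) = ψ (d 0, d 1) := by
  classical
  have h1 : ∀ (i : Fin 3) (f : ArmSeries),
      AgreeBelow 1 (MvPowerSeries.X i + MvPowerSeries.X 2 * f) (MvPowerSeries.X i) := by
    intro i f
    have := (AgreeBelow.refl (N := 1) (MvPowerSeries.X i)).add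
      (AgreeBelow.X_two_mul (N := 0) (f := f) (f' := 0) (fun _ h => absurd h (by omega)))
    simpa using this
  rw [map_sum]
  simp only [MvPowerSeries.coeff_C_mul]
  rw [Finset.sum_congr rfl fun x _ => by
    rw [((h1 0 _).pow x.1).mul ((h1 1 _).pow x.2) d (by omega),
      coeff_X_pow_mul_X_pow _ _ _ hd]]
  rw [Finset.sum_eq_single (d 0, d 1)]
  · simp
  · intro x _ hx
    rw [if_neg (fun h => hx h.symm), mul_zero]
  · intro h
    simp only [Finset.mem_product, Finset.mem_range] at h
    omega

/-- The product `(x + t Q)ᵃ (y + t P)ᵇ`. -/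
def startPow (ν : ℕ × ℕ → ℝ≥0) (x : ℕ × ℕ) : ArmSeries :=
  (MvPowerSeries.X 0 + MvPowerSeries.X 2 * treeSeriesFemale ν) ^ x.1 *
    (MvPowerSeries.X 1 + MvPowerSeries.X 2 * treeSeriesMale ν) ^ x.2

lemma isTransported_sum_startPow (ψ : ℕ × ℕ → ℝ≥0) (s : Finset (ℕ × ℕ)) :
    IsTransported ν (∑ x ∈ s, MvPowerSeries.C (ψ x) * startPow ν x) :=
  IsTransported.sum s fun _ => (IsTransported.const _).mul
    ((IsTransported.male_start.pow _).mul (IsTransported.female_start.pow _))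

/-- The formal fixed point equation `P = ∂ₓg (x + tQ, y + tP)`, degree by degree: both sides are
transported and have the same low-degree coefficients at `t = 0`. -/
lemma coeff_treeSeriesMale_eq_sum {K : ℕ} (d : Fin 3 →₀ ℕ) (hd : d 0 + d 1 + d 2 < K) :
    MvPowerSeries.coeff d (treeSeriesMale ν) = ∑ x ∈ Finset.range K ×ˢ Finset.range K,
      ((x.1 + 1) * ν (x.1 + 1, x.2)) * MvPowerSeries.coeff d (startPow ν x) := by
  rw [IsTransported.male.coeff_eq
    (isTransported_sum_startPow (fun x => (x.1 + 1) * ν (x.1 + 1, x.2))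
      (Finset.range K ×ˢ Finset.range K)) ?_ d hd]
  · simp only [map_sum, MvPowerSeries.coeff_C_mul]
  · intro e he hK
    unfold startPow
    rw [coeff_sum_start _ e he hK, treeSeriesMale, MvPowerSeries.coeff_pderiv, coeff_treeSeries,
      treeCoeff, dif_pos (by simpa using he)]
    simp [mul_comm]

lemma coeff_treeSeriesFemale_eq_sum {K : ℕ} (d : Fin 3 →₀ ℕ) (hd : d 0 + d 1 + d 2 < K) :
    MvPowerSeries.coeff d (treeSeriesFemale ν) = ∑ x ∈ Finset.range K ×ˢ Finset.range K,
      ((x.2 + 1) * ν (x.1, x.2 + 1)) * MvPowerSeries.coeff d (startPow ν x) := by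
  rw [IsTransported.female.coeff_eq
    (isTransported_sum_startPow (fun x => (x.2 + 1) * ν (x.1, x.2 + 1))
      (Finset.range K ×ˢ Finset.range K)) ?_ d hd]
  · simp only [map_sum, MvPowerSeries.coeff_C_mul]
  · intro e he hK
    unfold startPow
    rw [coeff_sum_start _ e he hK, treeSeriesFemale, MvPowerSeries.coeff_pderiv,
      coeff_treeSeries, treeCoeff, dif_pos (by simpa using he)]
    simp [mul_comm]


/-! ### Evaluation of formal series in `[0, ∞]` -/

/-- The monomial `xᵃ yᵇ tⁿ`. -/
def armMonomial (t : Fin 3 → ℝ≥0∞) (d : Fin 3 →₀ ℕ) : ℝ≥0∞ := ∏ i, t i ^ d i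

lemma armMonomial_add (t : Fin 3 → ℝ≥0∞) (d e : Fin 3 →₀ ℕ) :
    armMonomial t (d + e) = armMonomial t d * armMonomial t e := by
  simp [armMonomial, pow_add, Finset.prod_mul_distrib]

/-- The value in `[0, ∞]` of a series with nonnegative coefficients. -/
def evalSeries (t : Fin 3 → ℝ≥0∞) (f : ArmSeries) : ℝ≥0∞ :=
  ∑' d, ((MvPowerSeries.coeff d f : ℝ≥0) : ℝ≥0∞) * armMonomial t d

section evalSeries

variable (t : Fin 3 → ℝ≥0∞)

lemma evalSeries_mono {f g : ArmSeries}
    (h : ∀ d, MvPowerSeries.coeff d f ≤ MvPowerSeries.coeff d g) :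
    evalSeries t f ≤ evalSeries t g := by
  refine ENNReal.tsum_le_tsum fun d => ?_
  gcongr
  exact h d

lemma evalSeries_add (f g : ArmSeries) :
    evalSeries t (f + g) = evalSeries t f + evalSeries t g := by
  simp only [evalSeries, map_add, ENNReal.coe_add, add_mul]
  exact ENNReal.tsum_add

/-- In `[0, ∞]` the double sum can be regrouped along antidiagonals with no convergence hypothesis;
this is the advantage of nonnegative coefficients and extended values. -/
lemma evalSeries_mul (f g : ArmSeries) :
    evalSeries t (f * g) = evalSeries t f * evalSeries t g := by
  classical
  have h1 : evalSeries t f * evalSeries t g = ∑' p : (Fin 3 →₀ ℕ) × (Fin 3 →₀ ℕ),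
      (((MvPowerSeries.coeff p.1 f : ℝ≥0) : ℝ≥0∞) * armMonomial t p.1) *
        (((MvPowerSeries.coeff p.2 g : ℝ≥0) : ℝ≥0∞) * armMonomial t p.2) := by
    rw [ENNReal.tsum_prod (f := fun d e => ((MvPowerSeries.coeff d f : ℝ≥0) : ℝ≥0∞) *
      armMonomial t d * (((MvPowerSeries.coeff e g : ℝ≥0) : ℝ≥0∞) * armMonomial t e))]
    simp only [ENNReal.tsum_mul_left, ENNReal.tsum_mul_right]
    rfl
  rw [h1, ← Finset.HasAntidiagonal.sigmaAntidiagonalEquivProd.tsum_eq, ENNReal.tsum_sigma']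
  refine tsum_congr fun d => ?_
  rw [MvPowerSeries.coeff_mul, ENNReal.ofNNReal_finsetSum, Finset.sum_mul, tsum_fintype,
    ← Finset.sum_coe_sort]
  refine Finset.sum_congr rfl fun p _ => ?_
  have hp : armMonomial t d = armMonomial t p.1.1 * armMonomial t p.1.2 := by
    rw [← armMonomial_add, Finset.HasAntidiagonal.mem_antidiagonal.1 p.2]
  rw [hp, ENNReal.coe_mul]
  simp only [Finset.HasAntidiagonal.sigmaAntidiagonalEquivProd_apply]
  ring

lemma evalSeries_monomial (d : Fin 3 →₀ ℕ) (r : ℝ≥0) :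
    evalSeries t (MvPowerSeries.monomial d r) = r * armMonomial t d := by
  classical
  rw [evalSeries, tsum_eq_single d]
  · rw [MvPowerSeries.coeff_monomial_same]
  · intro e he
    rw [MvPowerSeries.coeff_monomial_ne he, ENNReal.coe_zero, zero_mul]

lemma evalSeries_X (i : Fin 3) : evalSeries t (MvPowerSeries.X i) = t i := by
  rw [MvPowerSeries.X, evalSeries_monomial, armMonomial, Finset.prod_eq_single i]
  · simp
  · intro j _ hj
    simp [Finsupp.single_eq_of_ne hj]
  · simp

lemma evalSeries_one : evalSeries t 1 = 1 := by
  have := evalSeries_monomial t 0 1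
  rw [MvPowerSeries.monomial_zero_one] at this
  simpa [armMonomial] using this

lemma evalSeries_pow (f : ArmSeries) (n : ℕ) :
    evalSeries t (f ^ n) = evalSeries t f ^ n := by
  induction n with
  | zero => simp [evalSeries_one]
  | succ n ih => rw [pow_succ, pow_succ, evalSeries_mul, ih]

end evalSeries

/-! ### The derivatives of the generating function -/

/-- The derivative of `∑ ν (a, b) xᵃ yᵇ` in `x`. -/
def genMale (ν : ℕ × ℕ → ℝ≥0) (X Y : ℝ≥0∞) : ℝ≥0∞ :=
  ∑' x : ℕ × ℕ, (((x.1 + 1) * ν (x.1 + 1, x.2) : ℝ≥0) : ℝ≥0∞) * (X ^ x.1 * Y ^ x.2)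

/-- The derivative of `∑ ν (a, b) xᵃ yᵇ` in `y`. -/
def genFemale (ν : ℕ × ℕ → ℝ≥0) (X Y : ℝ≥0∞) : ℝ≥0∞ :=
  ∑' x : ℕ × ℕ, (((x.2 + 1) * ν (x.1, x.2 + 1) : ℝ≥0) : ℝ≥0∞) * (X ^ x.1 * Y ^ x.2)

lemma genMale_mono {X X' Y Y' : ℝ≥0∞} (hX : X ≤ X') (hY : Y ≤ Y') :
    genMale ν X Y ≤ genMale ν X' Y' :=
  ENNReal.tsum_le_tsum fun _ => by gcongr

lemma genFemale_mono {X X' Y Y' : ℝ≥0∞} (hX : X ≤ X') (hY : Y ≤ Y') :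
    genFemale ν X Y ≤ genFemale ν X' Y' :=
  ENNReal.tsum_le_tsum fun _ => by gcongr

lemma ENNReal.tsum_eq_of_forall_sum_range {f : ℕ × ℕ → ℝ≥0∞} {c : ℝ≥0∞} {N : ℕ}
    (h : ∀ K, N < K → ∑ x ∈ Finset.range K ×ˢ Finset.range K, f x = c) : ∑' x, f x = c := by
  have h1 : Tendsto (fun K : ℕ => Finset.range K ×ˢ Finset.range K) atTop atTop := by
    refine tendsto_atTop_finset_of_monotone (fun a b hab => ?_) fun x => ⟨x.1 + x.2 + 1, ?_⟩
    · have := Finset.range_mono hab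
      exact Finset.product_subset_product this this
    · simp
  refine tendsto_nhds_unique ((ENNReal.summable (f := f)).hasSum.comp h1)
    (tendsto_const_nhds.congr' ?_)
  filter_upwards [eventually_gt_atTop N] with K hK using (h K hK).symm

lemma coe_coeff_treeSeriesMale (d : Fin 3 →₀ ℕ) :
    ((MvPowerSeries.coeff d (treeSeriesMale ν) : ℝ≥0) : ℝ≥0∞) =
      ∑' x : ℕ × ℕ, (((x.1 + 1) * ν (x.1 + 1, x.2) : ℝ≥0) : ℝ≥0∞) *
        ((MvPowerSeries.coeff d (startPow ν x) : ℝ≥0) : ℝ≥0∞) := by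
  refine (ENNReal.tsum_eq_of_forall_sum_range (N := d 0 + d 1 + d 2) fun K hK => ?_).symm
  rw [coeff_treeSeriesMale_eq_sum d hK]
  push_cast
  rfl

lemma coe_coeff_treeSeriesFemale (d : Fin 3 →₀ ℕ) :
    ((MvPowerSeries.coeff d (treeSeriesFemale ν) : ℝ≥0) : ℝ≥0∞) =
      ∑' x : ℕ × ℕ, (((x.2 + 1) * ν (x.1, x.2 + 1) : ℝ≥0) : ℝ≥0∞) *
        ((MvPowerSeries.coeff d (startPow ν x) : ℝ≥0) : ℝ≥0∞) := by
  refine (ENNReal.tsum_eq_of_forall_sum_range (N := d 0 + d 1 + d 2) fun K hK => ?_).symm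
  rw [coeff_treeSeriesFemale_eq_sum d hK]
  push_cast
  rfl

section fixedPoint

variable (t : Fin 3 → ℝ≥0∞)

lemma evalSeries_start (i : Fin 3) (f : ArmSeries) :
    evalSeries t (MvPowerSeries.X i + MvPowerSeries.X 2 * f) = t i + t 2 * evalSeries t f := by
  rw [evalSeries_add, evalSeries_mul, evalSeries_X, evalSeries_X]

lemma evalSeries_startPow (x : ℕ × ℕ) :
    evalSeries t (startPow ν x) = (t 0 + t 2 * evalSeries t (treeSeriesFemale ν)) ^ x.1 *
      (t 1 + t 2 * evalSeries t (treeSeriesMale ν)) ^ x.2 := by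
  rw [startPow, evalSeries_mul, evalSeries_pow, evalSeries_pow, evalSeries_start,
    evalSeries_start]

/-- Exchange of the two sums in the evaluation of a superposition of series. -/
lemma evalSeries_eq_tsum {f : ArmSeries} {ψ : ℕ × ℕ → ℝ≥0} {h : ℕ × ℕ → ArmSeries}
    (hf : ∀ d, ((MvPowerSeries.coeff d f : ℝ≥0) : ℝ≥0∞) =
      ∑' x : ℕ × ℕ, (ψ x : ℝ≥0∞) * ((MvPowerSeries.coeff d (h x) : ℝ≥0) : ℝ≥0∞)) :
    evalSeries t f = ∑' x, (ψ x : ℝ≥0∞) * evalSeries t (h x) := by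
  simp only [evalSeries, hf, ← ENNReal.tsum_mul_left, ← ENNReal.tsum_mul_right]
  rw [ENNReal.tsum_comm]
  simp only [mul_assoc]

lemma evalSeries_treeSeriesMale :
    evalSeries t (treeSeriesMale ν) =
      genMale ν (t 0 + t 2 * evalSeries t (treeSeriesFemale ν))
        (t 1 + t 2 * evalSeries t (treeSeriesMale ν)) := by
  conv_lhs => rw [evalSeries_eq_tsum t coe_coeff_treeSeriesMale]
  simp only [evalSeries_startPow]
  rfl

lemma evalSeries_treeSeriesFemale :
    evalSeries t (treeSeriesFemale ν) =
      genFemale ν (t 0 + t 2 * evalSeries t (treeSeriesFemale ν))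
        (t 1 + t 2 * evalSeries t (treeSeriesMale ν)) := by
  conv_lhs => rw [evalSeries_eq_tsum t coe_coeff_treeSeriesFemale]
  simp only [evalSeries_startPow]
  rfl

/-- The terms of order less than `N` in `t`. -/
def truncTime (N : ℕ) (f : ArmSeries) : ArmSeries :=
  fun d => if d 2 < N then MvPowerSeries.coeff d f else 0

lemma coeff_truncTime (N : ℕ) (f : ArmSeries) (d : Fin 3 →₀ ℕ) :
    MvPowerSeries.coeff d (truncTime N f) = if d 2 < N then MvPowerSeries.coeff d f else 0 := rfl

lemma agreeBelow_truncTime (N : ℕ) (f : ArmSeries) : AgreeBelow N f (truncTime N f) :=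
  fun d hd => by rw [coeff_truncTime, if_pos hd]

/-- The factor `t` in front of `P` and `Q` gains one order: below order `N + 1` in `t`, the products
see `P` and `Q` only below order `N`. Restoring the higher terms of the product costs equality but
keeps the inequality. -/
lemma evalSeries_truncTime_le {N : ℕ} {f : ArmSeries} {ψ : ℕ × ℕ → ℝ≥0}
    (hf : ∀ d, ((MvPowerSeries.coeff d f : ℝ≥0) : ℝ≥0∞) =
      ∑' x : ℕ × ℕ, (ψ x : ℝ≥0∞) * ((MvPowerSeries.coeff d (startPow ν x) : ℝ≥0) : ℝ≥0∞)) :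
    evalSeries t (truncTime (N + 1) f) ≤ ∑' x : ℕ × ℕ, (ψ x : ℝ≥0∞) *
      ((t 0 + t 2 * evalSeries t (truncTime N (treeSeriesFemale ν))) ^ x.1 *
        (t 1 + t 2 * evalSeries t (truncTime N (treeSeriesMale ν))) ^ x.2) := by
  set h : ℕ × ℕ → ArmSeries := fun x =>
    (MvPowerSeries.X 0 + MvPowerSeries.X 2 * truncTime N (treeSeriesFemale ν)) ^ x.1 *
      (MvPowerSeries.X 1 + MvPowerSeries.X 2 * truncTime N (treeSeriesMale ν)) ^ x.2 with hh
  have hag : ∀ x, AgreeBelow (N + 1) (startPow ν x) (h x) := fun x =>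
    (((AgreeBelow.refl _).add (agreeBelow_truncTime N _).X_two_mul).pow _).mul
      (((AgreeBelow.refl _).add (agreeBelow_truncTime N _).X_two_mul).pow _)
  have hev : ∀ x, evalSeries t (truncTime (N + 1) (startPow ν x)) ≤
      (t 0 + t 2 * evalSeries t (truncTime N (treeSeriesFemale ν))) ^ x.1 *
        (t 1 + t 2 * evalSeries t (truncTime N (treeSeriesMale ν))) ^ x.2 := by
    intro x
    rw [← evalSeries_start, ← evalSeries_start, ← evalSeries_pow, ← evalSeries_pow,
      ← evalSeries_mul]
    refine evalSeries_mono t fun d => ?_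
    rw [coeff_truncTime]
    split_ifs with hd
    · exact (hag x d hd).le
    · exact zero_le
  rw [evalSeries_eq_tsum t (f := truncTime (N + 1) f) (ψ := ψ)
    (h := fun x => truncTime (N + 1) (startPow ν x))]
  · exact ENNReal.tsum_le_tsum fun x => by gcongr; exact hev x
  · intro d
    simp only [coeff_truncTime]
    split_ifs with hd
    · exact hf d
    · simp

lemma evalSeries_le_of_forall_truncTime {f : ArmSeries} {p : ℝ≥0∞}
    (h : ∀ N, evalSeries t (truncTime N f) ≤ p) : evalSeries t f ≤ p := by
  refine ENNReal.summable.tsum_le_of_sum_le fun s => ?_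
  refine le_trans ?_ (h (s.sup (fun d => d 2) + 1))
  refine le_trans (Finset.sum_le_sum fun d hd => ?_) (ENNReal.sum_le_tsum s)
  have : d 2 ≤ s.sup (fun d => d 2) := Finset.le_sup (f := fun d : Fin 3 →₀ ℕ => d 2) hd
  rw [coeff_truncTime, if_pos (by omega)]

/-- The values of the derivatives of `treeSeries` are the least solution of the fixed point
equations. -/
lemma evalSeries_le_of_supersolution {p q : ℝ≥0∞}
    (hp : genMale ν (t 0 + t 2 * q) (t 1 + t 2 * p) ≤ p)
    (hq : genFemale ν (t 0 + t 2 * q) (t 1 + t 2 * p) ≤ q) :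
    evalSeries t (treeSeriesMale ν) ≤ p ∧ evalSeries t (treeSeriesFemale ν) ≤ q := by
  -- Monotone iteration from zero: the truncations start below the supersolution, and each further
  -- order in `t` is controlled by one application of the fixed point map.
  have key : ∀ N, evalSeries t (truncTime N (treeSeriesMale ν)) ≤ p ∧
      evalSeries t (truncTime N (treeSeriesFemale ν)) ≤ q := by
    intro N
    induction N with
    | zero => simp [evalSeries, coeff_truncTime]
    | succ N ih =>
      refine ⟨((evalSeries_truncTime_le t coe_coeff_treeSeriesMale).trans ?_).trans hp,
        ((evalSeries_truncTime_le t coe_coeff_treeSeriesFemale).trans ?_).trans hq⟩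
      · exact genMale_mono (by gcongr; exact ih.2) (by gcongr; exact ih.1)
      · exact genFemale_mono (by gcongr; exact ih.2) (by gcongr; exact ih.1)
  exact ⟨evalSeries_le_of_forall_truncTime t fun N => (key N).1,
    evalSeries_le_of_forall_truncTime t fun N => (key N).2⟩

end fixedPoint


/-! ### Generating functions on the unit square -/

/-- The power series `∑ ψ (i, j) Xⁱ Yʲ` in two real variables. -/
def gen (ψ : ℕ × ℕ → ℝ) (X Y : ℝ) : ℝ := ∑' x : ℕ × ℕ, ψ x * (X ^ x.1 * Y ^ x.2)

lemma abs_pow_sub_pow_le_of_mem_unit {X Y : ℝ} (hX : X ∈ Set.Icc (0 : ℝ) 1)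
    (hY : Y ∈ Set.Icc (0 : ℝ) 1) (n : ℕ) : |X ^ n - Y ^ n| ≤ n * |X - Y| := by
  refine (abs_pow_sub_pow_le X Y n).trans ?_
  have : max |X| |Y| ^ (n - 1) ≤ 1 :=
    pow_le_one₀ (le_max_of_le_left (abs_nonneg _))
      (max_le (by rw [abs_of_nonneg hX.1]; exact hX.2) (by rw [abs_of_nonneg hY.1]; exact hY.2))
  calc _ ≤ |X - Y| * n * 1 := by gcongr
    _ = _ := by ring

lemma abs_pow_mul_pow_sub_le {X Y X' Y' : ℝ} (hX : X ∈ Set.Icc (0 : ℝ) 1)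
    (hY : Y ∈ Set.Icc (0 : ℝ) 1) (hX' : X' ∈ Set.Icc (0 : ℝ) 1) (hY' : Y' ∈ Set.Icc (0 : ℝ) 1)
    (i j : ℕ) : |X ^ i * Y ^ j - X' ^ i * Y' ^ j| ≤ i * |X - X'| + j * |Y - Y'| := by
  have h : X ^ i * Y ^ j - X' ^ i * Y' ^ j =
      (X ^ i - X' ^ i) * Y ^ j + X' ^ i * (Y ^ j - Y' ^ j) := by ring
  rw [h]
  refine (abs_add_le _ _).trans ?_
  rw [abs_mul, abs_mul, abs_of_nonneg (pow_nonneg hY.1 j), abs_of_nonneg (pow_nonneg hX'.1 i)]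
  exact add_le_add
    ((mul_le_of_le_one_right (abs_nonneg _) (pow_le_one₀ hY.1 hY.2)).trans
      (abs_pow_sub_pow_le_of_mem_unit hX hX' i))
    ((mul_le_of_le_one_left (abs_nonneg _) (pow_le_one₀ hX'.1 hX'.2)).trans
      (abs_pow_sub_pow_le_of_mem_unit hY hY' j))

section gen

variable {ψ : ℕ × ℕ → ℝ} {X Y X' Y' : ℝ}

lemma summable_gen (h0 : ∀ x, 0 ≤ ψ x) (hs : Summable ψ) (hX : X ∈ Set.Icc (0 : ℝ) 1)
    (hY : Y ∈ Set.Icc (0 : ℝ) 1) : Summable fun x : ℕ × ℕ => ψ x * (X ^ x.1 * Y ^ x.2) :=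
  hs.of_nonneg_of_le
    (fun x => mul_nonneg (h0 x) (mul_nonneg (pow_nonneg hX.1 _) (pow_nonneg hY.1 _)))
    fun x => mul_le_of_le_one_right (h0 x)
      (mul_le_one₀ (pow_le_one₀ hX.1 hX.2) (pow_nonneg hY.1 _) (pow_le_one₀ hY.1 hY.2))

/-- A generating function with finite first moments is Lipschitz on the unit square. -/
lemma abs_gen_sub_gen_le (h0 : ∀ x, 0 ≤ ψ x) (hs : Summable ψ) {A B : ℝ}
    (hA : HasSum (fun x => ψ x * x.1) A) (hB : HasSum (fun x => ψ x * x.2) B)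
    (hX : X ∈ Set.Icc (0 : ℝ) 1) (hY : Y ∈ Set.Icc (0 : ℝ) 1)
    (hX' : X' ∈ Set.Icc (0 : ℝ) 1) (hY' : Y' ∈ Set.Icc (0 : ℝ) 1) :
    |gen ψ X Y - gen ψ X' Y'| ≤ A * |X - X'| + B * |Y - Y'| := by
  have h1 := ((summable_gen h0 hs hX hY).hasSum.sub (summable_gen h0 hs hX' hY').hasSum)
  have h2 := (hA.mul_right |X - X'|).add (hB.mul_right |Y - Y'|)
  have hle : ∀ x : ℕ × ℕ, ‖ψ x * (X ^ x.1 * Y ^ x.2) - ψ x * (X' ^ x.1 * Y' ^ x.2)‖ ≤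
      ψ x * x.1 * |X - X'| + ψ x * x.2 * |Y - Y'| := by
    intro x
    rw [← mul_sub, Real.norm_eq_abs, abs_mul, abs_of_nonneg (h0 x)]
    calc _ ≤ ψ x * (x.1 * |X - X'| + x.2 * |Y - Y'|) :=
          mul_le_mul_of_nonneg_left (abs_pow_mul_pow_sub_le hX hY hX' hY' _ _) (h0 x)
      _ = _ := by ring
  have := tsum_of_norm_bounded h2 hle
  rwa [h1.tsum_eq] at this

lemma tsum_ofReal_mul_pow (h0 : ∀ x, 0 ≤ ψ x) (hs : Summable ψ) (hX : X ∈ Set.Icc (0 : ℝ) 1)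
    (hY : Y ∈ Set.Icc (0 : ℝ) 1) :
    ∑' x : ℕ × ℕ, ENNReal.ofReal (ψ x) * (ENNReal.ofReal X ^ x.1 * ENNReal.ofReal Y ^ x.2) =
      ENNReal.ofReal (gen ψ X Y) := by
  rw [gen, ENNReal.ofReal_tsum_of_nonneg
    (fun x => mul_nonneg (h0 x) (mul_nonneg (pow_nonneg hX.1 _) (pow_nonneg hY.1 _)))
    (summable_gen h0 hs hX hY)]
  refine tsum_congr fun x => ?_
  rw [ENNReal.ofReal_mul (h0 x), ENNReal.ofReal_mul (pow_nonneg hX.1 _),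
    ENNReal.ofReal_pow hX.1, ENNReal.ofReal_pow hY.1]

lemma gen_nonneg (h0 : ∀ x, 0 ≤ ψ x) (hX : 0 ≤ X) (hY : 0 ≤ Y) : 0 ≤ gen ψ X Y :=
  tsum_nonneg fun x => mul_nonneg (h0 x) (mul_nonneg (pow_nonneg hX _) (pow_nonneg hY _))

lemma gen_one_one : gen ψ 1 1 = ∑' x, ψ x := by simp [gen]

end gen

/-! ### Critical and subcritical offspring laws -/

/-- The offspring law of a female individual. -/
def femaleWeight (ν : ℕ × ℕ → ℝ≥0) (x : ℕ × ℕ) : ℝ := (x.1 + 1) * ν (x.1 + 1, x.2)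

/-- The offspring law of a male individual. -/
def maleWeight (ν : ℕ × ℕ → ℝ≥0) (x : ℕ × ℕ) : ℝ := (x.2 + 1) * ν (x.1, x.2 + 1)

lemma femaleWeight_nonneg (x : ℕ × ℕ) : 0 ≤ femaleWeight ν x := by
  unfold femaleWeight; positivity

lemma maleWeight_nonneg (x : ℕ × ℕ) : 0 ≤ maleWeight ν x := by
  unfold maleWeight; positivity

lemma genMale_eq_tsum_ofReal (X Y : ℝ≥0∞) : genMale ν X Y =
    ∑' x : ℕ × ℕ, ENNReal.ofReal (femaleWeight ν x) * (X ^ x.1 * Y ^ x.2) := by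
  refine tsum_congr fun x => ?_
  congr 1
  rw [femaleWeight, ← ENNReal.ofReal_coe_nnreal]
  push_cast
  rfl

lemma genFemale_eq_tsum_ofReal (X Y : ℝ≥0∞) : genFemale ν X Y =
    ∑' x : ℕ × ℕ, ENNReal.ofReal (maleWeight ν x) * (X ^ x.1 * Y ^ x.2) := by
  refine tsum_congr fun x => ?_
  congr 1
  rw [maleWeight, ← ENNReal.ofReal_coe_nnreal]
  push_cast
  rfl

/-- The weights `ν` have one male and one female arm on average, and second factorial moments
`α`, `β`, `γ` such that the mean matrix of the offspring laws has spectral radius at most one. -/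
structure IsSubcritical (ν : ℕ × ℕ → ℝ≥0) (α β γ : ℝ) : Prop where
  female : HasSum (femaleWeight ν) 1
  male : HasSum (maleWeight ν) 1
  female_fst : HasSum (fun x => femaleWeight ν x * x.1) α
  female_snd : HasSum (fun x => femaleWeight ν x * x.2) γ
  male_fst : HasSum (fun x => maleWeight ν x * x.1) γ
  male_snd : HasSum (fun x => maleWeight ν x * x.2) β
  le_one : γ + √(α * β) ≤ 1

namespace IsSubcritical

variable {α β γ : ℝ} (h : IsSubcritical ν α β γ)
include h

lemma alpha_nonneg : 0 ≤ α :=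
  h.female_fst.nonneg fun x => mul_nonneg (femaleWeight_nonneg x) x.1.cast_nonneg

lemma beta_nonneg : 0 ≤ β :=
  h.male_snd.nonneg fun x => mul_nonneg (maleWeight_nonneg x) x.2.cast_nonneg

lemma gamma_nonneg : 0 ≤ γ :=
  h.female_snd.nonneg fun x => mul_nonneg (femaleWeight_nonneg x) x.2.cast_nonneg

lemma gamma_le_one : γ ≤ 1 := by
  have := h.le_one
  have := Real.sqrt_nonneg (α * β)
  linarith

lemma mul_le_sq : α * β ≤ (1 - γ) ^ 2 :=
  (Real.sqrt_le_left (by linarith [h.gamma_le_one])).1 (by linarith [h.le_one])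

/-- The linearised fixed point equations have no solution but zero. -/
lemma eq_zero_of_le {e f z : ℝ} (he : 0 ≤ e) (hf : 0 ≤ f) (hz0 : 0 ≤ z) (hz1 : z < 1)
    (h1 : e ≤ α * (z * f) + γ * (z * e)) (h2 : f ≤ γ * (z * f) + β * (z * e)) :
    e = 0 ∧ f = 0 := by
  have hγ := h.gamma_le_one
  have hγ0 := h.gamma_nonneg
  have hα := h.alpha_nonneg
  have hβ := h.beta_nonneg
  -- This is `z < 1` in disguise, and the only source of strictness: it makes the argument work even
  -- when the spectral radius equals one.
  have hzγ : z * (1 - γ) < 1 - z * γ := by linarith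
  have hpos : 0 < 1 - z * γ := lt_of_le_of_lt (mul_nonneg hz0 (by linarith)) hzγ
  have h1' : (1 - z * γ) * e ≤ z * α * f := by linarith
  have h2' : (1 - z * γ) * f ≤ z * β * e := by linarith
  have hsq : z ^ 2 * (α * β) < (1 - z * γ) ^ 2 := by
    have := mul_le_mul_of_nonneg_left h.mul_le_sq (sq_nonneg z)
    have h3 : (z * (1 - γ)) ^ 2 < (1 - z * γ) ^ 2 :=
      pow_lt_pow_left₀ hzγ (mul_nonneg hz0 (by linarith)) two_ne_zero
    nlinarith
  -- One row substituted in the other bounds `e` by a multiple of itself with ratio less than one.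
  have hee : (1 - z * γ) ^ 2 * e ≤ z ^ 2 * (α * β) * e := by
    have a1 := mul_le_mul_of_nonneg_left h1' hpos.le
    have a2 := mul_le_mul_of_nonneg_left h2' (mul_nonneg hz0 hα)
    nlinarith
  have he0 : e = 0 := by
    by_contra hne
    have : 0 < e := lt_of_le_of_ne he (Ne.symm hne)
    have := mul_lt_mul_of_pos_right hsq this
    linarith
  refine ⟨he0, ?_⟩
  subst he0
  nlinarith

lemma abs_gen_female_sub_le {X Y X' Y' : ℝ} (hX : X ∈ Set.Icc (0 : ℝ) 1)
    (hY : Y ∈ Set.Icc (0 : ℝ) 1) (hX' : X' ∈ Set.Icc (0 : ℝ) 1) (hY' : Y' ∈ Set.Icc (0 : ℝ) 1) :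
    |gen (femaleWeight ν) X Y - gen (femaleWeight ν) X' Y'| ≤ α * |X - X'| + γ * |Y - Y'| :=
  abs_gen_sub_gen_le femaleWeight_nonneg h.female.summable h.female_fst h.female_snd hX hY hX' hY'

lemma abs_gen_male_sub_le {X Y X' Y' : ℝ} (hX : X ∈ Set.Icc (0 : ℝ) 1)
    (hY : Y ∈ Set.Icc (0 : ℝ) 1) (hX' : X' ∈ Set.Icc (0 : ℝ) 1) (hY' : Y' ∈ Set.Icc (0 : ℝ) 1) :
    |gen (maleWeight ν) X Y - gen (maleWeight ν) X' Y'| ≤ γ * |X - X'| + β * |Y - Y'| :=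
  abs_gen_sub_gen_le maleWeight_nonneg h.male.summable h.male_fst h.male_snd hX hY hX' hY'

lemma genMale_ofReal {X Y : ℝ} (hX : X ∈ Set.Icc (0 : ℝ) 1) (hY : Y ∈ Set.Icc (0 : ℝ) 1) :
    genMale ν (ENNReal.ofReal X) (ENNReal.ofReal Y) =
      ENNReal.ofReal (gen (femaleWeight ν) X Y) := by
  rw [genMale_eq_tsum_ofReal, tsum_ofReal_mul_pow femaleWeight_nonneg h.female.summable hX hY]

lemma genFemale_ofReal {X Y : ℝ} (hX : X ∈ Set.Icc (0 : ℝ) 1) (hY : Y ∈ Set.Icc (0 : ℝ) 1) :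
    genFemale ν (ENNReal.ofReal X) (ENNReal.ofReal Y) =
      ENNReal.ofReal (gen (maleWeight ν) X Y) := by
  rw [genFemale_eq_tsum_ofReal, tsum_ofReal_mul_pow maleWeight_nonneg h.male.summable hX hY]

lemma gen_female_one : gen (femaleWeight ν) 1 1 = 1 := by rw [gen_one_one, h.female.tsum_eq]

lemma gen_male_one : gen (maleWeight ν) 1 1 = 1 := by rw [gen_one_one, h.male.tsum_eq]

end IsSubcritical

/-- `(p, q)` solves the fixed point equations at `(x, y, t)`, in the unit square. -/
structure IsFixedPoint (ν : ℕ × ℕ → ℝ≥0) (x y t p q : ℝ) : Prop where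
  fst_mem : p ∈ Set.Icc (0 : ℝ) 1
  snd_mem : q ∈ Set.Icc (0 : ℝ) 1
  fst_eq : p = gen (femaleWeight ν) (x + t * q) (y + t * p)
  snd_eq : q = gen (maleWeight ν) (x + t * q) (y + t * p)

lemma add_mul_mem_unit {x t q : ℝ} (hx : 0 ≤ x) (ht : 0 ≤ t) (hxt : x + t ≤ 1)
    (hq : q ∈ Set.Icc (0 : ℝ) 1) : x + t * q ∈ Set.Icc (0 : ℝ) 1 :=
  ⟨add_nonneg hx (mul_nonneg ht hq.1),
    (add_le_add_right (mul_le_of_le_one_right ht hq.2) x).trans hxt⟩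

/-- The first moments are Lipschitz constants for the generating functions on the unit square, so
the differences of two solutions satisfy the linearised inequalities with `z = t < 1`. -/
lemma IsFixedPoint.unique {α β γ : ℝ} (h : IsSubcritical ν α β γ) {x y t p q p' q' : ℝ}
    (hx : 0 ≤ x) (hy : 0 ≤ y) (ht : 0 ≤ t) (ht1 : t < 1) (hxt : x + t ≤ 1) (hyt : y + t ≤ 1)
    (h1 : IsFixedPoint ν x y t p q) (h2 : IsFixedPoint ν x y t p' q') : p = p' ∧ q = q' := by
  have a1 := h.abs_gen_female_sub_le (add_mul_mem_unit hx ht hxt h1.snd_mem)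
    (add_mul_mem_unit hy ht hyt h1.fst_mem) (add_mul_mem_unit hx ht hxt h2.snd_mem)
    (add_mul_mem_unit hy ht hyt h2.fst_mem)
  have a2 := h.abs_gen_male_sub_le (add_mul_mem_unit hx ht hxt h1.snd_mem)
    (add_mul_mem_unit hy ht hyt h1.fst_mem) (add_mul_mem_unit hx ht hxt h2.snd_mem)
    (add_mul_mem_unit hy ht hyt h2.fst_mem)
  rw [← h1.fst_eq, ← h2.fst_eq] at a1
  rw [← h1.snd_eq, ← h2.snd_eq] at a2
  simp only [add_sub_add_left_eq_sub, ← mul_sub, abs_mul, abs_of_nonneg ht] at a1 a2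
  obtain ⟨e1, e2⟩ := h.eq_zero_of_le (abs_nonneg _) (abs_nonneg _) ht ht1 a1 a2
  exact ⟨sub_eq_zero.1 (abs_eq_zero.1 e1), sub_eq_zero.1 (abs_eq_zero.1 e2)⟩

/-- A point with nonnegative real coordinates, as a point with coordinates in `[0, ∞]`. -/
def armPoint (x y t : ℝ) : Fin 3 → ℝ≥0∞ :=
  ![ENNReal.ofReal x, ENNReal.ofReal y, ENNReal.ofReal t]

/-- The value of `treeSeriesMale` at a point with real coordinates. -/
def valMale (ν : ℕ × ℕ → ℝ≥0) (x y t : ℝ) : ℝ≥0∞ := evalSeries (armPoint x y t) (treeSeriesMale ν)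

/-- The value of `treeSeriesFemale` at a point with real coordinates. -/
def valFemale (ν : ℕ × ℕ → ℝ≥0) (x y t : ℝ) : ℝ≥0∞ :=
  evalSeries (armPoint x y t) (treeSeriesFemale ν)

namespace IsSubcritical

variable {α β γ : ℝ} (h : IsSubcritical ν α β γ) {x y t : ℝ}
include h

/-- The offspring weights have total mass one and `x + t`, `y + t` are at most `1`, so `(1, 1)` is a
supersolution. -/
lemma val_le_one (hx : 0 ≤ x) (hy : 0 ≤ y) (ht : 0 ≤ t) (hxt : x + t ≤ 1) (hyt : y + t ≤ 1) :
    valMale ν x y t ≤ 1 ∧ valFemale ν x y t ≤ 1 := by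
  have hX : ENNReal.ofReal x + ENNReal.ofReal t * 1 ≤ ENNReal.ofReal 1 := by
    rw [mul_one, ← ENNReal.ofReal_add hx ht]
    exact ENNReal.ofReal_le_ofReal hxt
  have hY : ENNReal.ofReal y + ENNReal.ofReal t * 1 ≤ ENNReal.ofReal 1 := by
    rw [mul_one, ← ENNReal.ofReal_add hy ht]
    exact ENNReal.ofReal_le_ofReal hyt
  refine evalSeries_le_of_supersolution _ ((genMale_mono hX hY).trans ?_)
    ((genFemale_mono hX hY).trans ?_)
  · rw [h.genMale_ofReal (by simp) (by simp), h.gen_female_one, ENNReal.ofReal_one]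
  · rw [h.genFemale_ofReal (by simp) (by simp), h.gen_male_one, ENNReal.ofReal_one]

lemma isFixedPoint_val (hx : 0 ≤ x) (hy : 0 ≤ y) (ht : 0 ≤ t) (hxt : x + t ≤ 1)
    (hyt : y + t ≤ 1) :
    IsFixedPoint ν x y t (valMale ν x y t).toReal (valFemale ν x y t).toReal := by
  obtain ⟨hp, hq⟩ := h.val_le_one hx hy ht hxt hyt
  have hpm : (valMale ν x y t).toReal ∈ Set.Icc (0 : ℝ) 1 :=
    ⟨ENNReal.toReal_nonneg, ENNReal.toReal_le_of_le_ofReal zero_le_one (by simpa using hp)⟩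
  have hqm : (valFemale ν x y t).toReal ∈ Set.Icc (0 : ℝ) 1 :=
    ⟨ENNReal.toReal_nonneg, ENNReal.toReal_le_of_le_ofReal zero_le_one (by simpa using hq)⟩
  have hp' : ENNReal.ofReal (valMale ν x y t).toReal = valMale ν x y t :=
    ENNReal.ofReal_toReal (hp.trans_lt ENNReal.one_lt_top).ne
  have hq' : ENNReal.ofReal (valFemale ν x y t).toReal = valFemale ν x y t :=
    ENNReal.ofReal_toReal (hq.trans_lt ENNReal.one_lt_top).ne
  have hX : ENNReal.ofReal x + ENNReal.ofReal t * valFemale ν x y t =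
      ENNReal.ofReal (x + t * (valFemale ν x y t).toReal) := by
    rw [ENNReal.ofReal_add hx (mul_nonneg ht hqm.1), ENNReal.ofReal_mul ht, hq']
  have hY : ENNReal.ofReal y + ENNReal.ofReal t * valMale ν x y t =
      ENNReal.ofReal (y + t * (valMale ν x y t).toReal) := by
    rw [ENNReal.ofReal_add hy (mul_nonneg ht hpm.1), ENNReal.ofReal_mul ht, hp']
  have hXm := add_mul_mem_unit hx ht hxt hqm
  have hYm := add_mul_mem_unit hy ht hyt hpm
  refine ⟨hpm, hqm, ?_, ?_⟩
  · have := evalSeries_treeSeriesMale (ν := ν) (armPoint x y t)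
    change valMale ν x y t = genMale ν (ENNReal.ofReal x + ENNReal.ofReal t * valFemale ν x y t)
      (ENNReal.ofReal y + ENNReal.ofReal t * valMale ν x y t) at this
    rw [hX, hY, h.genMale_ofReal hXm hYm] at this
    conv_lhs => rw [this]
    exact ENNReal.toReal_ofReal (gen_nonneg femaleWeight_nonneg hXm.1 hYm.1)
  · have := evalSeries_treeSeriesFemale (ν := ν) (armPoint x y t)
    change valFemale ν x y t =
      genFemale ν (ENNReal.ofReal x + ENNReal.ofReal t * valFemale ν x y t)
      (ENNReal.ofReal y + ENNReal.ofReal t * valMale ν x y t) at this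
    rw [hX, hY, h.genFemale_ofReal hXm hYm] at this
    conv_lhs => rw [this]
    exact ENNReal.toReal_ofReal (gen_nonneg maleWeight_nonneg hXm.1 hYm.1)

/-- Along the characteristic started from `(1, 1)`, the derivatives of the solution keep their
initial value one. -/
lemma val_eq_one (ht : 0 ≤ t) (ht1 : t < 1) :
    valMale ν (1 - t) (1 - t) t = 1 ∧ valFemale ν (1 - t) (1 - t) t = 1 := by
  have hx : 0 ≤ 1 - t := by linarith
  have hxt : 1 - t + t ≤ 1 := by linarith
  have h2 : IsFixedPoint ν (1 - t) (1 - t) t 1 1 := by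
    refine ⟨by simp, by simp, ?_, ?_⟩
    · rw [mul_one, sub_add_cancel, h.gen_female_one]
    · rw [mul_one, sub_add_cancel, h.gen_male_one]
  obtain ⟨e1, e2⟩ := (h.isFixedPoint_val hx hx ht hxt hxt).unique h hx hx ht ht1 hxt hxt h2
  exact ⟨(ENNReal.toReal_eq_one_iff _).1 e1, (ENNReal.toReal_eq_one_iff _).1 e2⟩

/-- For small `t`, the derivatives of the solution are Lipschitz along the diagonal at the end point
of the characteristic started from `(1, 1)`. -/
lemma one_sub_val_le {δ : ℝ} (ht : 0 ≤ t) (hL : t * (α + β + 2 * γ) ≤ 1 / 2) (hδ : 0 ≤ δ)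
    (hδt : δ ≤ 1 - t) :
    1 - (valMale ν (1 - t - δ) (1 - t - δ) t).toReal ≤ 2 * (α + β + 2 * γ) * δ ∧
      1 - (valFemale ν (1 - t - δ) (1 - t - δ) t).toReal ≤ 2 * (α + β + 2 * γ) * δ := by
  have hx : 0 ≤ 1 - t - δ := by linarith
  have hxt : 1 - t - δ + t ≤ 1 := by linarith
  have h1 := h.isFixedPoint_val hx hx ht hxt hxt
  set p := (valMale ν (1 - t - δ) (1 - t - δ) t).toReal
  set q := (valFemale ν (1 - t - δ) (1 - t - δ) t).toReal
  have hX := add_mul_mem_unit hx ht hxt h1.snd_mem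
  have hY := add_mul_mem_unit hx ht hxt h1.fst_mem
  have hone : (1 : ℝ) ∈ Set.Icc (0 : ℝ) 1 := by simp
  have a1 := h.abs_gen_female_sub_le hone hone hX hY
  have a2 := h.abs_gen_male_sub_le hone hone hX hY
  rw [← h1.fst_eq, h.gen_female_one, abs_of_nonneg (by linarith [h1.fst_mem.2]),
    abs_of_nonneg (by linarith [hX.2]), abs_of_nonneg (by linarith [hY.2])] at a1
  rw [← h1.snd_eq, h.gen_male_one, abs_of_nonneg (by linarith [h1.snd_mem.2]),
    abs_of_nonneg (by linarith [hX.2]), abs_of_nonneg (by linarith [hY.2])] at a2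
  have hα := h.alpha_nonneg
  have hβ := h.beta_nonneg
  have hγ := h.gamma_nonneg
  have hp := h1.fst_mem.2
  have hq := h1.snd_mem.2
  -- The sum of the two Lipschitz bounds, with `1 - (1 - t - δ + t q) = δ + t (1 - q)` and likewise
  -- for `p`. The smallness of `t` then lets half of the left side absorb the unknowns on the right.
  have hE : (1 - p) + (1 - q) ≤ (α + β + 2 * γ) * (δ + t * ((1 - p) + (1 - q))) := by
    have b1 : 0 ≤ t * (1 - p) := mul_nonneg ht (by linarith)
    have b2 : 0 ≤ t * (1 - q) := mul_nonneg ht (by linarith)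
    have c1 := mul_nonneg hα b1
    have c2 := mul_nonneg hβ b2
    have c3 := mul_nonneg hγ b1
    have c4 := mul_nonneg hγ b2
    have c5 := mul_nonneg hα hδ
    have c6 := mul_nonneg hβ hδ
    nlinarith
  have hE2 : t * (α + β + 2 * γ) * ((1 - p) + (1 - q)) ≤ 1 / 2 * ((1 - p) + (1 - q)) :=
    mul_le_mul_of_nonneg_right hL (by linarith)
  constructor <;> nlinarith

end IsSubcritical


/-! ### Particles and exponents -/

/-- The exponent `(a, b, m - 1)` of a particle. -/
def armIndex (p : Particle) : Fin 3 →₀ ℕ :=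
  Finsupp.equivFunOnFinite.symm ![p.1, p.2.1, p.2.2.natPred]

@[simp] lemma armIndex_zero (p : Particle) : armIndex p 0 = p.1 := rfl

@[simp] lemma armIndex_one (p : Particle) : armIndex p 1 = p.2.1 := rfl

@[simp] lemma armIndex_two (p : Particle) : armIndex p 2 = p.2.2.natPred := rfl

lemma Finsupp.ext_fin_three {d e : Fin 3 →₀ ℕ} (h0 : d 0 = e 0) (h1 : d 1 = e 1)
    (h2 : d 2 = e 2) : d = e := by
  ext i
  fin_cases i
  exacts [h0, h1, h2]

/-- Particles correspond to exponents. -/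
def particleEquiv : Particle ≃ (Fin 3 →₀ ℕ) where
  toFun := armIndex
  invFun d := (d 0, d 1, (d 2).succPNat)
  left_inv p := by simp
  right_inv d := Finsupp.ext_fin_three (by simp) (by simp) (by simp)

namespace Particle

lemma mem_parts {p p' : Particle} :
    p' ∈ parts p ↔ p'.1 < p.1 + 2 ∧ p'.2.1 < p.2.1 + 2 ∧ (p'.2.2 : ℕ) < p.2.2 := by
  simp [parts]

lemma fst_rest_add {p p' : Particle} (h : p' ∈ parts p) : (rest p p').1 + p'.1 = p.1 + 1 := by
  have := (mem_parts.1 h).1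
  simp only [rest]
  omega

lemma snd_rest_add {p p' : Particle} (h : p' ∈ parts p) :
    (rest p p').2.1 + p'.2.1 = p.2.1 + 1 := by
  have := (mem_parts.1 h).2.1
  simp only [rest]
  omega

lemma mass_rest_add {p p' : Particle} (h : p' ∈ parts p) :
    ((rest p p').2.2 : ℕ) + p'.2.2 = p.2.2 := by
  have := (mem_parts.1 h).2.2
  simp only [rest, PNat.sub_coe]
  rw [if_pos (by exact_mod_cast this)]
  omega

lemma ext_nat {p q : Particle} (h0 : p.1 = q.1) (h1 : p.2.1 = q.2.1)
    (h2 : (p.2.2 : ℕ) = q.2.2) : p = q :=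
  Prod.ext h0 (Prod.ext h1 (PNat.eq h2))

lemma rest_mem_parts {p p' : Particle} (h : p' ∈ parts p) : rest p p' ∈ parts p := by
  have h0 := fst_rest_add h
  have h1 := snd_rest_add h
  have h2 := mass_rest_add h
  have := p'.2.2.pos
  rw [mem_parts]
  omega

lemma rest_rest {p p' : Particle} (h : p' ∈ parts p) : rest p (rest p p') = p' := by
  have h0 := fst_rest_add h
  have h1 := snd_rest_add h
  have h2 := mass_rest_add h
  have h0' := fst_rest_add (rest_mem_parts h)
  have h1' := snd_rest_add (rest_mem_parts h)
  have h2' := mass_rest_add (rest_mem_parts h)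
  exact ext_nat (by omega) (by omega) (by omega)

lemma natPred_rest_add {p p' : Particle} (h : p' ∈ parts p) :
    (rest p p').2.2.natPred + p'.2.2.natPred + 1 = p.2.2.natPred := by
  have h2 := mass_rest_add h
  have := p'.2.2.natPred_add_one
  have := p.2.2.natPred_add_one
  have := (rest p p').2.2.natPred_add_one
  omega

/-- The gain term, with the arms that are paired singled out. -/
lemma half_sum_parts (f : Particle → ℝ) (p : Particle) :
    (1 / 2) * ∑ p' ∈ parts p, rate p' (rest p p') * f p' * f (rest p p') =
      ∑ p' ∈ parts p, (p'.male * f p') * ((rest p p').female * f (rest p p')) := by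
  -- The involution `rest p` exchanges the two ways of pairing a male arm with a female one, which
  -- explains the factor `1 / 2`.
  have hswap : ∑ p' ∈ parts p, (p'.male * f p') * ((rest p p').female * f (rest p p')) =
      ∑ p' ∈ parts p, ((rest p p').male * f (rest p p')) * (p'.female * f p') := by
    refine Finset.sum_nbij' (rest p) (rest p) (fun _ => rest_mem_parts) (fun _ => rest_mem_parts)
      (fun _ => rest_rest) (fun _ => rest_rest) fun q hq => ?_
    rw [rest_rest hq]
  have hsum : ∑ p' ∈ parts p, rate p' (rest p p') * f p' * f (rest p p') =
      ∑ p' ∈ parts p, (p'.male * f p') * ((rest p p').female * f (rest p p')) +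
      ∑ p' ∈ parts p, ((rest p p').male * f (rest p p')) * (p'.female * f p') := by
    rw [← Finset.sum_add_distrib]
    refine Finset.sum_congr rfl fun q _ => ?_
    rw [rate]
    ring
  rw [hsum, ← hswap]
  ring

end Particle

open Particle

/-- The limiting profile of the concentrations: `treeCoeff` as a function of the particle. -/
def treeConc (ν : ℕ × ℕ → ℝ≥0) (p : Particle) : ℝ := treeCoeff ν (armIndex p)

lemma treeConc_nonneg (p : Particle) : 0 ≤ treeConc ν p := NNReal.coe_nonneg _

lemma treeConc_of_mass_one {p : Particle} (hp : p.2.2 = 1) :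
    treeConc ν p = ν (p.1, p.2.1) := by
  rw [treeConc, treeCoeff, dif_pos (by simp [hp, PNat.natPred])]
  simp

lemma treeCoeff_succ (d : Fin 3 →₀ ℕ) :
    treeCoeff ν (d + single 2 1) * (d 2 + 1) = ∑ ef ∈ antidiagonal d,
      (treeCoeff ν (ef.1 + single 0 1) * (ef.1 0 + 1)) *
        (treeCoeff ν (ef.2 + single 1 1) * (ef.2 1 + 1)) := by
  classical
  have h := congrArg (MvPowerSeries.coeff d) (pderiv_two_treeSeries (ν := ν))
  rw [MvPowerSeries.coeff_mul, MvPowerSeries.coeff_pderiv, coeff_treeSeries] at h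
  rw [h]
  refine Finset.sum_congr rfl fun ef _ => ?_
  simp only [treeSeriesMale, treeSeriesFemale, MvPowerSeries.coeff_pderiv, coeff_treeSeries]

/-- The profile solves the stationary form of the coagulation equation. -/
lemma natPred_mul_treeConc (p : Particle) :
    (p.2.2.natPred : ℝ) * treeConc ν p =
      (1 / 2) * ∑ p' ∈ parts p, rate p' (rest p p') * treeConc ν p' * treeConc ν (rest p p') := by
  classical
  rw [half_sum_parts]
  rcases Nat.eq_zero_or_pos p.2.2.natPred with hp | hp
  · rw [hp, Nat.cast_zero, zero_mul, Finset.sum_eq_zero]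
    intro q hq
    have := natPred_rest_add hq
    omega
  · set d : Fin 3 →₀ ℕ := armIndex p - single 2 1 with hd
    have hpd : armIndex p = d + single 2 1 := by
      rw [hd, tsub_add_cancel_of_le]
      rw [Finsupp.single_le_iff, armIndex_two]
      exact hp
    have hd0 : d 0 = p.1 := by rw [← armIndex_zero, hpd]; simp
    have hd1 : d 1 = p.2.1 := by rw [← armIndex_one, hpd]; simp
    have hd2 : d 2 + 1 = p.2.2.natPred := by rw [← armIndex_two, hpd]; simp
    have h := congrArg (fun r : ℝ≥0 => (r : ℝ)) (treeCoeff_succ (ν := ν) d)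
    simp only [NNReal.coe_mul, NNReal.coe_sum, NNReal.coe_add, NNReal.coe_natCast,
      NNReal.coe_one] at h
    rw [treeConc, hpd, mul_comm, ← hd2, Nat.cast_succ, h]
    have hm := p.2.2.natPred_add_one
    -- The two exponents describe the constituents after removal of a male arm from the first and a
    -- female arm from the second. Constituents not reached in this way lack one of these arms and
    -- contribute zero.
    refine Finset.sum_of_injOn (fun ef => (ef.1 0 + 1, ef.1 1, (ef.1 2).succPNat)) ?_ ?_ ?_ ?_
    · intro ef hef ef' hef' heq
      simp only [Prod.mk.injEq, add_left_inj, Nat.succPNat_inj] at heq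
      have h1 : ef.1 = ef'.1 := Finsupp.ext_fin_three heq.1 heq.2.1 heq.2.2
      have a1 := Finset.HasAntidiagonal.mem_antidiagonal.1 (Finset.mem_coe.1 hef)
      have a2 := Finset.HasAntidiagonal.mem_antidiagonal.1 (Finset.mem_coe.1 hef')
      refine Prod.ext h1 ?_
      rw [← a2, h1] at a1
      exact add_left_cancel a1
    · intro ef hef
      have a := Finset.HasAntidiagonal.mem_antidiagonal.1 (Finset.mem_coe.1 hef)
      have a0 := DFunLike.congr_fun a 0
      have a1 := DFunLike.congr_fun a 1
      have a2 := DFunLike.congr_fun a 2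
      simp only [Finsupp.add_apply] at a0 a1 a2
      rw [Finset.mem_coe, mem_parts]
      simp only [Nat.succPNat_coe, Nat.succ_eq_add_one]
      omega
    · intro q hq hnot
      have r0 := fst_rest_add hq
      have r1 := snd_rest_add hq
      have r2 := natPred_rest_add hq
      by_cases hq0 : q.1 = 0
      · simp [male, hq0]
      by_cases hr1 : (rest p q).2.1 = 0
      · simp [female, hr1]
      refine absurd ?_ hnot
      refine ⟨(armIndex q - single 0 1, armIndex (rest p q) - single 1 1), ?_, ?_⟩
      · rw [Finset.mem_coe, Finset.HasAntidiagonal.mem_antidiagonal]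
        refine Finsupp.ext_fin_three ?_ ?_ ?_
        · simp; omega
        · simp; omega
        · simp; omega
      · refine Particle.ext_nat ?_ ?_ ?_
        · simp; omega
        · simp
        · simp
    · intro ef hef
      have a := Finset.HasAntidiagonal.mem_antidiagonal.1 hef
      have a0 := DFunLike.congr_fun a 0
      have a1 := DFunLike.congr_fun a 1
      have a2 := DFunLike.congr_fun a 2
      simp only [Finsupp.add_apply] at a0 a1 a2
      have hq : ((ef.1 0 + 1, ef.1 1, (ef.1 2).succPNat) : Particle) ∈ parts p := by
        rw [mem_parts]
        simp only [Nat.succPNat_coe, Nat.succ_eq_add_one]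
        omega
      have r0 := fst_rest_add hq
      have r1 := snd_rest_add hq
      have r2 := natPred_rest_add hq
      simp only [Nat.natPred_succPNat] at r0 r1 r2
      have e1 : armIndex (ef.1 0 + 1, ef.1 1, (ef.1 2).succPNat) = ef.1 + single 0 1 :=
        Finsupp.ext_fin_three (by simp) (by simp) (by simp)
      have e2 : armIndex (rest p (ef.1 0 + 1, ef.1 1, (ef.1 2).succPNat)) = ef.2 + single 1 1 :=
        Finsupp.ext_fin_three (by simp; omega) (by simp; omega) (by simp; omega)
      have e3 : (rest p (ef.1 0 + 1, ef.1 1, (ef.1 2).succPNat)).2.1 = ef.2 1 + 1 := by omega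
      simp only [treeConc, e1, e2, male, female, e3]
      push_cast
      ring

/-! ### Sums over particles -/

lemma tsum_particle (f : (Fin 3 →₀ ℕ) → ℝ≥0∞) : ∑' p, f (armIndex p) = ∑' d, f d :=
  particleEquiv.tsum_eq f

lemma coeff_X_mul_pderiv (i : Fin 3) (f : ArmSeries) (d : Fin 3 →₀ ℕ) :
    MvPowerSeries.coeff d (MvPowerSeries.X i * MvPowerSeries.pderiv ℝ≥0 i f) =
      MvPowerSeries.coeff d f * d i := by
  classical
  rw [MvPowerSeries.X, MvPowerSeries.coeff_monomial_mul]
  split_ifs with h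
  · rw [one_mul, MvPowerSeries.coeff_pderiv, tsub_add_cancel_of_le h]
    have := Finsupp.single_le_iff.1 h
    congr 1
    rw [Finsupp.tsub_apply, Finsupp.single_eq_same]
    exact_mod_cast Nat.sub_add_cancel this
  · have : d i = 0 := by
      rw [Finsupp.single_le_iff] at h
      omega
    simp [this]

/-- The concentration profile with weights `x`, `y`, `t` for male arms, female arms and mass. -/
def scaledConc (ν : ℕ × ℕ → ℝ≥0) (x y t : ℝ) (p : Particle) : ℝ :=
  treeConc ν p * (x ^ p.1 * y ^ p.2.1 * t ^ p.2.2.natPred)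

lemma ofReal_scaledConc {x y t : ℝ} (hx : 0 ≤ x) (hy : 0 ≤ y) (ht : 0 ≤ t) (p : Particle) :
    ENNReal.ofReal (scaledConc ν x y t p) =
      (treeCoeff ν (armIndex p) : ℝ≥0∞) * armMonomial (armPoint x y t) (armIndex p) := by
  rw [scaledConc, treeConc, ENNReal.ofReal_mul (NNReal.coe_nonneg _), ENNReal.ofReal_coe_nnreal,
    ENNReal.ofReal_mul (by positivity), ENNReal.ofReal_mul (by positivity),
    ENNReal.ofReal_pow hx, ENNReal.ofReal_pow hy, ENNReal.ofReal_pow ht, armMonomial,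
    Fin.prod_univ_three]
  rfl

lemma scaledConc_nonneg {x y t : ℝ} (hx : 0 ≤ x) (hy : 0 ≤ y) (ht : 0 ≤ t) (p : Particle) :
    0 ≤ scaledConc ν x y t p :=
  mul_nonneg (treeConc_nonneg p) (by positivity)

/-- Counting arms of one kind amounts to applying `xᵢ ∂ᵢ` to the generating series. -/
lemma tsum_ofReal_scaledConc_mul_arms {x y t : ℝ} (hx : 0 ≤ x) (hy : 0 ≤ y) (ht : 0 ≤ t)
    (i : Fin 3) :
    ∑' p, ENNReal.ofReal (scaledConc ν x y t p * armIndex p i) = armPoint x y t i *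
      evalSeries (armPoint x y t) (MvPowerSeries.pderiv ℝ≥0 i (treeSeries ν)) := by
  rw [← evalSeries_X (armPoint x y t) i, ← evalSeries_mul, evalSeries, ← tsum_particle]
  refine tsum_congr fun p => ?_
  rw [ENNReal.ofReal_mul (scaledConc_nonneg hx hy ht p), ofReal_scaledConc hx hy ht,
    coeff_X_mul_pderiv, coeff_treeSeries, ENNReal.ofReal_natCast]
  push_cast
  ring

lemma tsum_ofReal_scaledConc_mul_male {x y t : ℝ} (hx : 0 ≤ x) (hy : 0 ≤ y) (ht : 0 ≤ t) :
    ∑' p, ENNReal.ofReal (scaledConc ν x y t p * p.male) =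
      ENNReal.ofReal x * valMale ν x y t :=
  tsum_ofReal_scaledConc_mul_arms hx hy ht 0

lemma tsum_ofReal_scaledConc_mul_female {x y t : ℝ} (hx : 0 ≤ x) (hy : 0 ≤ y) (ht : 0 ≤ t) :
    ∑' p, ENNReal.ofReal (scaledConc ν x y t p * p.female) =
      ENNReal.ofReal y * valFemale ν x y t :=
  tsum_ofReal_scaledConc_mul_arms hx hy ht 1

lemma hasSum_of_tsum_ofReal {ι : Type*} {f : ι → ℝ} {s : ℝ} (hf : ∀ i, 0 ≤ f i) (hs : 0 ≤ s)
    (h : ∑' i, ENNReal.ofReal (f i) = ENNReal.ofReal s) : HasSum f s := by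
  have hne : ∑' i, ENNReal.ofReal (f i) ≠ ∞ := h ▸ ENNReal.ofReal_ne_top
  have := ENNReal.hasSum_toReal hne
  rw [← ENNReal.tsum_toReal_eq fun i => ENNReal.ofReal_ne_top, h, ENNReal.toReal_ofReal hs] at this
  simpa only [ENNReal.toReal_ofReal (hf _)] using this

/-- The total mass created per unit of `t` among particles without arms. -/
lemma tsum_armless_eq {t : ℝ} (ht : 0 ≤ t) :
    ∑' n : ℕ, ENNReal.ofReal ((n + 1) * treeConc ν (0, 0, (n + 1).succPNat) * t ^ n) =
      valMale ν 0 0 t * valFemale ν 0 0 t := by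
  have hinj : Function.Injective fun n : ℕ => single (2 : Fin 3) n :=
    Finsupp.single_injective 2
  rw [valMale, valFemale, ← evalSeries_mul, ← pderiv_two_treeSeries, evalSeries,
    ← hinj.tsum_eq (f := fun d => ((MvPowerSeries.coeff d
      (MvPowerSeries.pderiv ℝ≥0 2 (treeSeries ν)) : ℝ≥0) : ℝ≥0∞) *
        armMonomial (armPoint 0 0 t) d)]
  · refine tsum_congr fun n => ?_
    have hidx : armIndex (0, 0, (n + 1).succPNat) = single 2 n + single 2 1 :=
      Finsupp.ext_fin_three (by simp) (by simp) (by simp)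
    rw [treeConc, hidx, MvPowerSeries.coeff_pderiv, coeff_treeSeries, armMonomial,
      Fin.prod_univ_three, ENNReal.ofReal_mul (by positivity), ENNReal.ofReal_mul (by positivity),
      ENNReal.ofReal_coe_nnreal, ENNReal.ofReal_pow ht]
    have : ENNReal.ofReal ((n : ℝ) + 1) = (n : ℝ≥0∞) + 1 := by
      exact_mod_cast ENNReal.ofReal_natCast (n + 1)
    rw [this]
    simp [armPoint]
    ring
  · intro d hd
    have hd' : armMonomial (armPoint 0 0 t) d ≠ 0 := fun h0 => hd (by simp [h0])
    rw [armMonomial, Fin.prod_univ_three] at hd'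
    have h0 : d 0 = 0 := by
      by_contra h
      simp [armPoint, h] at hd'
    have h1 : d 1 = 0 := by
      by_contra h
      simp [armPoint, h] at hd'
    exact ⟨d 2, Finsupp.ext_fin_three (by simp [h0]) (by simp [h1]) (by simp)⟩


/-! ### Existence of a solution -/

/-- The gain term of the scaled profile. -/
lemma gain_scaledConc (x y t : ℝ) (p : Particle) :
    (1 / 2) * ∑ p' ∈ parts p, rate p' (rest p p') * scaledConc ν x y t p' *
        scaledConc ν x y t (rest p p') =
      p.2.2.natPred * treeConc ν p * (x ^ (p.1 + 1) * y ^ (p.2.1 + 1) * t ^ (p.2.2.natPred - 1)) := by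
  rw [natPred_mul_treeConc, mul_assoc, Finset.sum_mul]
  congr 1
  refine Finset.sum_congr rfl fun q hq => ?_
  have h0 := fst_rest_add hq
  have h1 := snd_rest_add hq
  have h2 := natPred_rest_add hq
  rw [← h0, ← h1, ← h2, Nat.add_sub_cancel]
  simp only [scaledConc, pow_add]
  ring

lemma tsum_rate_mul {c : Particle → ℝ} {A B : ℝ} (hA : HasSum (fun p => c p * p.male) A)
    (hB : HasSum (fun p => c p * p.female) B) (p : Particle) :
    ∑' p', rate p p' * c p' = p.female * A + p.male * B := by
  rw [← ((hA.mul_left p.female).add (hB.mul_left p.male)).tsum_eq]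
  refine tsum_congr fun q => ?_
  rw [rate]
  ring

namespace IsSubcritical

variable {α β γ : ℝ} (h : IsSubcritical ν α β γ) {t : ℝ}
include h

lemma hasSum_scaledConc_male (ht : 0 ≤ t) (ht1 : t < 1) :
    HasSum (fun p => scaledConc ν (1 - t) (1 - t) t p * p.male) (1 - t) := by
  have hx : 0 ≤ 1 - t := by linarith
  refine hasSum_of_tsum_ofReal
    (fun p => mul_nonneg (scaledConc_nonneg hx hx ht p) (Nat.cast_nonneg _)) hx ?_
  rw [tsum_ofReal_scaledConc_mul_male hx hx ht, (h.val_eq_one ht ht1).1, mul_one]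

lemma hasSum_scaledConc_female (ht : 0 ≤ t) (ht1 : t < 1) :
    HasSum (fun p => scaledConc ν (1 - t) (1 - t) t p * p.female) (1 - t) := by
  have hx : 0 ≤ 1 - t := by linarith
  refine hasSum_of_tsum_ofReal
    (fun p => mul_nonneg (scaledConc_nonneg hx hx ht p) (Nat.cast_nonneg _)) hx ?_
  rw [tsum_ofReal_scaledConc_mul_female hx hx ht, (h.val_eq_one ht ht1).2, mul_one]

end IsSubcritical

/-! ### Finiteness of second moments for small times -/

lemma pow_add_mul_le_pow {x y δ : ℝ} (hy : 0 ≤ y) (hδ : 0 ≤ δ) (hx : x = y + δ) (hx1 : x ≤ 1)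
    (n : ℕ) : n * δ * y ^ n ≤ x ^ n - y ^ n := by
  induction n with
  | zero => simp
  | succ n ih =>
    have hyn := pow_nonneg hy n
    have h1 : 0 ≤ x * (x ^ n - y ^ n - n * δ * y ^ n) := mul_nonneg (by linarith) (by linarith)
    have h2 : 0 ≤ δ * y ^ n * (1 - y) := mul_nonneg (mul_nonneg hδ hyn) (by linarith)
    have h3 : 0 ≤ (n : ℝ) * δ * y ^ n * δ := by positivity
    subst hx
    push_cast
    rw [pow_succ, pow_succ]
    nlinarith

/-- A sum of powers that is Lipschitz at `x` from the left has a finite derivative at `x`. -/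
lemma summable_mul_pow_of_lipschitz {ι : Type*} {w : ι → ℝ} {n : ι → ℕ} {x C : ℝ}
    (hw : ∀ i, 0 ≤ w i) (hx0 : 0 < x) (hx1 : x ≤ 1)
    (hs : ∀ y, 0 ≤ y → y ≤ x → Summable fun i => w i * y ^ n i)
    (hC : ∀ y, 0 ≤ y → y < x → ∑' i, w i * x ^ n i - ∑' i, w i * y ^ n i ≤ C * (x - y)) :
    Summable fun i => w i * n i * x ^ n i := by
  refine summable_of_sum_le (c := C)
    (fun i => mul_nonneg (mul_nonneg (hw i) (n i).cast_nonneg) (pow_nonneg hx0.le _)) fun F => ?_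
  -- The difference quotient of each term between `y` and `x` is at least `w n yⁿ`; here `x ≤ 1`
  -- allows `yⁿ` instead of `y^(n-1)`. Finite sums at `y < x` are thus at most `C`, and `y` may tend
  -- to `x`.
  have hcont : Continuous fun y : ℝ => ∑ i ∈ F, w i * n i * y ^ n i := by fun_prop
  have htend : Tendsto (fun y : ℝ => ∑ i ∈ F, w i * n i * y ^ n i) (𝓝[<] x)
      (𝓝 (∑ i ∈ F, w i * n i * x ^ n i)) := hcont.continuousAt.tendsto.mono_left inf_le_left
  refine le_of_tendsto htend ?_
  filter_upwards [Ioo_mem_nhdsLT hx0] with y hy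
  have hδ : 0 < x - y := sub_pos.2 hy.2
  refine le_of_mul_le_mul_right ?_ hδ
  refine le_trans ?_ (hC y hy.1.le hy.2)
  rw [← (hs x hx0.le le_rfl).tsum_sub (hs y hy.1.le hy.2.le), Finset.sum_mul]
  refine le_trans (Finset.sum_le_sum fun i _ => ?_)
    (((hs x hx0.le le_rfl).sub (hs y hy.1.le hy.2.le)).sum_le_tsum F fun i _ => ?_)
  · have := mul_le_mul_of_nonneg_left
      (pow_add_mul_le_pow hy.1.le hδ.le (by ring) hx1 (n i)) (hw i)
    calc _ = w i * (n i * (x - y) * y ^ n i) := by ring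
      _ ≤ w i * (x ^ n i - y ^ n i) := this
      _ = _ := by ring
  · rw [← mul_sub]
    exact mul_nonneg (hw i) (sub_nonneg.2 (pow_le_pow_left₀ hy.1.le hy.2.le _))

namespace IsSubcritical

variable {α β γ : ℝ} (h : IsSubcritical ν α β γ) {t : ℝ}
include h

lemma hasSum_scaledConc_male_diag {x : ℝ} (hx : 0 ≤ x) (ht : 0 ≤ t) (hxt : x + t ≤ 1) :
    HasSum (fun p => scaledConc ν x x t p * p.male) (x * (valMale ν x x t).toReal) := by
  refine hasSum_of_tsum_ofReal
    (fun p => mul_nonneg (scaledConc_nonneg hx hx ht p) (Nat.cast_nonneg _))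
    (mul_nonneg hx ENNReal.toReal_nonneg) ?_
  rw [tsum_ofReal_scaledConc_mul_male hx hx ht, ENNReal.ofReal_mul hx, ENNReal.ofReal_toReal]
  exact ((h.val_le_one hx hx ht hxt hxt).1.trans_lt ENNReal.one_lt_top).ne

lemma hasSum_scaledConc_female_diag {x : ℝ} (hx : 0 ≤ x) (ht : 0 ≤ t) (hxt : x + t ≤ 1) :
    HasSum (fun p => scaledConc ν x x t p * p.female) (x * (valFemale ν x x t).toReal) := by
  refine hasSum_of_tsum_ofReal
    (fun p => mul_nonneg (scaledConc_nonneg hx hx ht p) (Nat.cast_nonneg _))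
    (mul_nonneg hx ENNReal.toReal_nonneg) ?_
  rw [tsum_ofReal_scaledConc_mul_female hx hx ht, ENNReal.ofReal_mul hx, ENNReal.ofReal_toReal]
  exact ((h.val_le_one hx hx ht hxt hxt).2.trans_lt ENNReal.one_lt_top).ne

/-- With weight `x^(a + b)`, the total of male arms is `x P(x, x, t)`, which is Lipschitz to the
left of `x = 1 - t`. Its derivative controls `⟨c, a(a + b)⟩`; with the female analogue this bounds
`⟨c, (a + b)²⟩`. -/
lemma summable_second_moments (ht : 0 ≤ t) (ht1 : t < 1)
    (hL : t * (α + β + 2 * γ) ≤ 1 / 2) :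
    Summable fun p => scaledConc ν (1 - t) (1 - t) t p * (p.male ^ 2 + p.female ^ 2) := by
  have hα := h.alpha_nonneg
  have hβ := h.beta_nonneg
  have hγ := h.gamma_nonneg
  have hx0 : 0 < 1 - t := by linarith
  have hbound : ∀ {s : ℝ → ℝ}, (∀ y, 0 ≤ y → y ≤ 1 - t → s y ≤ 1) → s (1 - t) = 1 →
      (∀ δ, 0 ≤ δ → δ ≤ 1 - t → 1 - s (1 - t - δ) ≤ 2 * (α + β + 2 * γ) * δ) →
      ∀ y, 0 ≤ y → y < 1 - t →
        (1 - t) * s (1 - t) - y * s y ≤ (2 * (α + β + 2 * γ) + 1) * (1 - t - y) := by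
    intro s hs1 hs2 hs y hy hyt
    have a := hs (1 - t - y) (by linarith) (by linarith)
    rw [sub_sub_cancel] at a
    rw [hs2, mul_one]
    have b : (1 - t) * (1 - s y) ≤ 1 * (2 * (α + β + 2 * γ) * (1 - t - y)) :=
      mul_le_mul (by linarith) a (by linarith [hs1 y hy hyt.le]) zero_le_one
    have c : (1 - t - y) * s y ≤ (1 - t - y) * 1 :=
      mul_le_mul_of_nonneg_left (hs1 y hy hyt.le) (by linarith)
    linarith
  have hfm : ∀ x, (fun p => scaledConc ν x x t p * p.male) = fun p : Particle =>
      (treeConc ν p * t ^ p.2.2.natPred * p.male) * x ^ (p.1 + p.2.1) := by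
    intro x
    ext p
    rw [scaledConc, pow_add]
    ring
  have hff : ∀ x, (fun p => scaledConc ν x x t p * p.female) = fun p : Particle =>
      (treeConc ν p * t ^ p.2.2.natPred * p.female) * x ^ (p.1 + p.2.1) := by
    intro x
    ext p
    rw [scaledConc, pow_add]
    ring
  have hle : ∀ y, 0 ≤ y → y ≤ 1 - t →
      (valMale ν y y t).toReal ≤ 1 ∧ (valFemale ν y y t).toReal ≤ 1 := fun y hy hyt => by
    have := h.isFixedPoint_val hy hy ht (by linarith) (by linarith)
    exact ⟨this.fst_mem.2, this.snd_mem.2⟩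
  have hm := summable_mul_pow_of_lipschitz (n := fun p : Particle => p.1 + p.2.1)
    (w := fun p : Particle => treeConc ν p * t ^ p.2.2.natPred * p.male)
    (C := 2 * (α + β + 2 * γ) + 1)
    (fun p => mul_nonneg (mul_nonneg (treeConc_nonneg p) (by positivity)) (Nat.cast_nonneg _))
    hx0 (by linarith)
    (fun y hy hyt => by
      have := h.hasSum_scaledConc_male_diag hy ht (by linarith)
      rw [hfm] at this
      exact this.summable)
    (fun y hy hyt => by
      have h1 := h.hasSum_scaledConc_male_diag hy ht (by linarith)
      have h2 := h.hasSum_scaledConc_male_diag hx0.le ht (by linarith)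
      rw [hfm] at h1 h2
      rw [h1.tsum_eq, h2.tsum_eq]
      refine hbound (s := fun y => (valMale ν y y t).toReal) (fun y hy hyt => (hle y hy hyt).1)
        ?_ (fun δ hδ hδt => (h.one_sub_val_le ht hL hδ hδt).1) y hy hyt
      simp [(h.val_eq_one ht ht1).1])
  have hf := summable_mul_pow_of_lipschitz (n := fun p : Particle => p.1 + p.2.1)
    (w := fun p : Particle => treeConc ν p * t ^ p.2.2.natPred * p.female)
    (C := 2 * (α + β + 2 * γ) + 1)
    (fun p => mul_nonneg (mul_nonneg (treeConc_nonneg p) (by positivity)) (Nat.cast_nonneg _))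
    hx0 (by linarith)
    (fun y hy hyt => by
      have := h.hasSum_scaledConc_female_diag hy ht (by linarith)
      rw [hff] at this
      exact this.summable)
    (fun y hy hyt => by
      have h1 := h.hasSum_scaledConc_female_diag hy ht (by linarith)
      have h2 := h.hasSum_scaledConc_female_diag hx0.le ht (by linarith)
      rw [hff] at h1 h2
      rw [h1.tsum_eq, h2.tsum_eq]
      refine hbound (s := fun y => (valFemale ν y y t).toReal) (fun y hy hyt => (hle y hy hyt).2)
        ?_ (fun δ hδ hδt => (h.one_sub_val_le ht hL hδ hδt).2) y hy hyt
      simp [(h.val_eq_one ht ht1).2])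
  refine (hm.add hf).of_nonneg_of_le
    (fun p => mul_nonneg (scaledConc_nonneg hx0.le hx0.le ht p) (by positivity)) fun p => ?_
  have e1 : (treeConc ν p * t ^ p.2.2.natPred * p.male) * ((p.1 + p.2.1 : ℕ) : ℝ) *
      (1 - t) ^ (p.1 + p.2.1) + (treeConc ν p * t ^ p.2.2.natPred * p.female) *
        ((p.1 + p.2.1 : ℕ) : ℝ) * (1 - t) ^ (p.1 + p.2.1) =
      scaledConc ν (1 - t) (1 - t) t p * (p.male + p.female) ^ 2 := by
    rw [scaledConc, pow_add, Particle.male, Particle.female]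
    push_cast
    ring
  rw [e1]
  refine mul_le_mul_of_nonneg_left ?_ (scaledConc_nonneg hx0.le hx0.le ht p)
  have h1 : 0 ≤ p.male := Nat.cast_nonneg _
  have h2 : 0 ≤ p.female := Nat.cast_nonneg _
  nlinarith [mul_nonneg h1 h2]

end IsSubcritical

/-- The solution of the coagulation equation. -/
def explicitSolution (ν : ℕ × ℕ → ℝ≥0) (t : ℝ) : Particle → ℝ :=
  scaledConc ν (1 - t / (1 + t)) (1 - t / (1 + t)) (t / (1 + t))

lemma natCast_mul_pow_pred_mul (n : ℕ) (u : ℝ) : n * u ^ (n - 1) * u = n * u ^ n := by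
  cases n with
  | zero => simp
  | succ n => rw [Nat.add_sub_cancel, pow_succ]; ring

lemma time_change_mem {t : ℝ} (ht : 0 ≤ t) : 0 ≤ t / (1 + t) ∧ t / (1 + t) < 1 :=
  ⟨by positivity, by rw [div_lt_one (by positivity)]; linarith⟩

/-- The inner time obeys `τ' = (1 - τ)²`, the product of the two factors, each equal to `1 - τ`. -/
lemma hasDerivAt_time_change {t : ℝ} (ht : 0 ≤ t) :
    HasDerivAt (fun s : ℝ => s / (1 + s)) ((1 - t / (1 + t)) ^ 2) t := by
  have h1 : (1 + t) ≠ 0 := by positivity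
  have := (hasDerivAt_id t).div ((hasDerivAt_id t).const_add 1) h1
  convert! this using 1
  simp only [id]
  field_simp
  ring

/-- The concentrations of a weighted profile, differentiated along a curve. -/
lemma hasDerivAt_explicitSolution {t : ℝ} (ht : 0 ≤ t) (p : Particle) :
    HasDerivAt (fun s => explicitSolution ν s p)
      (p.2.2.natPred * treeConc ν p * ((1 - t / (1 + t)) ^ (p.1 + 1) *
        (1 - t / (1 + t)) ^ (p.2.1 + 1) * (t / (1 + t)) ^ (p.2.2.natPred - 1)) -
        explicitSolution ν t p * (p.female * (1 - t / (1 + t)) + p.male * (1 - t / (1 + t)))) t := by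
  have hv := hasDerivAt_time_change ht
  have hu := hv.const_sub 1
  have := (((hu.pow p.1).mul (hu.pow p.2.1)).mul (hv.pow p.2.2.natPred)).const_mul (treeConc ν p)
  convert! this using 1
  simp only [explicitSolution, scaledConc, male, female, Pi.pow_apply, Pi.mul_apply]
  set u := 1 - t / (1 + t)
  set v := t / (1 + t)
  have h1 := natCast_mul_pow_pred_mul p.1 u
  have h2 := natCast_mul_pow_pred_mul p.2.1 u
  rw [show (p.1 : ℝ) * u ^ (p.1 - 1) * -u ^ 2 = -(p.1 * u ^ p.1) * u by rw [← h1]; ring,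
    show (p.2.1 : ℝ) * u ^ (p.2.1 - 1) * -u ^ 2 = -(p.2.1 * u ^ p.2.1) * u by rw [← h2]; ring]
  rw [pow_succ, pow_succ]
  ring

/-- Differentiating the power of `τ` produces the gain term. Differentiating the powers of `1 - τ`
produces the loss term, because both totals of arms equal `1 - τ`. -/
theorem IsSubcritical.isSolution_explicitSolution {α β γ : ℝ} (h : IsSubcritical ν α β γ)
    {μ : ℕ × ℕ → ℝ} (hμ : ∀ x, (ν x : ℝ) = μ x) :
    IsSolution (monodisperse μ) ⊤ (explicitSolution ν) := by
  have hα := h.alpha_nonneg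
  have hβ := h.beta_nonneg
  have hγ := h.gamma_nonneg
  have hnn : ∀ t, 0 ≤ t → ∀ p, 0 ≤ explicitSolution ν t p := fun t ht p =>
    scaledConc_nonneg (by linarith [(time_change_mem ht).2]) (by linarith [(time_change_mem ht).2])
      (time_change_mem ht).1 p
  have harms : ∀ t, 0 ≤ t → HasSum (fun p => |explicitSolution ν t p| * (p.male + p.female))
      ((1 - t / (1 + t)) + (1 - t / (1 + t))) := fun t ht => by
    have hm := h.hasSum_scaledConc_male (time_change_mem ht).1 (time_change_mem ht).2
    have hf := h.hasSum_scaledConc_female (time_change_mem ht).1 (time_change_mem ht).2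
    refine (hm.add hf).congr_fun fun p => ?_
    rw [abs_of_nonneg (hnn t ht p), mul_add]
    rfl
  constructor
  · intro p
    simp only [explicitSolution, scaledConc, monodisperse]
    split_ifs with hp
    · rw [treeConc_of_mass_one hp, hμ, hp]
      simp [PNat.natPred]
    · have : p.2.2.natPred ≠ 0 := fun h0 => hp (by
        have := p.2.2.natPred_add_one
        rw [h0] at this
        exact PNat.eq this.symm)
      simp [this]
  · intro t ht _
    exact (harms t ht).summable
  · intro t ht _
    have hc : ContinuousOn (fun s : ℝ => (1 - s / (1 + s)) + (1 - s / (1 + s)))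
        (Set.uIcc 0 t) := by
      rw [Set.uIcc_of_le ht]
      have : ContinuousOn (fun s : ℝ => s / (1 + s)) (Set.Icc 0 t) :=
        continuousOn_id.div (by fun_prop) fun s hs => by linarith [hs.1]
      fun_prop
    refine (hc.intervalIntegrable).congr fun s hs => ?_
    rw [Set.uIoc_of_le ht] at hs
    exact (harms s hs.1.le).tsum_eq.symm
  -- Below this time `τ (α + β + 2γ) ≤ 1 / 2`, as the moment bound requires; the summand `1` keeps
  -- the denominator positive.
  · refine ⟨1 / (2 * (α + β + 2 * γ + 1)), by positivity, fun t ht htε _ => ?_⟩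
    have h1 : t * (2 * (α + β + 2 * γ + 1)) < 1 := by rwa [lt_div_iff₀ (by positivity)] at htε
    have hτ : t / (1 + t) ≤ t := div_le_self ht (by linarith)
    refine (h.summable_second_moments (time_change_mem ht).1 (time_change_mem ht).2 ?_).congr
      fun p => ?_
    · have := mul_le_mul_of_nonneg_right hτ (show 0 ≤ α + β + 2 * γ by positivity)
      linarith
    · rw [abs_of_nonneg (hnn t ht p)]
      rfl
  · intro t ht _ p
    refine (hasDerivAt_explicitSolution ht p).hasDerivWithinAt.congr_deriv ?_
    rw [coagulationRHS, tsum_rate_mul (c := explicitSolution ν t)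
      (h.hasSum_scaledConc_male (time_change_mem ht).1 (time_change_mem ht).2)
      (h.hasSum_scaledConc_female (time_change_mem ht).1 (time_change_mem ht).2),
      ← gain_scaledConc]
    rfl


/-! ### Integrating factors -/

/-- The function is bounded on the interval, and the exponential is Lipschitz on bounded sets. -/
lemma AbsolutelyContinuousOnInterval.exp {f : ℝ → ℝ} {a b : ℝ}
    (hf : AbsolutelyContinuousOnInterval f a b) :
    AbsolutelyContinuousOnInterval (fun t => Real.exp (f t)) a b := by
  obtain ⟨C, hC⟩ := hf.exists_bound
  obtain ⟨K, hK⟩ := (Real.contDiff_exp.contDiffOn (n := 1)).exists_lipschitzOnWith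
    one_ne_zero (convex_Icc (-C) C) isCompact_Icc
  unfold AbsolutelyContinuousOnInterval at hf ⊢
  apply squeeze_zero' ?_ ?_ (by simpa using hf.const_mul (K : ℝ))
  · exact Eventually.of_forall fun _ => Finset.sum_nonneg fun i hi => dist_nonneg
  rw [eventually_inf_principal]
  filter_upwards with (n, I) hnI
  rw [Finset.mul_sum]
  refine Finset.sum_le_sum fun i hi => ?_
  have hI := hnI.left i (Finset.mem_range.1 hi |> fun h => by simpa using h)
  exact hK.dist_le_mul _ (abs_le.1 (hC _ hI.1)) _ (abs_le.1 (hC _ hI.2))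

/-- Multiplication of a differentiable function by an integrating factor. -/
lemma integral_mul_exp_eq {f f' w : ℝ → ℝ} {T : ℝ} (hT : 0 ≤ T)
    (hf : ∀ t, 0 ≤ t → HasDerivWithinAt f (f' t) (Set.Ici 0) t)
    (hf' : IntervalIntegrable f' volume 0 T) (hw : IntervalIntegrable w volume 0 T) :
    ∫ t in 0..T, (f' t + f t * w t) * Real.exp (∫ s in 0..t, w s) =
      f T * Real.exp (∫ s in 0..T, w s) - f 0 := by
  have hft : ∀ t ∈ Set.Icc 0 T, f 0 + ∫ s in 0..t, f' s = f t := by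
    intro t ht
    rw [intervalIntegral.integral_eq_sub_of_hasDeriv_right_of_le ht.1
      (fun s hs => (hf s hs.1).continuousWithinAt.mono fun r hr => hr.1)
      (fun s hs => (hf s hs.1.le).mono fun r hr => hs.1.le.trans (le_of_lt hr))
      (hf'.mono_set (by
        rw [Set.uIcc_of_le ht.1, Set.uIcc_of_le hT]
        exact Set.Icc_subset_Icc le_rfl ht.2))]
    ring
  -- The rate `w` is merely integrable, so the exponential is differentiable only almost everywhere;
  -- integration by parts is done for absolutely continuous functions.
  have hac1 : AbsolutelyContinuousOnInterval (fun t => f 0 + ∫ s in 0..t, f' s) 0 T :=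
    ((contDiffOn_const (c := f 0)).absolutelyContinuousOnInterval).add
      (hf'.absolutelyContinuousOnInterval_intervalIntegral Set.left_mem_uIcc)
  have hac2 := (hw.absolutelyContinuousOnInterval_intervalIntegral
    (c := 0) Set.left_mem_uIcc).exp
  have key := AbsolutelyContinuousOnInterval.integral_deriv_mul_eq_sub hac1 hac2
  rw [hft T ⟨hT, le_rfl⟩, hft 0 ⟨le_rfl, hT⟩, intervalIntegral.integral_same, Real.exp_zero,
    mul_one] at key
  rw [← key]
  refine intervalIntegral.integral_congr_ae ?_
  filter_upwards [hf'.ae_hasDerivAt_integral, hw.ae_hasDerivAt_integral] with t h1 h2 ht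
  have htu := Set.uIoc_subset_uIcc ht
  have d1 := (h1 htu 0 Set.left_mem_uIcc).const_add (f 0)
  have d2 := (h2 htu 0 Set.left_mem_uIcc).exp
  rw [Set.uIcc_of_le hT] at htu
  rw [d1.deriv, d2.deriv, hft t htu]
  ring

lemma continuousOn_primitive_Ici {f : ℝ → ℝ}
    (hf : ∀ T, 0 ≤ T → IntervalIntegrable f volume 0 T) :
    ContinuousOn (fun t => ∫ s in 0..t, f s) (Set.Ici 0) := by
  refine continuousOn_of_locally_continuousOn fun t ht => ⟨Set.Iio (t + 1), isOpen_Iio,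
    by simp, ?_⟩
  have ht' : (0 : ℝ) ≤ t + 1 := by linarith [Set.mem_Ici.1 ht]
  have h1 := intervalIntegral.continuousOn_primitive_interval
    ((intervalIntegrable_iff' (μ := volume)).1 (hf _ ht'))
  rw [Set.uIcc_of_le ht'] at h1
  exact h1.mono fun s hs => ⟨hs.1, (le_of_lt hs.2)⟩

/-! ### Uniqueness of the solution -/

/-- The total number of male arms. -/
def maleArms (c : ℝ → Particle → ℝ) (t : ℝ) : ℝ := ∑' p, c t p * p.male

/-- The total number of female arms. -/
def femaleArms (c : ℝ → Particle → ℝ) (t : ℝ) : ℝ := ∑' p, c t p * p.female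

/-- The probability that a given male arm stays free. -/
def maleFactor (c : ℝ → Particle → ℝ) (t : ℝ) : ℝ := Real.exp (-∫ s in 0..t, femaleArms c s)

/-- The probability that a given female arm stays free. -/
def femaleFactor (c : ℝ → Particle → ℝ) (t : ℝ) : ℝ := Real.exp (-∫ s in 0..t, maleArms c s)

/-- The time change that makes the equation autonomous. -/
def innerTime (c : ℝ → Particle → ℝ) (t : ℝ) : ℝ :=
  ∫ s in 0..t, maleFactor c s * femaleFactor c s

lemma maleFactor_pos (c : ℝ → Particle → ℝ) (t : ℝ) : 0 < maleFactor c t := Real.exp_pos _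

lemma femaleFactor_pos (c : ℝ → Particle → ℝ) (t : ℝ) : 0 < femaleFactor c t := Real.exp_pos _

lemma maleFactor_zero (c : ℝ → Particle → ℝ) : maleFactor c 0 = 1 := by simp [maleFactor]

lemma innerTime_zero (c : ℝ → Particle → ℝ) : innerTime c 0 = 0 := by simp [innerTime]

lemma innerTime_nonneg (c : ℝ → Particle → ℝ) {t : ℝ} (ht : 0 ≤ t) : 0 ≤ innerTime c t :=
  intervalIntegral.integral_nonneg ht fun s _ =>
    mul_nonneg (maleFactor_pos c s).le (femaleFactor_pos c s).le

namespace IsSolution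

variable {c₀ : Particle → ℝ} {c : ℝ → Particle → ℝ} (hc : IsSolution c₀ ⊤ c)
include hc

lemma hasDerivWithinAt {t : ℝ} (ht : 0 ≤ t) (p : Particle) :
    HasDerivWithinAt (fun s => c s p) (coagulationRHS (c t) p) (Set.Ici 0) t :=
  hc.equation t ht ENNReal.ofReal_lt_top p

lemma continuousOn (p : Particle) : ContinuousOn (fun s => c s p) (Set.Ici 0) :=
  fun _ ht => (hc.hasDerivWithinAt ht p).continuousWithinAt

lemma summable_male {t : ℝ} (ht : 0 ≤ t) : Summable fun p => c t p * p.male := by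
  refine Summable.of_norm_bounded (hc.arms_summable t ht ENNReal.ofReal_lt_top) fun p => ?_
  have h1 : 0 ≤ p.male := Nat.cast_nonneg _
  have h2 : 0 ≤ p.female := Nat.cast_nonneg _
  rw [Real.norm_eq_abs, abs_mul, abs_of_nonneg h1]
  gcongr
  linarith

lemma summable_female {t : ℝ} (ht : 0 ≤ t) : Summable fun p => c t p * p.female := by
  refine Summable.of_norm_bounded (hc.arms_summable t ht ENNReal.ofReal_lt_top) fun p => ?_
  have h1 : 0 ≤ p.male := Nat.cast_nonneg _
  have h2 : 0 ≤ p.female := Nat.cast_nonneg _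
  rw [Real.norm_eq_abs, abs_mul, abs_of_nonneg h2]
  gcongr
  linarith

lemma intervalIntegrable_tsum {f : Particle → ℝ} {T : ℝ} (hT : 0 ≤ T)
    (hf : ∀ p, |f p| ≤ p.male + p.female) :
    IntervalIntegrable (fun t => ∑' p, c t p * f p) volume 0 T := by
  have hint := hc.arms_integrable T hT ENNReal.ofReal_lt_top
  have hbd : ∀ t, ∀ p, ‖c t p * f p‖ ≤ |c t p| * (p.male + p.female) := fun t p => by
    rw [Real.norm_eq_abs, abs_mul]
    gcongr
    exact hf p
  rw [intervalIntegrable_iff_integrableOn_Ioc_of_le hT] at hint ⊢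
  refine Integrable.mono' hint ?_ ?_
  · refine aestronglyMeasurable_of_tendsto_ae (u := (atTop : Filter (Finset Particle)))
      (f := fun F t => ∑ p ∈ F, c t p * f p) (fun F => ?_) ?_
    · refine ContinuousOn.aestronglyMeasurable ?_ measurableSet_Ioc
      exact continuousOn_finsetSum _ fun p _ =>
        ((hc.continuousOn p).mono fun s hs => hs.1.le).mul continuousOn_const
    · refine (ae_restrict_iff' measurableSet_Ioc).2 (Eventually.of_forall fun t ht => ?_)
      exact (Summable.of_norm_bounded (hc.arms_summable t ht.1.le ENNReal.ofReal_lt_top)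
        (hbd t)).hasSum
  · refine (ae_restrict_iff' measurableSet_Ioc).2 (Eventually.of_forall fun t ht => ?_)
    exact tsum_of_norm_bounded (hc.arms_summable t ht.1.le ENNReal.ofReal_lt_top).hasSum (hbd t)

lemma intervalIntegrable_maleArms {T : ℝ} (hT : 0 ≤ T) :
    IntervalIntegrable (maleArms c) volume 0 T :=
  hc.intervalIntegrable_tsum hT fun p => by
    have h1 : 0 ≤ p.male := Nat.cast_nonneg _
    have h2 : 0 ≤ p.female := Nat.cast_nonneg _
    rw [abs_of_nonneg h1]
    linarith

lemma intervalIntegrable_femaleArms {T : ℝ} (hT : 0 ≤ T) :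
    IntervalIntegrable (femaleArms c) volume 0 T :=
  hc.intervalIntegrable_tsum hT fun p => by
    have h1 : 0 ≤ p.male := Nat.cast_nonneg _
    have h2 : 0 ≤ p.female := Nat.cast_nonneg _
    rw [abs_of_nonneg h2]
    linarith

lemma rhs_eq {t : ℝ} (ht : 0 ≤ t) (p : Particle) : coagulationRHS (c t) p =
    (1 / 2) * ∑ p' ∈ parts p, rate p' (rest p p') * c t p' * c t (rest p p') -
      c t p * (p.female * maleArms c t + p.male * femaleArms c t) := by
  rw [coagulationRHS,
    tsum_rate_mul (hc.summable_male ht).hasSum (hc.summable_female ht).hasSum]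
  rfl

lemma continuousOn_gain (p : Particle) : ContinuousOn (fun t =>
    (1 / 2) * ∑ p' ∈ parts p, rate p' (rest p p') * c t p' * c t (rest p p')) (Set.Ici 0) :=
  continuousOn_const.mul (continuousOn_finsetSum _ fun _ _ =>
    (continuousOn_const.mul (hc.continuousOn _)).mul (hc.continuousOn _))

lemma intervalIntegrable_loss {T : ℝ} (hT : 0 ≤ T) (p : Particle) :
    IntervalIntegrable (fun t => p.female * maleArms c t + p.male * femaleArms c t) volume 0 T :=
  ((hc.intervalIntegrable_maleArms hT).const_mul _).add
    ((hc.intervalIntegrable_femaleArms hT).const_mul _)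

lemma intervalIntegrable_rhs {T : ℝ} (hT : 0 ≤ T) (p : Particle) :
    IntervalIntegrable (fun t => coagulationRHS (c t) p) volume 0 T := by
  have hsub : Set.uIcc 0 T ⊆ Set.Ici 0 := by
    rw [Set.uIcc_of_le hT]
    exact fun s hs => hs.1
  refine (((hc.continuousOn_gain p).mono hsub).intervalIntegrable.sub
    ((hc.intervalIntegrable_loss hT p).continuousOn_mul
      ((hc.continuousOn p).mono hsub))).congr fun t ht => ?_
  rw [Set.uIoc_of_le hT] at ht
  exact (hc.rhs_eq ht.1.le p).symm

lemma continuousOn_maleFactor : ContinuousOn (maleFactor c) (Set.Ici 0) :=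
  (continuousOn_primitive_Ici fun _ hT => hc.intervalIntegrable_femaleArms hT).neg.rexp

lemma continuousOn_femaleFactor : ContinuousOn (femaleFactor c) (Set.Ici 0) :=
  (continuousOn_primitive_Ici fun _ hT => hc.intervalIntegrable_maleArms hT).neg.rexp

lemma continuousOn_factors :
    ContinuousOn (fun t => maleFactor c t * femaleFactor c t) (Set.Ici 0) :=
  hc.continuousOn_maleFactor.mul hc.continuousOn_femaleFactor

lemma intervalIntegrable_factors {T : ℝ} (hT : 0 ≤ T) :
    IntervalIntegrable (fun t => maleFactor c t * femaleFactor c t) volume 0 T :=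
  (hc.continuousOn_factors.mono fun s hs => by
    rw [Set.uIcc_of_le hT] at hs
    exact hs.1).intervalIntegrable

lemma continuousOn_innerTime : ContinuousOn (innerTime c) (Set.Ici 0) :=
  continuousOn_primitive_Ici fun _ hT => hc.intervalIntegrable_factors hT

lemma hasDerivWithinAt_innerTime {t : ℝ} (ht : 0 ≤ t) :
    HasDerivWithinAt (innerTime c) (maleFactor c t * femaleFactor c t) (Set.Ioi t) t := by
  refine (intervalIntegral.integral_hasDerivWithinAt_right
    (hc.intervalIntegrable_factors ht) (s := Set.Ici t) (t := Set.Ioi t) ?_ ?_).mono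
      Set.Ioi_subset_Ici_self
  · refine ⟨Set.Ioi t, self_mem_nhdsWithin, ?_⟩
    exact (hc.continuousOn_factors.mono fun s hs =>
      ht.trans (le_of_lt hs)).aestronglyMeasurable measurableSet_Ioi
  · exact (hc.continuousOn_factors t ht).mono fun s hs => ht.trans (le_of_lt hs)

/-- The integrating factor of the loss term is the inverse of `Xᵃ Yᵇ`. -/
lemma maleFactor_pow_mul_exp {t : ℝ} (ht : 0 ≤ t) (p : Particle) :
    maleFactor c t ^ p.1 * femaleFactor c t ^ p.2.1 *
      Real.exp (∫ s in 0..t, (p.female * maleArms c s + p.male * femaleArms c s)) = 1 := by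
  rw [intervalIntegral.integral_add ((hc.intervalIntegrable_maleArms ht).const_mul _)
    ((hc.intervalIntegrable_femaleArms ht).const_mul _), intervalIntegral.integral_const_mul,
    intervalIntegral.integral_const_mul, maleFactor, femaleFactor, ← Real.exp_nat_mul,
    ← Real.exp_nat_mul, ← Real.exp_add, ← Real.exp_add, Particle.male, Particle.female]
  convert Real.exp_zero using 2
  ring

/-- The concentrations at positive times are determined by the total numbers of arms. -/
lemma eq_scaledConc {μ : ℕ × ℕ → ℝ} (hμ : ∀ x, (ν x : ℝ) = μ x) (h0 : c₀ = monodisperse μ)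
    {t : ℝ} (ht : 0 ≤ t) (p : Particle) :
    c t p = scaledConc ν (maleFactor c t) (femaleFactor c t) (innerTime c t) p := by
  -- Constituents are strictly lighter than the particle they form, so the gain is already known.
  induction hn : p.2.2.natPred using Nat.strong_induction_on generalizing p t with
  | _ n ih =>
    set K := treeConc ν p
    have hgain : ∀ s, 0 ≤ s →
        (1 / 2) * ∑ p' ∈ parts p, rate p' (rest p p') * c s p' * c s (rest p p') =
        n * K * (maleFactor c s ^ (p.1 + 1) * femaleFactor c s ^ (p.2.1 + 1) *
          innerTime c s ^ (n - 1)) := by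
      intro s hs
      rw [← hn, ← gain_scaledConc]
      congr 1
      refine Finset.sum_congr rfl fun q hq => ?_
      have h2 := natPred_rest_add hq
      rw [ih _ (by omega) hs q rfl, ih _ (by omega) hs (rest p q) rfl]
    have key := integral_mul_exp_eq ht (fun s hs => hc.hasDerivWithinAt hs p)
      (hc.intervalIntegrable_rhs ht p) (hc.intervalIntegrable_loss ht p)
    -- After multiplication by the integrating factor all arm weights cancel, and the integrand is
    -- the derivative of `K τⁿ`.
    have hcongr : Set.EqOn (fun s => (coagulationRHS (c s) p + c s p *
        (p.female * maleArms c s + p.male * femaleArms c s)) *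
          Real.exp (∫ r in 0..s, (p.female * maleArms c r + p.male * femaleArms c r)))
        (fun s => K * (n * innerTime c s ^ (n - 1) * (maleFactor c s * femaleFactor c s)))
        (Set.uIcc 0 t) := by
      intro s hs
      rw [Set.uIcc_of_le ht] at hs
      have h1 := hc.maleFactor_pow_mul_exp hs.1 p
      simp only
      rw [hc.rhs_eq hs.1, sub_add_cancel, hgain s hs.1, pow_succ, pow_succ]
      linear_combination (n * K * maleFactor c s * femaleFactor c s * innerTime c s ^ (n - 1)) * h1
    have hint : ∫ s in 0..t, K * (n * innerTime c s ^ (n - 1) *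
        (maleFactor c s * femaleFactor c s)) =
        K * innerTime c t ^ n - K * innerTime c 0 ^ n := by
      have hcont : ContinuousOn (fun s => K * (n * innerTime c s ^ (n - 1) *
          (maleFactor c s * femaleFactor c s))) (Set.Ici 0) :=
        continuousOn_const.mul ((continuousOn_const.mul (hc.continuousOn_innerTime.pow _)).mul
          hc.continuousOn_factors)
      refine intervalIntegral.integral_eq_sub_of_hasDeriv_right_of_le
        (f := fun s => K * innerTime c s ^ n) ht
        ((continuousOn_const.mul (hc.continuousOn_innerTime.pow _)).mono fun s hs => hs.1)
        (fun s hs => ?_) ((hcont.mono fun s hs => ?_).intervalIntegrable)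
      · exact ((hc.hasDerivWithinAt_innerTime hs.1.le).pow n).const_mul K
      · rw [Set.uIcc_of_le ht] at hs
        exact hs.1
    rw [intervalIntegral.integral_congr hcongr, hint, innerTime_zero] at key
    -- With `0 ^ 0 = 1`, this encodes that only particles of mass one are present initially.
    have hinit : c 0 p = K * 0 ^ n := by
      rw [hc.init, h0, monodisperse]
      split_ifs with hp
      · have : n = 0 := by rw [← hn, hp]; simp [PNat.natPred]
        rw [this, pow_zero, mul_one, ← hμ]
        exact (treeConc_of_mass_one hp).symm
      · have : n ≠ 0 := fun h0 => hp (by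
          have := p.2.2.natPred_add_one
          rw [hn, h0] at this
          exact PNat.eq this.symm)
        simp [this]
    rw [hinit] at key
    have h1 := hc.maleFactor_pow_mul_exp ht p
    rw [scaledConc, hn]
    linear_combination (-(c t p)) * h1 -
      maleFactor c t ^ p.1 * femaleFactor c t ^ p.2.1 * key

end IsSolution


/-! ### Arms cannot be created -/

namespace Particle

/-- The number of arms of the constituents of a particle, including those used up. -/
def armCount (p : Particle) : ℕ := p.1 + p.2.1 + 2 * p.2.2.natPred

/-- A coagulation consumes one arm of each kind and raises the sum of the masses minus one by one;
the weight `2` compensates exactly. -/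
lemma armCount_rest_add {p p' : Particle} (h : p' ∈ parts p) :
    armCount (rest p p') + armCount p' = armCount p := by
  have h0 := fst_rest_add h
  have h1 := snd_rest_add h
  have h2 := natPred_rest_add h
  unfold armCount
  omega

/-- The particles built from constituents with at most `N` arms in total. -/
def smallParticles (N : ℕ) : Finset Particle :=
  (Finset.range (N + 1) ×ˢ Finset.range (N + 1) ×ˢ Finset.Icc 1 N.succPNat).filter
    fun p => armCount p ≤ N

lemma mem_smallParticles {N : ℕ} {p : Particle} : p ∈ smallParticles N ↔ armCount p ≤ N := by
  simp only [smallParticles, Finset.mem_filter, Finset.mem_product, Finset.mem_range,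
    Finset.mem_Icc, and_iff_right_iff_imp, one_le, true_and]
  intro h
  unfold armCount at h
  refine ⟨by omega, by omega, ?_⟩
  have := p.2.2.natPred_add_one
  rw [← PNat.coe_le_coe, Nat.succPNat_coe]
  omega

lemma tendsto_smallParticles : Tendsto smallParticles atTop atTop := by
  refine tendsto_atTop_finset_of_monotone (fun N N' hN p hp => ?_)
    fun p => ⟨armCount p, mem_smallParticles.2 le_rfl⟩
  rw [mem_smallParticles] at hp ⊢
  exact hp.trans hN

/-- Since `armCount` is additive, both constituents of a small particle are small. The truncated
gain is therefore a sum over some of the pairs of small particles, and the other pairs contribute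
nonnegatively. -/
lemma sum_gain_le {f : Particle → ℝ} (hf : ∀ p, 0 ≤ f p) {g : Particle → ℕ}
    (hadd : ∀ p, ∀ q ∈ parts p, g (rest p q) + g q = g p + 1)
    (hpos : ∀ q q' : Particle, q.1 ≠ 0 → q'.2.1 ≠ 0 → 1 ≤ g q + g q') (N : ℕ) :
    ∑ p ∈ smallParticles N,
      g p * ((1 / 2) * ∑ p' ∈ parts p, rate p' (rest p p') * f p' * f (rest p p')) ≤
    ∑ q ∈ smallParticles N, ∑ q' ∈ smallParticles N,
      ((g q : ℝ) + g q' - 1) * ((q.male * f q) * (q'.female * f q')) := by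
  set G : Particle × Particle → ℝ := fun x =>
    ((g x.1 : ℝ) + g x.2 - 1) * ((x.1.male * f x.1) * (x.2.female * f x.2)) with hG
  have hGnn : ∀ x, 0 ≤ G x := by
    intro x
    by_cases h1 : x.1.1 = 0
    · simp [hG, male, h1]
    by_cases h2 : x.2.2.1 = 0
    · simp [hG, female, h2]
    have h3 : (1 : ℝ) ≤ g x.1 + g x.2 := by exact_mod_cast hpos _ _ h1 h2
    have h4 : 0 ≤ x.1.male := Nat.cast_nonneg _
    have h5 : 0 ≤ x.2.female := Nat.cast_nonneg _
    exact mul_nonneg (by linarith) (mul_nonneg (mul_nonneg h4 (hf _)) (mul_nonneg h5 (hf _)))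
  have h1 : ∑ p ∈ smallParticles N,
      g p * ((1 / 2) * ∑ p' ∈ parts p, rate p' (rest p p') * f p' * f (rest p p')) =
      ∑ x ∈ (smallParticles N).sigma parts, G (x.2, rest x.1 x.2) := by
    rw [Finset.sum_sigma]
    refine Finset.sum_congr rfl fun p _ => ?_
    rw [half_sum_parts, Finset.mul_sum]
    refine Finset.sum_congr rfl fun q hq => ?_
    have : (g (rest p q) : ℝ) + g q = g p + 1 := by exact_mod_cast hadd p q hq
    simp only [hG]
    congr 1
    linarith
  -- The two constituents determine the particle that they form.
  have hinj : Set.InjOn (fun x : (_ : Particle) × Particle => (x.2, rest x.1 x.2))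
      ((smallParticles N).sigma parts : Finset ((_ : Particle) × Particle)) := by
    rintro ⟨p, q⟩ hx ⟨p', q'⟩ hx' heq
    have hq := (Finset.mem_sigma.1 (Finset.mem_coe.1 hx)).2
    have hq' := (Finset.mem_sigma.1 (Finset.mem_coe.1 hx')).2
    simp only [Prod.mk.injEq] at heq hq hq'
    obtain ⟨rfl, hr⟩ := heq
    have a0 := fst_rest_add hq
    have a1 := snd_rest_add hq
    have a2 := mass_rest_add hq
    have b0 := fst_rest_add hq'
    have b1 := snd_rest_add hq'
    have b2 := mass_rest_add hq'
    rw [hr] at a0 a1 a2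
    have : p = p' := Particle.ext_nat (by omega) (by omega) (by omega)
    rw [this]
  rw [h1, ← Finset.sum_image (f := G) hinj, ← Finset.sum_product']
  refine Finset.sum_le_sum_of_subset_of_nonneg ?_ fun x _ _ => hGnn x
  intro y hy
  obtain ⟨⟨p, q⟩, hx, rfl⟩ := Finset.mem_image.1 hy
  obtain ⟨hp, hq⟩ := Finset.mem_sigma.1 hx
  have hw := armCount_rest_add hq
  rw [mem_smallParticles] at hp
  rw [Finset.mem_product, mem_smallParticles, mem_smallParticles]
  simp only at hp hw ⊢
  omega

end Particle

namespace IsSolution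

variable {c₀ : Particle → ℝ} {c : ℝ → Particle → ℝ} (hc : IsSolution c₀ ⊤ c)
include hc

/-- The products with one factor `g` on each side cancel between gain and loss, up to the
differences between truncated and full totals of arms. The last product counts the arms used up by
coagulations. In the applications `g` is the number of male or of female arms. -/
lemma sum_rhs_le {t : ℝ} (ht : 0 ≤ t) (hnn : ∀ p, 0 ≤ c t p) {g : Particle → ℕ}
    (hadd : ∀ p, ∀ q ∈ parts p, g (rest p q) + g q = g p + 1)
    (hpos : ∀ q q' : Particle, q.1 ≠ 0 → q'.2.1 ≠ 0 → 1 ≤ g q + g q') (N : ℕ) :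
    ∑ p ∈ smallParticles N, g p * coagulationRHS (c t) p ≤
      (∑ p ∈ smallParticles N, g p * (c t p * p.male)) *
          ((∑ p ∈ smallParticles N, c t p * p.female) - femaleArms c t) +
        (∑ p ∈ smallParticles N, g p * (c t p * p.female)) *
          ((∑ p ∈ smallParticles N, c t p * p.male) - maleArms c t) -
        (∑ p ∈ smallParticles N, c t p * p.male) * ∑ p ∈ smallParticles N, c t p * p.female := by
  have h1 := Particle.sum_gain_le hnn hadd hpos N
  have h2 : ∑ p ∈ smallParticles N, g p * coagulationRHS (c t) p =
      ∑ p ∈ smallParticles N,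
        g p * ((1 / 2) * ∑ p' ∈ parts p, rate p' (rest p p') * c t p' * c t (rest p p')) -
      ((∑ p ∈ smallParticles N, g p * (c t p * p.female)) * maleArms c t +
        (∑ p ∈ smallParticles N, g p * (c t p * p.male)) * femaleArms c t) := by
    rw [Finset.sum_mul, Finset.sum_mul, ← Finset.sum_add_distrib, ← Finset.sum_sub_distrib]
    refine Finset.sum_congr rfl fun p _ => ?_
    rw [hc.rhs_eq ht]
    ring
  have h3 : ∑ q ∈ smallParticles N, ∑ q' ∈ smallParticles N,
      ((g q : ℝ) + g q' - 1) * ((q.male * c t q) * (q'.female * c t q')) =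
      (∑ p ∈ smallParticles N, g p * (c t p * p.male)) *
          (∑ p ∈ smallParticles N, c t p * p.female) +
        (∑ p ∈ smallParticles N, c t p * p.male) *
          (∑ p ∈ smallParticles N, g p * (c t p * p.female)) -
        (∑ p ∈ smallParticles N, c t p * p.male) * ∑ p ∈ smallParticles N, c t p * p.female := by
    simp only [Finset.sum_mul_sum, ← Finset.sum_add_distrib, ← Finset.sum_sub_distrib]
    refine Finset.sum_congr rfl fun p _ => Finset.sum_congr rfl fun q _ => ?_
    ring
  rw [h2]
  linarith

/-- A quantity that decays at rate at least `w` is bounded by the corresponding exponential. -/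
lemma le_exp_of_decay {g : Particle → ℝ} {w : ℝ → ℝ} {s : Finset Particle} {T : ℝ} (hT : 0 ≤ T)
    (hw : IntervalIntegrable w volume 0 T)
    (hg : ∀ t, 0 ≤ t → ∑ p ∈ s, g p * coagulationRHS (c t) p ≤ -((∑ p ∈ s, g p * c t p) * w t)) :
    ∑ p ∈ s, g p * c T p ≤ (∑ p ∈ s, g p * c 0 p) * Real.exp (-∫ t in 0..T, w t) := by
  have key := integral_mul_exp_eq (f := fun t => ∑ p ∈ s, g p * c t p)
    (f' := fun t => ∑ p ∈ s, g p * coagulationRHS (c t) p) hT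
    (fun t ht => HasDerivWithinAt.fun_sum fun p _ => (hc.hasDerivWithinAt ht p).const_mul (g p))
    (IntervalIntegrable.sum s (f := fun p t => g p * coagulationRHS (c t) p) (fun p _ =>
      (hc.intervalIntegrable_rhs hT p).const_mul (g p)) |>.congr fun t _ => by simp) hw
  have hle : ∫ t in 0..T, (∑ p ∈ s, g p * coagulationRHS (c t) p + (∑ p ∈ s, g p * c t p) * w t) *
      Real.exp (∫ r in 0..t, w r) ≤ 0 := by
    rw [intervalIntegral.integral_of_le hT]
    refine setIntegral_nonpos measurableSet_Ioc fun t ht => ?_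
    exact mul_nonpos_of_nonpos_of_nonneg (by linarith [hg t ht.1.le]) (Real.exp_pos _).le
  rw [key] at hle
  rw [Real.exp_neg, ← div_eq_mul_inv, le_div_iff₀ (Real.exp_pos _)]
  linarith

/-- Since `a² ≥ a` for integers, loss to female arms outside the truncation removes at least as much
as the rate `femaleArms` predicts. The truncated total thus decays at least at that full rate;
integration and `N → ∞` conclude. -/
lemma maleArms_le (hnn : ∀ t, 0 ≤ t → ∀ p, 0 ≤ c t p) {T : ℝ} (hT : 0 ≤ T) :
    maleArms c T ≤ maleArms c 0 * maleFactor c T := by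
  refine le_of_tendsto ((hc.summable_male hT).hasSum.comp tendsto_smallParticles)
    (Eventually.of_forall fun N => ?_)
  have key := hc.le_exp_of_decay (g := fun p => (p.1 : ℝ)) (s := smallParticles N) hT
    (hc.intervalIntegrable_femaleArms hT) fun t ht => by
      have h1 := hc.sum_rhs_le ht (hnn t ht) (g := fun p => p.1) (fun p q => fst_rest_add)
        (fun q q' h _ => by omega) N
      have h2 : ∑ p ∈ smallParticles N, c t p * p.male ≤ maleArms c t :=
        (hc.summable_male ht).sum_le_tsum _ fun p _ => mul_nonneg (hnn t ht p) (Nat.cast_nonneg _)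
      have h3 : ∑ p ∈ smallParticles N, c t p * p.female ≤ femaleArms c t :=
        (hc.summable_female ht).sum_le_tsum _ fun p _ =>
          mul_nonneg (hnn t ht p) (Nat.cast_nonneg _)
      have h4 : ∑ p ∈ smallParticles N, c t p * p.male ≤
          ∑ p ∈ smallParticles N, (p.1 : ℝ) * (c t p * p.male) := by
        refine Finset.sum_le_sum fun p _ => ?_
        rcases Nat.eq_zero_or_pos p.1 with h0 | h0
        · simp [male, h0]
        · exact le_mul_of_one_le_left (mul_nonneg (hnn t ht p) (Nat.cast_nonneg _))
            (by exact_mod_cast h0)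
      have h5 : 0 ≤ ∑ p ∈ smallParticles N, (p.1 : ℝ) * (c t p * p.female) :=
        Finset.sum_nonneg fun p _ => mul_nonneg (Nat.cast_nonneg _)
          (mul_nonneg (hnn t ht p) (Nat.cast_nonneg _))
      have h6 : ∑ p ∈ smallParticles N, (p.1 : ℝ) * c t p =
          ∑ p ∈ smallParticles N, c t p * p.male :=
        Finset.sum_congr rfl fun p _ => mul_comm _ _
      rw [h6]
      have h7 := mul_le_mul_of_nonneg_right h4 (sub_nonneg.2 h3)
      have h8 := mul_nonneg h5 (sub_nonneg.2 h2)
      nlinarith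
  have h6 : ∀ t, ∑ p ∈ smallParticles N, (p.1 : ℝ) * c t p =
      ∑ p ∈ smallParticles N, c t p * p.male := fun t =>
    Finset.sum_congr rfl fun p _ => mul_comm _ _
  rw [h6, h6] at key
  refine key.trans (mul_le_mul_of_nonneg_right ?_ (maleFactor_pos c T).le)
  exact (hc.summable_male le_rfl).sum_le_tsum _ fun p _ =>
    mul_nonneg (hnn 0 le_rfl p) (Nat.cast_nonneg _)

lemma femaleArms_le (hnn : ∀ t, 0 ≤ t → ∀ p, 0 ≤ c t p) {T : ℝ} (hT : 0 ≤ T) :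
    femaleArms c T ≤ femaleArms c 0 * femaleFactor c T := by
  refine le_of_tendsto ((hc.summable_female hT).hasSum.comp tendsto_smallParticles)
    (Eventually.of_forall fun N => ?_)
  have key := hc.le_exp_of_decay (g := fun p => (p.2.1 : ℝ)) (s := smallParticles N) hT
    (hc.intervalIntegrable_maleArms hT) fun t ht => by
      have h1 := hc.sum_rhs_le ht (hnn t ht) (g := fun p => p.2.1) (fun p q => snd_rest_add)
        (fun q q' _ h => by omega) N
      have h2 : ∑ p ∈ smallParticles N, c t p * p.male ≤ maleArms c t :=
        (hc.summable_male ht).sum_le_tsum _ fun p _ => mul_nonneg (hnn t ht p) (Nat.cast_nonneg _)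
      have h3 : ∑ p ∈ smallParticles N, c t p * p.female ≤ femaleArms c t :=
        (hc.summable_female ht).sum_le_tsum _ fun p _ =>
          mul_nonneg (hnn t ht p) (Nat.cast_nonneg _)
      have h4 : ∑ p ∈ smallParticles N, c t p * p.female ≤
          ∑ p ∈ smallParticles N, (p.2.1 : ℝ) * (c t p * p.female) := by
        refine Finset.sum_le_sum fun p _ => ?_
        rcases Nat.eq_zero_or_pos p.2.1 with h0 | h0
        · simp [female, h0]
        · exact le_mul_of_one_le_left (mul_nonneg (hnn t ht p) (Nat.cast_nonneg _))
            (by exact_mod_cast h0)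
      have h5 : 0 ≤ ∑ p ∈ smallParticles N, (p.2.1 : ℝ) * (c t p * p.male) :=
        Finset.sum_nonneg fun p _ => mul_nonneg (Nat.cast_nonneg _)
          (mul_nonneg (hnn t ht p) (Nat.cast_nonneg _))
      have h6 : ∑ p ∈ smallParticles N, (p.2.1 : ℝ) * c t p =
          ∑ p ∈ smallParticles N, c t p * p.female :=
        Finset.sum_congr rfl fun p _ => mul_comm _ _
      rw [h6]
      have h7 := mul_le_mul_of_nonneg_right h4 (sub_nonneg.2 h2)
      have h8 := mul_nonneg h5 (sub_nonneg.2 h3)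
      nlinarith
  have h6 : ∀ t, ∑ p ∈ smallParticles N, (p.2.1 : ℝ) * c t p =
      ∑ p ∈ smallParticles N, c t p * p.female := fun t =>
    Finset.sum_congr rfl fun p _ => mul_comm _ _
  rw [h6, h6] at key
  refine key.trans (mul_le_mul_of_nonneg_right ?_ (femaleFactor_pos c T).le)
  exact (hc.summable_female le_rfl).sum_le_tsum _ fun p _ =>
    mul_nonneg (hnn 0 le_rfl p) (Nat.cast_nonneg _)

end IsSolution

/-! ### Identification of the solution -/

lemma one_sub_exp_neg_integral {w : ℝ → ℝ} {T : ℝ} (hT : 0 ≤ T)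
    (hw : IntervalIntegrable w volume 0 T) :
    ∫ t in 0..T, w t * Real.exp (-∫ s in 0..t, w s) = 1 - Real.exp (-∫ s in 0..T, w s) := by
  have h := integral_mul_exp_eq (f := fun _ => 1) (f' := fun _ => 0) (w := fun t => -w t) hT
    (fun t _ => hasDerivWithinAt_const _ _ _) (by simp) hw.neg
  simp only [intervalIntegral.integral_neg, zero_add, one_mul, neg_mul] at h
  linarith

namespace IsSolution

variable {c₀ : Particle → ℝ} {c : ℝ → Particle → ℝ} (hc : IsSolution c₀ ⊤ c)
include hc

/-- If the numbers of arms are at most the factors, then the factors decay no faster than on the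
characteristic. -/
lemma one_sub_innerTime_le (hm : ∀ t, 0 ≤ t → maleArms c t ≤ maleFactor c t)
    (hf : ∀ t, 0 ≤ t → femaleArms c t ≤ femaleFactor c t) {t : ℝ} (ht : 0 ≤ t) :
    1 - innerTime c t ≤ maleFactor c t ∧ 1 - innerTime c t ≤ femaleFactor c t := by
  have hsub : Set.uIcc 0 t ⊆ Set.Ici 0 := by
    rw [Set.uIcc_of_le ht]
    exact fun s hs => hs.1
  constructor
  · have h1 := one_sub_exp_neg_integral ht (hc.intervalIntegrable_femaleArms ht)
    change _ = 1 - maleFactor c t at h1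
    have h2 : ∫ s in 0..t, femaleArms c s * maleFactor c s ≤ innerTime c t := by
      refine intervalIntegral.integral_mono_on ht
        ((hc.intervalIntegrable_femaleArms ht).mul_continuousOn
          (hc.continuousOn_maleFactor.mono hsub)) (hc.intervalIntegrable_factors ht)
        fun s hs => ?_
      rw [mul_comm]
      exact mul_le_mul_of_nonneg_left (hf s hs.1) (maleFactor_pos c s).le
    have h3 : ∫ s in 0..t, femaleArms c s * maleFactor c s = 1 - maleFactor c t := h1
    linarith
  · have h1 := one_sub_exp_neg_integral ht (hc.intervalIntegrable_maleArms ht)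
    have h2 : ∫ s in 0..t, maleArms c s * femaleFactor c s ≤ innerTime c t := by
      refine intervalIntegral.integral_mono_on ht
        ((hc.intervalIntegrable_maleArms ht).mul_continuousOn
          (hc.continuousOn_femaleFactor.mono hsub)) (hc.intervalIntegrable_factors ht)
        fun s hs => mul_le_mul_of_nonneg_right (hm s hs.1) (femaleFactor_pos c s).le
    have h3 : ∫ s in 0..t, maleArms c s * femaleFactor c s = 1 - femaleFactor c t := h1
    linarith

end IsSolution

lemma armMonomial_mono {t t' : Fin 3 → ℝ≥0∞} (h : ∀ i, t i ≤ t' i) (d : Fin 3 →₀ ℕ) :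
    armMonomial t d ≤ armMonomial t' d :=
  Finset.prod_le_prod' fun i _ => pow_le_pow_left' (h i) _

lemma evalSeries_mono_left {t t' : Fin 3 → ℝ≥0∞} (h : ∀ i, t i ≤ t' i) (f : ArmSeries) :
    evalSeries t f ≤ evalSeries t' f :=
  ENNReal.tsum_le_tsum fun d => by gcongr; exact armMonomial_mono h d

lemma armPoint_mono {x x' y y' t : ℝ} (hx : x ≤ x') (hy : y ≤ y') (i : Fin 3) :
    armPoint x y t i ≤ armPoint x' y' t i := by
  fin_cases i
  · exact ENNReal.ofReal_le_ofReal hx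
  · exact ENNReal.ofReal_le_ofReal hy
  · exact le_rfl

namespace IsSolution

variable {μ : ℕ × ℕ → ℝ} {c : ℝ → Particle → ℝ} (hc : IsSolution (monodisperse μ) ⊤ c)
  (hμ : ∀ x, (ν x : ℝ) = μ x)
include hc hμ

lemma nonneg {t : ℝ} (ht : 0 ≤ t) (p : Particle) : 0 ≤ c t p := by
  rw [hc.eq_scaledConc hμ rfl ht]
  exact scaledConc_nonneg (maleFactor_pos c t).le (femaleFactor_pos c t).le
    (innerTime_nonneg c ht) p

lemma ofReal_maleArms {t : ℝ} (ht : 0 ≤ t) : ENNReal.ofReal (maleArms c t) =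
    ENNReal.ofReal (maleFactor c t) *
      valMale ν (maleFactor c t) (femaleFactor c t) (innerTime c t) := by
  rw [← tsum_ofReal_scaledConc_mul_male (maleFactor_pos c t).le (femaleFactor_pos c t).le
    (innerTime_nonneg c ht), maleArms, ENNReal.ofReal_tsum_of_nonneg (f := fun p => c t p * p.male)
      (fun p => mul_nonneg (hc.nonneg hμ ht p) (Nat.cast_nonneg _)) (hc.summable_male ht)]
  exact tsum_congr fun p => by rw [hc.eq_scaledConc hμ rfl ht p]

lemma ofReal_femaleArms {t : ℝ} (ht : 0 ≤ t) : ENNReal.ofReal (femaleArms c t) =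
    ENNReal.ofReal (femaleFactor c t) *
      valFemale ν (maleFactor c t) (femaleFactor c t) (innerTime c t) := by
  rw [← tsum_ofReal_scaledConc_mul_female (maleFactor_pos c t).le (femaleFactor_pos c t).le
    (innerTime_nonneg c ht), femaleArms, ENNReal.ofReal_tsum_of_nonneg (f := fun p => c t p * p.female)
      (fun p => mul_nonneg (hc.nonneg hμ ht p) (Nat.cast_nonneg _)) (hc.summable_female ht)]
  exact tsum_congr fun p => by rw [hc.eq_scaledConc hμ rfl ht p]

lemma maleArms_nonneg {t : ℝ} (ht : 0 ≤ t) : 0 ≤ maleArms c t :=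
  tsum_nonneg fun p => mul_nonneg (hc.nonneg hμ ht p) (Nat.cast_nonneg _)

lemma femaleArms_nonneg {t : ℝ} (ht : 0 ≤ t) : 0 ≤ femaleArms c t :=
  tsum_nonneg fun p => mul_nonneg (hc.nonneg hμ ht p) (Nat.cast_nonneg _)

/-- Every solution is the explicit one. -/
theorem eq_explicitSolution {α β γ : ℝ} (h : IsSubcritical ν α β γ)
    (hadm : IsAdmissible (monodisperse μ)) {t : ℝ} (ht : 0 ≤ t) :
    c t = explicitSolution ν t := by
  have hA0 : maleArms c 0 = 1 := by
    rw [← hadm.male_arms.tsum_eq]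
    exact tsum_congr fun p => by rw [hc.init]
  have hB0 : femaleArms c 0 = 1 := by
    rw [← hadm.female_arms.tsum_eq]
    exact tsum_congr fun p => by rw [hc.init]
  have hnn : ∀ t, 0 ≤ t → ∀ p, 0 ≤ c t p := fun t ht p => hc.nonneg hμ ht p
  have hm : ∀ t, 0 ≤ t → maleArms c t ≤ maleFactor c t := fun t ht => by
    simpa [hA0] using hc.maleArms_le hnn ht
  have hf : ∀ t, 0 ≤ t → femaleArms c t ≤ femaleFactor c t := fun t ht => by
    simpa [hB0] using hc.femaleArms_le hnn ht
  -- The point `(X, Y)` dominates `(1 - τ, 1 - τ)`, where `P = Q = 1`. Monotonicity gives `P, Q ≥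
  -- 1`, so the totals of arms are also at least the factors.
  have heq : ∀ t, 0 ≤ t → innerTime c t < 1 →
      maleArms c t = maleFactor c t ∧ femaleArms c t = femaleFactor c t := by
    intro t ht h1
    obtain ⟨hx, hy⟩ := hc.one_sub_innerTime_le hm hf ht
    obtain ⟨v1, v2⟩ := h.val_eq_one (innerTime_nonneg c ht) h1
    have m1 : 1 ≤ valMale ν (maleFactor c t) (femaleFactor c t) (innerTime c t) :=
      v1 ▸ evalSeries_mono_left (armPoint_mono hx hy) _
    have m2 : 1 ≤ valFemale ν (maleFactor c t) (femaleFactor c t) (innerTime c t) :=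
      v2 ▸ evalSeries_mono_left (armPoint_mono hx hy) _
    constructor
    · refine le_antisymm (hm t ht) ((ENNReal.ofReal_le_ofReal_iff (hc.maleArms_nonneg hμ ht)).1 ?_)
      rw [hc.ofReal_maleArms hμ ht]
      exact le_mul_of_one_le_right' m1
    · refine le_antisymm (hf t ht)
        ((ENNReal.ofReal_le_ofReal_iff (hc.femaleArms_nonneg hμ ht)).1 ?_)
      rw [hc.ofReal_femaleArms hμ ht]
      exact le_mul_of_one_le_right' m2
  have hmono : ∀ s t, 0 ≤ s → s ≤ t → innerTime c s ≤ innerTime c t := by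
    intro s t hs hst
    have h1 := hc.intervalIntegrable_factors hs
    have h2 := hc.intervalIntegrable_factors (hs.trans hst)
    have := intervalIntegral.integral_interval_sub_left h2 h1
    have h3 : 0 ≤ ∫ r in s..t, maleFactor c r * femaleFactor c r :=
      intervalIntegral.integral_nonneg hst fun r _ =>
        mul_nonneg (maleFactor_pos c r).le (femaleFactor_pos c r).le
    unfold innerTime
    linarith
  -- With equality, each factor decreases at rate `X Y`, exactly the rate at which `τ` increases.
  have hfac : ∀ t, 0 ≤ t → innerTime c t < 1 →
      maleFactor c t = 1 - innerTime c t ∧ femaleFactor c t = 1 - innerTime c t := by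
    intro t ht h1
    have hlt : ∀ s ∈ Set.uIcc 0 t, 0 ≤ s ∧ innerTime c s < 1 := fun s hs => by
      rw [Set.uIcc_of_le ht] at hs
      exact ⟨hs.1, (hmono s t hs.1 hs.2).trans_lt h1⟩
    have a1 := one_sub_exp_neg_integral ht (hc.intervalIntegrable_femaleArms ht)
    have a2 := one_sub_exp_neg_integral ht (hc.intervalIntegrable_maleArms ht)
    have b1 : ∫ s in 0..t, femaleArms c s * maleFactor c s = innerTime c t :=
      intervalIntegral.integral_congr fun s hs => by
        rw [(heq s (hlt s hs).1 (hlt s hs).2).2, mul_comm]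
    have b2 : ∫ s in 0..t, maleArms c s * femaleFactor c s = innerTime c t :=
      intervalIntegral.integral_congr fun s hs => by
        rw [(heq s (hlt s hs).1 (hlt s hs).2).1]
    have c1 : innerTime c t = 1 - maleFactor c t := b1.symm.trans a1
    have c2 : innerTime c t = 1 - femaleFactor c t := b2.symm.trans a2
    constructor <;> linarith
  have hanti : ∀ s t, 0 ≤ s → s ≤ t → maleFactor c t ≤ maleFactor c s := by
    intro s t hs hst
    have h1 := hc.intervalIntegrable_femaleArms hs
    have h2 := hc.intervalIntegrable_femaleArms (hs.trans hst)
    have := intervalIntegral.integral_interval_sub_left h2 h1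
    have h3 : 0 ≤ ∫ r in s..t, femaleArms c r :=
      intervalIntegral.integral_nonneg hst fun r hr => hc.femaleArms_nonneg hμ (hs.trans hr.1)
    refine Real.exp_le_exp.2 ?_
    linarith
  -- If `τ` reached `1` by time `t`, it would earlier take the value `1 - X(t) / 2`. There the
  -- factor would be `X(t) / 2`, smaller than its later value, although it is nonincreasing.
  have hlt : ∀ t, 0 ≤ t → innerTime c t < 1 := by
    intro t ht
    by_contra! hge
    have hpos := maleFactor_pos c t
    have hle : maleFactor c t ≤ 1 := by
      have := hanti 0 t le_rfl ht
      rwa [maleFactor_zero] at this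
    obtain ⟨s, hs, hsv⟩ : 1 - maleFactor c t / 2 ∈ innerTime c '' Set.Icc 0 t :=
      intermediate_value_Icc ht (hc.continuousOn_innerTime.mono fun s hs => hs.1)
        ⟨by rw [innerTime_zero]; linarith, by linarith⟩
    have h1 := (hfac s hs.1 (by linarith)).1
    have h2 := hanti s t hs.1 hs.2
    linarith
  -- The reciprocal of `X` grows at rate `femaleArms / X = Y / X = 1`, so `X = 1 / (1 + t)`.
  have hinv : innerTime c t = t / (1 + t) := by
    have hsub : ∀ s ∈ Set.uIcc 0 t, 0 ≤ s := fun s hs => by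
      rw [Set.uIcc_of_le ht] at hs
      exact hs.1
    have key := integral_mul_exp_eq (f := fun _ => 1) (f' := fun _ => 0) ht
      (fun t _ => hasDerivWithinAt_const _ _ _) (by simp) (hc.intervalIntegrable_femaleArms ht)
    have hone : ∫ s in 0..t, (0 + 1 * femaleArms c s) * Real.exp (∫ r in 0..s, femaleArms c r) =
        ∫ s in 0..t, (1 : ℝ) := by
      refine intervalIntegral.integral_congr fun s hs => ?_
      have hs0 := hsub s hs
      have h1 := hfac s hs0 (hlt s hs0)
      rw [(heq s hs0 (hlt s hs0)).2, h1.2, ← h1.1, maleFactor, zero_add, one_mul, ← Real.exp_add,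
        neg_add_cancel, Real.exp_zero]
    rw [hone] at key
    simp only [intervalIntegral.integral_const, sub_zero, smul_eq_mul, mul_one, one_mul] at key
    have h1 := (hfac t ht (hlt t ht)).1
    have h2 : maleFactor c t * (1 + t) = 1 := by
      rw [show 1 + t = Real.exp (∫ s in 0..t, femaleArms c s) by linarith, maleFactor,
        ← Real.exp_add, neg_add_cancel, Real.exp_zero]
    rw [eq_div_iff (by positivity)]
    rw [h1] at h2
    linarith
  funext p
  rw [hc.eq_scaledConc hμ rfl ht, explicitSolution, (hfac t ht (hlt t ht)).1,
    (hfac t ht (hlt t ht)).2, hinv]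

end IsSolution


/-! ### Limiting concentrations -/

namespace IsSubcritical

variable {α β γ : ℝ} (h : IsSubcritical ν α β γ)
include h

/-- For `t < 1` the full series is `P Q` at `(0, 0, t)`, hence at most one; finite partial sums
allow `t → 1`. -/
lemma sum_armless_le (N : ℕ) :
    ∑ n ∈ Finset.range N, ((n : ℝ) + 1) * treeConc ν (0, 0, (n + 1).succPNat) ≤ 1 := by
  have hlim : Tendsto (fun t : ℝ => ∑ n ∈ Finset.range N,
      ((n : ℝ) + 1) * treeConc ν (0, 0, (n + 1).succPNat) * t ^ n) (𝓝[<] 1)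
      (𝓝 (∑ n ∈ Finset.range N, ((n : ℝ) + 1) * treeConc ν (0, 0, (n + 1).succPNat))) := by
    have hcont : Continuous fun t : ℝ => ∑ n ∈ Finset.range N,
        ((n : ℝ) + 1) * treeConc ν (0, 0, (n + 1).succPNat) * t ^ n := by fun_prop
    have := hcont.tendsto 1
    simp only [one_pow, mul_one] at this
    exact this.mono_left nhdsWithin_le_nhds
  refine le_of_tendsto hlim ?_
  filter_upwards [Ioo_mem_nhdsLT (zero_lt_one (α := ℝ))] with t ht
  have hnn : ∀ n : ℕ, 0 ≤ ((n : ℝ) + 1) * treeConc ν (0, 0, (n + 1).succPNat) * t ^ n := fun n =>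
    mul_nonneg (mul_nonneg (by positivity) (treeConc_nonneg _)) (pow_nonneg ht.1.le _)
  have h1 := h.val_le_one (x := 0) (y := 0) le_rfl le_rfl ht.1.le (by linarith [ht.2])
    (by linarith [ht.2])
  rw [← ENNReal.ofReal_le_one, ENNReal.ofReal_sum_of_nonneg fun n _ => hnn n]
  refine (ENNReal.sum_le_tsum _).trans ?_
  rw [tsum_armless_eq ht.1.le]
  exact mul_le_one' h1.1 h1.2

lemma summable_armless : Summable fun m : ℕ+ => treeConc ν (0, 0, m) := by
  rw [← Equiv.pnatEquivNat.symm.summable_iff, ← summable_nat_add_iff 1]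
  refine summable_of_sum_range_le (c := 1) (fun n => treeConc_nonneg _) fun N => ?_
  refine (Finset.sum_le_sum fun n _ => ?_).trans (h.sum_armless_le N)
  exact le_mul_of_one_le_left (treeConc_nonneg _) (by simp)

lemma summable_armless_particle : Summable (armless fun m => treeConc ν (0, 0, m)) := by
  have hinj : Function.Injective fun m : ℕ+ => ((0, 0, m) : Particle) := fun m n e => by
    simpa using e
  refine (hinj.summable_iff fun p hp => ?_).1 
    (by simpa [Function.comp_def, armless] using h.summable_armless)
  rw [armless, if_neg]
  rintro ⟨h0, h1⟩
  exact hp ⟨p.2.2, ext_nat h0.symm h1.symm rfl⟩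

/-- Arms disappear, and the concentrations of armless particles converge, in `ℓ¹`. -/
theorem tendstoL1_explicitSolution :
    TendstoL1 (explicitSolution ν) (armless fun m => treeConc ν (0, 0, m)) := by
  set d : Particle → ℝ := armless fun m => treeConc ν (0, 0, m) with hd
  have hd0 : ∀ p, 0 ≤ d p := fun p => by
    rw [hd, armless]
    split_ifs
    exacts [treeConc_nonneg _, le_rfl]
  have hτ : Tendsto (fun t : ℝ => t / (1 + t)) atTop (𝓝 1) := by
    have : Tendsto (fun t : ℝ => 1 - (1 + t)⁻¹) atTop (𝓝 (1 - 0)) :=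
      tendsto_const_nhds.sub (tendsto_inv_atTop_zero.comp (tendsto_atTop_add_const_left _ 1 tendsto_id))
    rw [sub_zero] at this
    refine this.congr' ?_
    filter_upwards [eventually_ge_atTop 0] with t ht
    have : 1 + t ≠ 0 := by positivity
    field_simp
    ring
  -- A particle with arms is charged to its number of arms, which is at least one. For an armless
  -- particle the error is exactly `K (1 - τ^(m-1))`, which tends to zero in sum by domination.
  have hle : ∀ t, 0 ≤ t → ∑' p, ENNReal.ofReal |explicitSolution ν t p - d p| ≤
      ENNReal.ofReal ((1 - t / (1 + t)) + (1 - t / (1 + t))) +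
        ENNReal.ofReal (∑' p, d p * (1 - (t / (1 + t)) ^ p.2.2.natPred)) := by
    intro t ht
    obtain ⟨h0, h1⟩ := time_change_mem ht
    have hnn : ∀ p, 0 ≤ explicitSolution ν t p := fun p =>
      scaledConc_nonneg (by linarith) (by linarith) h0 p
    have harm : HasSum (fun p => explicitSolution ν t p * p.male + explicitSolution ν t p * p.female)
        ((1 - t / (1 + t)) + (1 - t / (1 + t))) :=
      (h.hasSum_scaledConc_male h0 h1).add (h.hasSum_scaledConc_female h0 h1)
    have harm0 : ∀ p : Particle,
        0 ≤ explicitSolution ν t p * p.male + explicitSolution ν t p * p.female := fun p =>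
      add_nonneg (mul_nonneg (hnn p) (Nat.cast_nonneg _)) (mul_nonneg (hnn p) (Nat.cast_nonneg _))
    have hfac : ∀ p : Particle, 0 ≤ 1 - (t / (1 + t)) ^ p.2.2.natPred := fun p =>
      sub_nonneg.2 (pow_le_one₀ h0 h1.le)
    have hres0 : ∀ p : Particle, 0 ≤ d p * (1 - (t / (1 + t)) ^ p.2.2.natPred) := fun p =>
      mul_nonneg (hd0 p) (hfac p)
    have hres : Summable fun p : Particle => d p * (1 - (t / (1 + t)) ^ p.2.2.natPred) :=
      h.summable_armless_particle.of_nonneg_of_le hres0 fun p =>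
        mul_le_of_le_one_right (hd0 p) (sub_le_self _ (pow_nonneg h0 _))
    rw [← harm.tsum_eq, ENNReal.ofReal_tsum_of_nonneg harm0 harm.summable,
      ENNReal.ofReal_tsum_of_nonneg hres0 hres, ← ENNReal.tsum_add]
    refine ENNReal.tsum_le_tsum fun p => ?_
    rw [← ENNReal.ofReal_add (harm0 p) (hres0 p)]
    refine ENNReal.ofReal_le_ofReal ?_
    by_cases hp : p.1 = 0 ∧ p.2.1 = 0
    · obtain ⟨a, b, m⟩ := p
      obtain ⟨rfl, rfl⟩ : a = 0 ∧ b = 0 := hp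
      refine le_of_eq ?_
      have hK : 0 ≤ treeConc ν (0, 0, m) := treeConc_nonneg _
      have := mul_nonneg hK (hfac (0, 0, m))
      simp only [hd, armless, explicitSolution, scaledConc, Particle.male, Particle.female, pow_zero, one_mul,
        Nat.cast_zero, mul_zero, add_zero, zero_add, and_self, if_true] at this ⊢
      rw [abs_sub_comm, ← mul_one_sub, abs_of_nonneg this]
    · rw [hd, armless, if_neg hp, sub_zero, zero_mul, add_zero, abs_of_nonneg (hnn p), ← mul_add]
      refine le_mul_of_one_le_right (hnn p) ?_
      rw [Particle.male, Particle.female]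
      have : 1 ≤ p.1 + p.2.1 := by omega
      exact_mod_cast this
  have hlim : Tendsto (fun t : ℝ => ENNReal.ofReal ((1 - t / (1 + t)) + (1 - t / (1 + t))) +
        ENNReal.ofReal (∑' p : Particle, d p * (1 - (t / (1 + t)) ^ p.2.2.natPred))) atTop
      (𝓝 0) := by
    have h1 : Tendsto (fun t : ℝ => (1 - t / (1 + t)) + (1 - t / (1 + t))) atTop (𝓝 0) := by
      have := (hτ.const_sub 1).add (hτ.const_sub 1)
      simpa using this
    have h2 : Tendsto (fun t : ℝ => ∑' p : Particle, d p * (1 - (t / (1 + t)) ^ p.2.2.natPred))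
        atTop (𝓝 (∑' _ : Particle, 0)) := by
      refine tendsto_tsum_of_dominated_convergence h.summable_armless_particle (fun p => ?_) ?_
      · have := ((hτ.pow p.2.2.natPred).const_sub 1).const_mul (d p)
        simpa using this
      · filter_upwards [eventually_ge_atTop 0] with t ht p
        obtain ⟨h0, h1⟩ := time_change_mem ht
        have hf : 0 ≤ 1 - (t / (1 + t)) ^ p.2.2.natPred := sub_nonneg.2 (pow_le_one₀ h0 h1.le)
        rw [Real.norm_of_nonneg (mul_nonneg (hd0 p) hf)]
        exact mul_le_of_le_one_right (hd0 p) (sub_le_self _ (pow_nonneg h0 _))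
    rw [tsum_zero] at h2
    simpa using (ENNReal.tendsto_ofReal h1).add (ENNReal.tendsto_ofReal h2)
  refine tendsto_of_tendsto_of_tendsto_of_le_of_le' tendsto_const_nhds hlim
    (Eventually.of_forall fun _ => zero_le) ?_
  filter_upwards [eventually_ge_atTop 0] with t ht using hle t ht

end IsSubcritical

/-! ### Monodisperse initial data -/

lemma hasSum_monodisperse_iff {μ : ℕ × ℕ → ℝ} {g : Particle → ℝ} {s : ℝ} :
    HasSum (fun p => monodisperse μ p * g p) s ↔
      HasSum (fun x : ℕ × ℕ => μ x * g (x.1, x.2, 1)) s := by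
  have hinj : Function.Injective fun x : ℕ × ℕ => ((x.1, x.2, 1) : Particle) := fun x y e => by
    simp only [Prod.mk.injEq, and_true] at e
    exact Prod.ext e.1 e.2
  rw [← hinj.hasSum_iff]
  · simp [Function.comp_def, monodisperse]
  · intro p hp
    rw [monodisperse, if_neg, zero_mul]
    intro h1
    exact hp ⟨(p.1, p.2.1), ext_nat rfl rfl (by rw [h1])⟩

lemma hasSum_fst_succ_iff {f : ℕ × ℕ → ℝ} (h0 : ∀ b, f (0, b) = 0) {s : ℝ} :
    HasSum (fun x : ℕ × ℕ => f (x.1 + 1, x.2)) s ↔ HasSum f s := by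
  have hinj : Function.Injective fun x : ℕ × ℕ => ((x.1 + 1, x.2) : ℕ × ℕ) := fun x y e => by
    simp only [Prod.mk.injEq, add_left_inj] at e
    exact Prod.ext e.1 e.2
  refine hinj.hasSum_iff fun x hx => ?_
  obtain ⟨a, b⟩ := x
  cases a with
  | zero => exact h0 b
  | succ a => exact absurd ⟨(a, b), rfl⟩ hx

lemma hasSum_snd_succ_iff {f : ℕ × ℕ → ℝ} (h0 : ∀ a, f (a, 0) = 0) {s : ℝ} :
    HasSum (fun x : ℕ × ℕ => f (x.1, x.2 + 1)) s ↔ HasSum f s := by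
  have hinj : Function.Injective fun x : ℕ × ℕ => ((x.1, x.2 + 1) : ℕ × ℕ) := fun x y e => by
    simp only [Prod.mk.injEq, add_left_inj] at e
    exact Prod.ext e.1 e.2
  refine hinj.hasSum_iff fun x hx => ?_
  obtain ⟨a, b⟩ := x
  cases b with
  | zero => exact h0 a
  | succ b => exact absurd ⟨(a, b), rfl⟩ hx

/-- The first moments of the size-biased laws are `⟨c₀, a² - a⟩`, `⟨c₀, b² - b⟩` and `⟨c₀, ab⟩`, and
an infinite critical time means `M ≤ 1`. -/
theorem isSubcritical_of_criticalTime_eq_top {μ : ℕ × ℕ → ℝ}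
    (hadm : IsAdmissible (monodisperse μ)) (hTc : criticalTime (monodisperse μ) = ⊤)
    (hμ : ∀ x, (ν x : ℝ) = μ x) : ∃ α β γ, IsSubcritical ν α β γ := by
  have hdom : ∀ g : Particle → ℝ, (∀ p, |g p| ≤ p.male ^ 2 + p.female ^ 2) →
      HasSum (fun x : ℕ × ℕ => μ x * g (x.1, x.2, 1)) (pairing (monodisperse μ) g) := by
    intro g hg
    refine hasSum_monodisperse_iff.1 (Summable.hasSum ?_)
    refine hadm.second_moments.of_norm_bounded fun p => ?_
    rw [norm_mul, Real.norm_of_nonneg (hadm.nonneg p), Real.norm_eq_abs]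
    exact mul_le_mul_of_nonneg_left (hg p) (hadm.nonneg p)
  have hsq : ∀ n : ℕ, (n : ℝ) ≤ n ^ 2 := fun n => by
    exact_mod_cast Nat.le_self_pow two_ne_zero n
  have hA := hdom (fun p => p.male ^ 2 - p.male) fun p => by
    rw [abs_of_nonneg (sub_nonneg.2 (show p.male ≤ p.male ^ 2 from hsq p.1))]
    have : 0 ≤ p.male := Nat.cast_nonneg _
    nlinarith [sq_nonneg p.female]
  have hB := hdom (fun p => p.female ^ 2 - p.female) fun p => by
    rw [abs_of_nonneg (sub_nonneg.2 (show p.female ≤ p.female ^ 2 from hsq p.2.1))]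
    have : 0 ≤ p.female := Nat.cast_nonneg _
    nlinarith [sq_nonneg p.male]
  have hC := hdom (fun p => p.male * p.female) fun p => by
    rw [abs_of_nonneg (mul_nonneg (Nat.cast_nonneg _) (Nat.cast_nonneg _))]
    nlinarith [sq_nonneg (p.male - p.female), sq_nonneg (p.male + p.female)]
  have h1 := hasSum_monodisperse_iff.1 hadm.male_arms
  have h2 := hasSum_monodisperse_iff.1 hadm.female_arms
  refine ⟨pairing (monodisperse μ) fun p => p.male ^ 2 - p.male,
    pairing (monodisperse μ) fun p => p.female ^ 2 - p.female,
    pairing (monodisperse μ) fun p => p.male * p.female, ?_, ?_, ?_, ?_, ?_, ?_, ?_⟩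
  · convert! (hasSum_fst_succ_iff (by simp [male])).2 h1 using 1
    ext x
    simp only [femaleWeight, hμ, male]; push_cast; ring
  · convert! (hasSum_snd_succ_iff (by simp [female])).2 h2 using 1
    ext x
    simp only [maleWeight, hμ, female]; push_cast; ring
  · convert! (hasSum_fst_succ_iff (by simp [male])).2 hA using 1
    ext x
    simp only [femaleWeight, hμ, male]; push_cast; ring
  · convert! (hasSum_fst_succ_iff (by simp [male])).2 hC using 1
    ext x
    simp only [femaleWeight, hμ, male, female]; push_cast; ring
  · convert! (hasSum_snd_succ_iff (by simp [female])).2 hC using 1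
    ext x
    simp only [maleWeight, hμ, male, female]; push_cast; ring
  · convert! (hasSum_snd_succ_iff (by simp [female])).2 hB using 1
    ext x
    simp only [maleWeight, hμ, female]; push_cast; ring
  · rw [criticalTime] at hTc
    by_contra hM
    rw [if_neg (show ¬ criticalParameter (monodisperse μ) ≤ 1 from hM)] at hTc
    exact ENNReal.ofReal_ne_top hTc


/-! ### Fixed points of the offspring generating functions -/

lemma one_sub_pow_mul_pow_le {a b : ℝ} (ha : a ∈ Set.Icc (0 : ℝ) 1) (hb : b ∈ Set.Icc (0 : ℝ) 1)
    (i j : ℕ) : 1 - a ^ i * b ^ j ≤ i * (1 - a) + j * (1 - b) := by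
  have := abs_pow_mul_pow_sub_le (X := 1) (Y := 1) (by simp) (by simp) ha hb i j
  rw [one_pow, one_pow, one_mul, abs_of_nonneg (sub_nonneg.2 ha.2),
    abs_of_nonneg (sub_nonneg.2 hb.2)] at this
  exact (le_abs_self _).trans this

/-- Peeling off one factor `a` costs `aⁱ bʲ (1 - a)`, which is strictly less than `1 - a` as soon as
another factor remains. -/
lemma one_sub_pow_succ_mul_pow_lt {a b : ℝ} (ha : a ∈ Set.Ico (0 : ℝ) 1)
    (hb : b ∈ Set.Ico (0 : ℝ) 1) {i j : ℕ} (hij : 1 ≤ i + j) :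
    1 - a ^ (i + 1) * b ^ j < (i + 1) * (1 - a) + j * (1 - b) := by
  have h1 := one_sub_pow_mul_pow_le (Set.Ico_subset_Icc_self ha) (Set.Ico_subset_Icc_self hb) i j
  have h2 : a ^ i * b ^ j < 1 := by
    rcases Nat.eq_zero_or_pos i with rfl | hi
    · simpa using pow_lt_one₀ hb.1 hb.2 (by omega)
    · exact mul_lt_one_of_nonneg_of_lt_one_left (pow_nonneg ha.1 i)
        (pow_lt_one₀ ha.1 ha.2 hi.ne') (pow_le_one₀ hb.1 hb.2.le)
  rw [pow_succ, mul_right_comm]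
  nlinarith [ha.2]

lemma add_le_one_of_one_sub_pow_mul_pow_eq {a b : ℝ} (ha : a ∈ Set.Ico (0 : ℝ) 1)
    (hb : b ∈ Set.Ico (0 : ℝ) 1) {i j : ℕ}
    (h : 1 - a ^ i * b ^ j = i * (1 - a) + j * (1 - b)) : i + j ≤ 1 := by
  by_contra! hij
  rcases i with _ | i
  · obtain ⟨j, rfl⟩ : ∃ k, j = k + 1 := ⟨j - 1, by omega⟩
    have := one_sub_pow_succ_mul_pow_lt hb ha (i := j) (j := 0) (by omega)
    push_cast at h this
    linarith
  · have := one_sub_pow_succ_mul_pow_lt ha hb (i := i) (j := j) (by omega)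
    push_cast at h
    linarith

/-- An equality case: a probability weight concentrated on at most one child. -/
lemma weight_eq_zero_of_gen_eq {ψ : ℕ × ℕ → ℝ} (h0 : ∀ x, 0 ≤ ψ x) {A B a b : ℝ}
    (hψ : HasSum ψ 1) (hA : HasSum (fun x => ψ x * x.1) A) (hB : HasSum (fun x => ψ x * x.2) B)
    (ha : a ∈ Set.Ico (0 : ℝ) 1) (hb : b ∈ Set.Ico (0 : ℝ) 1)
    (h : 1 - gen ψ a b = A * (1 - a) + B * (1 - b)) (x : ℕ × ℕ) (hx : 1 < x.1 + x.2) :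
    ψ x = 0 := by
  have ha' := Set.Ico_subset_Icc_self ha
  have hb' := Set.Ico_subset_Icc_self hb
  -- The hypothesis `h` says that the termwise gaps in the linear bound sum to zero. Being
  -- nonnegative, they all vanish.
  have hs := ((hA.mul_right (1 - a)).add (hB.mul_right (1 - b))).sub
    (hψ.sub (summable_gen h0 hψ.summable ha' hb').hasSum)
  rw [← gen, h, sub_self] at hs
  have hz := (hasSum_zero_iff_of_nonneg fun y => ?_).1 hs
  · have hy := congrFun hz x
    simp only [Pi.zero_apply] at hy
    by_contra hne
    have : ψ x * (x.1 * (1 - a) + x.2 * (1 - b) - (1 - a ^ x.1 * b ^ x.2)) = 0 := by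
      rw [← hy]; ring
    have := add_le_one_of_one_sub_pow_mul_pow_eq ha hb
      (sub_eq_zero.1 ((mul_eq_zero.1 this).resolve_left hne)).symm
    omega
  · have := mul_nonneg (h0 y) (sub_nonneg.2 (one_sub_pow_mul_pow_le ha' hb' y.1 y.2))
    calc (0 : ℝ) ≤ _ := this
      _ = _ := by ring

/-- With at most one child, the mean number of children is the probability of having one; it equals
`1` only if childlessness has probability zero. -/
lemma weight_zero_of_concentrated {ψ : ℕ × ℕ → ℝ} (h0 : ∀ x, 0 ≤ ψ x) {A B : ℝ}
    (hψ : HasSum ψ 1) (hA : HasSum (fun x => ψ x * x.1) A) (hB : HasSum (fun x => ψ x * x.2) B)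
    (hconc : ∀ x : ℕ × ℕ, 1 < x.1 + x.2 → ψ x = 0) :
    A + B ≤ 1 ∧ (A + B = 1 → ψ (0, 0) = 0) := by
  have hs := hψ.sub (hA.add hB)
  have hnn : ∀ x : ℕ × ℕ, 0 ≤ ψ x - (ψ x * x.1 + ψ x * x.2) := fun x => by
    by_cases hx : 1 < x.1 + x.2
    · simp [hconc x hx]
    · have : ((x.1 : ℝ) + x.2) ≤ 1 := by exact_mod_cast not_lt.1 hx
      nlinarith [h0 x]
  refine ⟨by linarith [hs.nonneg hnn], fun h1 => ?_⟩
  rw [h1, sub_self] at hs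
  simpa using congrFun ((hasSum_zero_iff_of_nonneg hnn).1 hs) (0, 0)

section weights

variable {μ : ℕ × ℕ → ℝ} (hμ : ∀ x, (ν x : ℝ) = μ x)
include hμ

lemma eq_zero_of_femaleWeight_eq_zero {a b : ℕ} (hw : femaleWeight ν (a, b) = 0) :
    μ (a + 1, b) = 0 := by
  rw [femaleWeight, hμ] at hw
  exact (mul_eq_zero.1 hw).resolve_left (by positivity)

lemma eq_zero_of_maleWeight_eq_zero {a b : ℕ} (hw : maleWeight ν (a, b) = 0) :
    μ (a, b + 1) = 0 := by
  rw [maleWeight, hμ] at hw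
  exact (mul_eq_zero.1 hw).resolve_left (by positivity)

end weights

namespace IsSubcritical

variable {α β γ : ℝ} (h : IsSubcritical ν α β γ) {μ : ℕ × ℕ → ℝ} (hμ : ∀ x, (ν x : ℝ) = μ x)
include h hμ

/-- Here `α β = 0`. If `α = 0`, no type has two or more male arms; a male then has at most one male
child, and the mean `γ = 1` forces exactly one. So every type with arms has exactly one male arm.
The case `β = 0` is symmetric. -/
lemma isDegenerate_of_gamma_eq_one (hγ : γ = 1) : IsDegenerate μ := by
  have hαβ : α * β = 0 := by
    refine le_antisymm (h.mul_le_sq.trans (by simp [hγ])) (mul_nonneg h.alpha_nonneg h.beta_nonneg)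
  rcases mul_eq_zero.1 hαβ with h0 | h0
  · have h1 := h.female_fst
    rw [h0, hasSum_zero_iff_of_nonneg
      fun x => mul_nonneg (femaleWeight_nonneg x) x.1.cast_nonneg] at h1
    have h2 : ∀ a b, μ (a + 2, b) = 0 := fun a b =>
      eq_zero_of_femaleWeight_eq_zero hμ
        ((mul_eq_zero.1 (congrFun h1 (a + 1, b))).resolve_right (by positivity))
    have h3 := h.male.sub h.male_fst
    have h4 : ∀ x : ℕ × ℕ, 0 ≤ maleWeight ν x - maleWeight ν x * x.1 := fun x => by
      rcases x with ⟨_ | _ | a, b⟩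
      · simpa using maleWeight_nonneg _
      · simp
      · simp [maleWeight, hμ, h2]
    rw [hγ, sub_self, hasSum_zero_iff_of_nonneg h4] at h3
    have h5 : ∀ b, μ (0, b + 1) = 0 := fun b =>
      eq_zero_of_maleWeight_eq_zero hμ (by simpa using congrFun h3 (0, b))
    refine Or.inl fun a b hab ha => ?_
    rcases a with _ | _ | a
    · rcases b with _ | b
      exacts [absurd rfl hab, h5 b]
    · exact absurd rfl ha
    · exact h2 a b
  · have h1 := h.male_snd
    rw [h0, hasSum_zero_iff_of_nonneg
      fun x => mul_nonneg (maleWeight_nonneg x) x.2.cast_nonneg] at h1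
    have h2 : ∀ a b, μ (a, b + 2) = 0 := fun a b =>
      eq_zero_of_maleWeight_eq_zero hμ
        ((mul_eq_zero.1 (congrFun h1 (a, b + 1))).resolve_right (by positivity))
    have h3 := h.female.sub h.female_snd
    have h4 : ∀ x : ℕ × ℕ, 0 ≤ femaleWeight ν x - femaleWeight ν x * x.2 := fun x => by
      rcases x with ⟨a, _ | _ | b⟩
      · simpa using femaleWeight_nonneg _
      · simp
      · simp [femaleWeight, hμ, h2]
    rw [hγ, sub_self, hasSum_zero_iff_of_nonneg h4] at h3
    have h5 : ∀ a, μ (a + 1, 0) = 0 := fun a =>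
      eq_zero_of_femaleWeight_eq_zero hμ (by simpa using congrFun h3 (a, 0))
    refine Or.inr (Or.inl fun a b hab hb => ?_)
    rcases b with _ | _ | b
    · rcases a with _ | a
      exacts [absurd rfl hab, h5 a]
    · exact absurd rfl hb
    · exact h2 a b

/-- Unless `μ` is degenerate, the offspring generating functions have no other fixed point in the
unit square than `(1, 1)`. -/
theorem fixedPoint_eq_one (hdeg : ¬ IsDegenerate μ) {a b : ℝ} (ha : a ∈ Set.Icc (0 : ℝ) 1)
    (hb : b ∈ Set.Icc (0 : ℝ) 1) (hfa : a = gen (maleWeight ν) a b)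
    (hfb : b = gen (femaleWeight ν) a b) : a = 1 ∧ b = 1 := by
  have hγ : 0 < 1 - γ := sub_pos.2 (lt_of_le_of_ne h.gamma_le_one
    fun h1 => hdeg (h.isDegenerate_of_gamma_eq_one hμ h1))
  have he0 : 0 ≤ 1 - a := sub_nonneg.2 ha.2
  have hf0 : 0 ≤ 1 - b := sub_nonneg.2 hb.2
  have he := h.abs_gen_male_sub_le (X := 1) (Y := 1) (by simp) (by simp) ha hb
  have hf := h.abs_gen_female_sub_le (X := 1) (Y := 1) (by simp) (by simp) ha hb
  rw [h.gen_male_one, ← hfa, abs_of_nonneg he0, abs_of_nonneg hf0] at he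
  rw [h.gen_female_one, ← hfb, abs_of_nonneg he0, abs_of_nonneg hf0] at hf
  have hα := h.alpha_nonneg
  have hβ := h.beta_nonneg
  have hsq := h.mul_le_sq
  by_contra hne
  have hepos : 0 < 1 - a := by
    refine lt_of_le_of_ne he0 fun h1 => hne ?_
    rw [← h1] at hf
    constructor <;> nlinarith
  have hfpos : 0 < 1 - b := by
    refine lt_of_le_of_ne hf0 fun h1 => hne ?_
    rw [← h1] at he
    constructor <;> nlinarith
  have ha1 : a ∈ Set.Ico (0 : ℝ) 1 := ⟨ha.1, by linarith⟩
  have hb1 : b ∈ Set.Ico (0 : ℝ) 1 := ⟨hb.1, by linarith⟩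
  have hle1 : (1 - γ) * (1 - a) ≤ β * (1 - b) := by linarith
  have hle2 : (1 - γ) * (1 - b) ≤ α * (1 - a) := by linarith
  have hp1 : 0 < (1 - γ) * (1 - a) := mul_pos hγ hepos
  have hp2 : 0 < (1 - γ) * (1 - b) := mul_pos hγ hfpos
  -- Multiplied together, the two row inequalities run against `α β ≤ (1 - γ)²`, so both must be
  -- equalities.
  have hprod : (β * (1 - b)) * (α * (1 - a)) ≤ ((1 - γ) * (1 - a)) * ((1 - γ) * (1 - b)) := by
    have := mul_le_mul_of_nonneg_right hsq (mul_pos hepos hfpos).le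
    linarith
  have heq1 : (1 - γ) * (1 - a) = β * (1 - b) := by
    refine le_antisymm hle1 (le_of_mul_le_mul_right ?_ hp2)
    exact (mul_le_mul_of_nonneg_left hle2 (hp1.le.trans hle1)).trans hprod
  have heq2 : (1 - γ) * (1 - b) = α * (1 - a) := by
    refine le_antisymm hle2 (le_of_mul_le_mul_left ?_ hp1)
    exact (mul_le_mul_of_nonneg_right hle1 (hp2.le.trans hle2)).trans hprod
  have heq3 : α * β = (1 - γ) ^ 2 := by
    refine mul_right_cancel₀ (mul_pos hepos hfpos).ne' ?_
    calc α * β * ((1 - a) * (1 - b)) = (β * (1 - b)) * (α * (1 - a)) := by ring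
      _ = _ := by rw [← heq1, ← heq2]; ring
  -- Equality in the linear bounds means that no individual has more than one child.
  have hm := weight_eq_zero_of_gen_eq maleWeight_nonneg h.male h.male_fst h.male_snd ha1 hb1
    (by rw [← hfa]; linarith)
  have hfm := weight_eq_zero_of_gen_eq femaleWeight_nonneg h.female h.female_fst h.female_snd ha1
    hb1 (by rw [← hfb]; linarith)
  obtain ⟨hm1, hm2⟩ := weight_zero_of_concentrated maleWeight_nonneg h.male h.male_fst h.male_snd hm
  obtain ⟨hf1, hf2⟩ :=
    weight_zero_of_concentrated femaleWeight_nonneg h.female h.female_fst h.female_snd hfm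
  -- Now `α` and `β` are at most `1 - γ` with product `(1 - γ)²`, so both equal `1 - γ`. Each law
  -- has mean one and almost surely a child, which excludes the types `(0, 1)` and `(1, 0)`.
  have hm3 := eq_zero_of_maleWeight_eq_zero hμ (hm2 (by nlinarith))
  have hf3 := eq_zero_of_femaleWeight_eq_zero hμ (hf2 (by nlinarith))
  refine hdeg (Or.inr (Or.inr fun i j h00 h11 h20 h02 => ?_))
  rcases j with _ | j
  · rcases i with _ | i
    · exact absurd rfl h00
    · rcases Nat.eq_zero_or_pos i with rfl | hi
      · exact hf3
      · refine eq_zero_of_femaleWeight_eq_zero hμ (hfm _ ?_)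
        rw [Ne, Prod.mk.injEq] at h20
        show 1 < i + 0
        omega
  · by_cases hz : i = 0 ∧ j = 0
    · obtain ⟨rfl, rfl⟩ := hz
      exact hm3
    · refine eq_zero_of_maleWeight_eq_zero hμ (hm _ ?_)
      rw [Ne, Prod.mk.injEq] at h11 h02
      show 1 < i + j
      omega

end IsSubcritical


/-! ### Generating functions of a Galton–Watson process -/

/-- The monomial `uᵃ vᵇ`. -/
def monomialWeight (u v : ℝ≥0∞) (x : ℕ × ℕ) : ℝ≥0∞ := u ^ x.1 * v ^ x.2

lemma monomialWeight_add (u v : ℝ≥0∞) (x y : ℕ × ℕ) :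
    monomialWeight u v (x + y) = monomialWeight u v x * monomialWeight u v y := by
  simp only [monomialWeight, Prod.fst_add, Prod.snd_add, pow_add]
  ring

lemma monomialWeight_sum {ι : Type*} (u v : ℝ≥0∞) (s : Finset ι) (f : ι → ℕ × ℕ) :
    monomialWeight u v (∑ i ∈ s, f i) = ∏ i ∈ s, monomialWeight u v (f i) := by
  simp [monomialWeight, Prod.fst_sum, Prod.snd_sum, Finset.prod_pow_eq_pow_sum,
    Finset.prod_mul_distrib]

/-- The generating function of a measure on `ℕ × ℕ`. -/
def genMeasure (κ : Measure (ℕ × ℕ)) (u v : ℝ≥0∞) : ℝ≥0∞ := ∫⁻ x, monomialWeight u v x ∂κ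

section GaltonWatson

variable {Ω : Type*} {ξ : Gender × ℕ × ℕ → Ω → ℕ × ℕ}

/-- The number of individuals in the first `N` generations. -/
def progeny (ξ : Gender × ℕ × ℕ → Ω → ℕ × ℕ) (z : ℕ × ℕ) (N : ℕ) (ω : Ω) : ℕ :=
  ∑ n ∈ Finset.range N, ((galtonWatson ξ z n ω).1 + (galtonWatson ξ z n ω).2)

/-- The offspring of `x.1` males and `x.2` females of generation `n`. -/
def offspring (ξ : Gender × ℕ × ℕ → Ω → ℕ × ℕ) (n : ℕ) (x : ℕ × ℕ) (ω : Ω) : ℕ × ℕ :=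
  ∑ i ∈ Finset.range x.1, ξ (.male, n, i) ω + ∑ i ∈ Finset.range x.2, ξ (.female, n, i) ω

lemma measurable_offspring {m : MeasurableSpace Ω} {n : ℕ}
    (hξ : ∀ g i, Measurable[m] (ξ (g, n, i))) (x : ℕ × ℕ) :
    Measurable[m] (offspring ξ n x) := by
  unfold offspring
  exact (Finset.measurable_fun_sum _ fun i _ => hξ _ i).add
    (Finset.measurable_fun_sum _ fun i _ => hξ _ i)

lemma measurable_galtonWatson {m : MeasurableSpace Ω} (z : ℕ × ℕ) (N : ℕ)
    (hξ : ∀ g n i, n < N → Measurable[m] (ξ (g, n, i))) :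
    Measurable[m] (galtonWatson ξ z N) := by
  induction N with
  | zero => exact measurable_const
  | succ N ih =>
    have h1 := ih fun g n i hn => hξ g n i (hn.trans N.lt_succ_self)
    have h2 : Measurable fun p : (ℕ × ℕ) × Ω => offspring ξ N p.1 p.2 :=
      measurable_from_prod_countable_right fun x =>
        measurable_offspring (fun g i => hξ g N i N.lt_succ_self) x
    exact h2.comp (h1.prodMk measurable_id)

lemma measurable_progeny {m : MeasurableSpace Ω} (z : ℕ × ℕ) (N : ℕ)
    (hξ : ∀ g n i, n < N → Measurable[m] (ξ (g, n, i))) : Measurable[m] (progeny ξ z N) := by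
  unfold progeny
  refine Finset.measurable_fun_sum _ fun n hn => ?_
  have := measurable_galtonWatson z n fun g k i hk =>
    hξ g k i (hk.trans (Finset.mem_range.1 hn))
  exact this.fst.add this.snd

/-- The events depending on the first `N` generations. -/
abbrev past (ξ : Gender × ℕ × ℕ → Ω → ℕ × ℕ) (N : ℕ) : MeasurableSpace Ω :=
  ⨆ j ∈ {j : Gender × ℕ × ℕ | j.2.1 < N}, MeasurableSpace.comap (ξ j) inferInstance

lemma measurable_past {N : ℕ} (g : Gender) (n i : ℕ) (hn : n < N) :
    Measurable[past ξ N] (ξ (g, n, i)) := by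
  refine measurable_iff_comap_le.2 ?_
  exact le_iSup₂_of_le (f := fun (j : Gender × ℕ × ℕ) (_ : j ∈ {j : Gender × ℕ × ℕ | j.2.1 < N}) =>
    MeasurableSpace.comap (ξ j) inferInstance) (g, n, i) hn le_rfl

end GaltonWatson

namespace IsOffspringFamily

variable {Ω : Type*} [mΩ : MeasurableSpace Ω] {ξ : Gender × ℕ × ℕ → Ω → ℕ × ℕ}
  {L : Gender → Measure (ℕ × ℕ)} {P : Measure Ω} (h : IsOffspringFamily L ξ P)
  (hm : ∀ j, Measurable (ξ j))
include h hm

lemma lintegral_offspring (u v : ℝ≥0∞) (n : ℕ) (x : ℕ × ℕ) :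
    ∫⁻ ω, monomialWeight u v (offspring ξ n x ω) ∂P =
      genMeasure (L .male) u v ^ x.1 * genMeasure (L .female) u v ^ x.2 := by
  let e : ℕ ⊕ ℕ → Gender × ℕ × ℕ := Sum.elim (fun i => (.male, n, i)) (fun i => (.female, n, i))
  have he : Function.Injective e := by
    rintro (i | i) (j | j) hij <;> simp [e] at hij ⊢
    · exact hij
    · exact hij
  have hW : Measurable (monomialWeight u v) := measurable_of_countable _
  have hind := (h.indep.precomp he).comp (fun _ => monomialWeight u v) fun _ => hW
  have hone : ∀ j, ∫⁻ ω, monomialWeight u v (ξ j ω) ∂P = genMeasure (L j.1) u v := fun j => by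
    rw [genMeasure, ← (h.law j).map_eq, lintegral_map hW (hm j)]
  have hprod : ∀ ω, monomialWeight u v (offspring ξ n x ω) =
      ∏ i ∈ (Finset.range x.1).disjSum (Finset.range x.2), monomialWeight u v (ξ (e i) ω) := by
    intro ω
    rw [offspring, monomialWeight_add, monomialWeight_sum, monomialWeight_sum,
      Finset.prod_disjSum]
    rfl
  simp only [hprod]
  have := lintegral_prod_eq_prod_lintegral_of_indepFun
    ((Finset.range x.1).disjSum (Finset.range x.2)) _ hind fun i => hW.comp (hm _)
  refine this.trans ?_
  simp only [Function.comp_apply, hone, Finset.prod_disjSum]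
  simp [e]

/-- The variables of generation `N` are independent of those of earlier generations, on which `F`
depends. -/
lemma lintegral_mul_offspring {F : Ω → ℝ≥0∞} {N : ℕ} (hF : Measurable[past ξ N] F) (u v : ℝ≥0∞)
    (x : ℕ × ℕ) :
    ∫⁻ ω, F ω * monomialWeight u v (offspring ξ N x ω) ∂P = (∫⁻ ω, F ω ∂P) *
      (genMeasure (L .male) u v ^ x.1 * genMeasure (L .female) u v ^ x.2) := by
  have hle : ∀ j, MeasurableSpace.comap (ξ j) inferInstance ≤ mΩ := fun j =>
    measurable_iff_comap_le.1 (hm j)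
  have hdisj : Disjoint {j : Gender × ℕ × ℕ | j.2.1 < N} {j : Gender × ℕ × ℕ | j.2.1 = N} :=
    Set.disjoint_left.2 fun j h1 h2 => (ne_of_lt h1) h2
  have hind := indep_iSup_of_disjoint hle h.indep.iIndep hdisj
  rw [← h.lintegral_offspring hm]
  refine lintegral_mul_eq_lintegral_mul_lintegral_of_independent_measurableSpace
    (iSup₂_le fun j _ => hle j) (iSup₂_le fun j _ => hle j) hind hF ?_
  refine (measurable_of_countable (monomialWeight u v)).comp (measurable_offspring ?_ x)
  intro g i
  refine measurable_iff_comap_le.2 ?_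
  exact le_iSup₂_of_le (f := fun (j : Gender × ℕ × ℕ) (_ : j ∈ {j : Gender × ℕ × ℕ | j.2.1 = N}) =>
    MeasurableSpace.comap (ξ j) inferInstance) (g, N, i) rfl le_rfl

/-- The joint generating function of the progeny and of the current generation, one generation
later. -/
lemma lintegral_progeny_succ (z : ℕ × ℕ) (s u v : ℝ≥0∞) (N : ℕ) :
    ∫⁻ ω, s ^ progeny ξ z (N + 1) ω * monomialWeight u v (galtonWatson ξ z (N + 1) ω) ∂P =
      ∫⁻ ω, s ^ progeny ξ z N ω * monomialWeight (s * genMeasure (L .male) u v)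
        (s * genMeasure (L .female) u v) (galtonWatson ξ z N ω) ∂P := by
  have hZ : Measurable[past ξ N] (galtonWatson ξ z N) :=
    measurable_galtonWatson z N measurable_past
  have hS : Measurable[past ξ N] (progeny ξ z N) := measurable_progeny z N measurable_past
  have hple : past ξ N ≤ mΩ := iSup₂_le fun j _ => measurable_iff_comap_le.1 (hm j)
  -- Decomposition over the composition `x` of generation `N`: once it is fixed, the next generation
  -- is an explicit function of fresh variables, and the `N`th contributes `s^(x.1 + x.2)`.
  set F : ℕ × ℕ → Ω → ℝ≥0∞ := fun x ω =>
    (if galtonWatson ξ z N ω = x then 1 else 0) * (s ^ progeny ξ z N ω * s ^ (x.1 + x.2)) with hFdef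
  have hF : ∀ x, Measurable[past ξ N] (F x) := fun x => by
    have h1 : Measurable[past ξ N] fun ω => (galtonWatson ξ z N ω, progeny ξ z N ω) := hZ.prodMk hS
    exact (measurable_of_countable fun y : (ℕ × ℕ) × ℕ =>
      (if y.1 = x then (1 : ℝ≥0∞) else 0) * (s ^ y.2 * s ^ (x.1 + x.2))).comp h1
  have hoff : ∀ x, Measurable fun ω => monomialWeight u v (offspring ξ N x ω) := fun x =>
    (measurable_of_countable (monomialWeight u v)).comp
      (measurable_offspring (fun g i => hm _) x)
  have e1 : ∀ ω, s ^ progeny ξ z (N + 1) ω * monomialWeight u v (galtonWatson ξ z (N + 1) ω) =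
      ∑' x, F x ω * monomialWeight u v (offspring ξ N x ω) := by
    intro ω
    rw [tsum_eq_single (galtonWatson ξ z N ω)]
    · rw [hFdef]
      simp only [if_true, one_mul]
      rw [progeny, Finset.sum_range_succ, pow_add]
      rfl
    · intro x hx
      simp [hFdef, Ne.symm hx]
  have e2 : ∀ ω, s ^ progeny ξ z N ω * monomialWeight (s * genMeasure (L .male) u v)
        (s * genMeasure (L .female) u v) (galtonWatson ξ z N ω) =
      ∑' x, F x ω * (genMeasure (L .male) u v ^ x.1 * genMeasure (L .female) u v ^ x.2) := by
    intro ω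
    rw [tsum_eq_single (galtonWatson ξ z N ω)]
    · rw [hFdef]
      simp only [if_true, one_mul, monomialWeight, mul_pow, pow_add]
      ring
    · intro x hx
      simp [hFdef, Ne.symm hx]
  simp only [e1, e2]
  have hF' : ∀ x, Measurable (F x) := fun x => (hF x).mono hple le_rfl
  rw [lintegral_tsum fun x => ((hF' x).fun_mul (hoff x)).aemeasurable,
    lintegral_tsum fun x => ((hF' x).mul_const _).aemeasurable]
  refine tsum_congr fun x => ?_
  rw [h.lintegral_mul_offspring hm (hF x), lintegral_mul_const _ (hF' x)]

/-- The generating function of the progeny up to generation `N` is obtained by iteration. -/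
lemma lintegral_progeny (s : ℝ≥0∞) (N : ℕ) (w : ℝ≥0∞ × ℝ≥0∞) :
    ∫⁻ ω, s ^ progeny ξ (1, 1) N ω * monomialWeight w.1 w.2 (galtonWatson ξ (1, 1) N ω) ∂P =
      ((fun y : ℝ≥0∞ × ℝ≥0∞ => (s * genMeasure (L .male) y.1 y.2,
        s * genMeasure (L .female) y.1 y.2))^[N] w).1 *
      ((fun y : ℝ≥0∞ × ℝ≥0∞ => (s * genMeasure (L .male) y.1 y.2,
        s * genMeasure (L .female) y.1 y.2))^[N] w).2 := by
  have : IsProbabilityMeasure P := h.indep.isProbabilityMeasure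
  induction N generalizing w with
  | zero => simp [progeny, galtonWatson, monomialWeight]
  | succ N ih =>
    rw [h.lintegral_progeny_succ hm, Function.iterate_succ_apply]
    exact ih (s * genMeasure (L .male) w.1 w.2, s * genMeasure (L .female) w.1 w.2)

end IsOffspringFamily


/-! ### The law of the total progeny -/

lemma genMeasure_male {μ : ℕ × ℕ → ℝ} (hμ : ∀ x, (ν x : ℝ) = μ x) (u v : ℝ≥0∞) :
    genMeasure (offspringLaw μ .male) u v = genFemale ν u v := by
  rw [genMeasure, offspringLaw, lintegral_withDensity_eq_lintegral_mul _ (measurable_of_countable _)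
    (measurable_of_countable _), lintegral_count, genFemale_eq_tsum_ofReal]
  simp only [maleWeight, hμ, Pi.mul_apply, monomialWeight]

lemma genMeasure_female {μ : ℕ × ℕ → ℝ} (hμ : ∀ x, (ν x : ℝ) = μ x) (u v : ℝ≥0∞) :
    genMeasure (offspringLaw μ .female) u v = genMale ν u v := by
  rw [genMeasure, offspringLaw, lintegral_withDensity_eq_lintegral_mul _ (measurable_of_countable _)
    (measurable_of_countable _), lintegral_count, genMale_eq_tsum_ofReal]
  simp only [femaleWeight, hμ, Pi.mul_apply, monomialWeight]

section totalProgeny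

variable {Ω : Type*} {ξ : Gender × ℕ × ℕ → Ω → ℕ × ℕ}

/-- The partial progenies are nondecreasing integers: they either stabilise at the total or tend to
infinity, and then `s < 1` removes the contribution. -/
lemma tendsto_pow_progeny {s : ℝ≥0∞} (hs : s < 1) (z : ℕ × ℕ) (ω : Ω) :
    Tendsto (fun N => s ^ progeny ξ z N ω) atTop
      (𝓝 (∑' m : ℕ, {ω | totalProgeny ξ z ω = m}.indicator (fun _ => s ^ m) ω)) := by
  have hT : Tendsto (fun N => (progeny ξ z N ω : ℝ≥0∞)) atTop (𝓝 (totalProgeny ξ z ω)) := by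
    have := (ENNReal.summable (f := fun n => ((galtonWatson ξ z n ω).1 : ℝ≥0∞) +
      ((galtonWatson ξ z n ω).2 : ℝ≥0∞))).hasSum.tendsto_sum_nat
    refine this.congr fun N => ?_
    rw [progeny]
    push_cast
    rfl
  have hmono : Monotone fun N => progeny ξ z N ω := fun N N' h =>
    Finset.sum_le_sum_of_subset (Finset.range_mono h)
  rcases tendsto_atTop_of_monotone hmono with hinf | ⟨l, hl⟩
  · have htop : totalProgeny ξ z ω = ⊤ :=
      tendsto_nhds_unique hT (ENNReal.tendsto_nat_nhds_top.comp hinf)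
    have h0 : ∑' m : ℕ, {ω | totalProgeny ξ z ω = m}.indicator (fun _ => s ^ m) ω = 0 := by
      simp [htop]
    rw [h0]
    exact (ENNReal.tendsto_pow_atTop_nhds_zero_of_lt_one hs).comp hinf
  · rw [nhds_discrete, tendsto_pure] at hl
    have hl' : totalProgeny ξ z ω = l := by
      refine tendsto_nhds_unique hT (tendsto_const_nhds.congr' ?_)
      filter_upwards [hl] with N hN
      rw [hN]
    have h0 : ∑' m : ℕ, {ω | totalProgeny ξ z ω = m}.indicator (fun _ => s ^ m) ω = s ^ l := by
      rw [tsum_eq_single l]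
      · simp [hl']
      · intro m hne
        simp [hl', Ne.symm hne]
    rw [h0]
    refine tendsto_const_nhds.congr' ?_
    filter_upwards [hl] with N hN
    rw [hN]

variable [MeasurableSpace Ω]

lemma measurable_totalProgeny (hm : ∀ j, Measurable (ξ j)) (z : ℕ × ℕ) :
    Measurable (totalProgeny ξ z) := by
  unfold totalProgeny
  refine Measurable.tsum fun n => ?_
  have := measurable_galtonWatson z n fun g k i _ => hm (g, k, i)
  exact (measurable_of_countable fun x : ℕ × ℕ => ((x.1 : ℝ≥0∞) + (x.2 : ℝ≥0∞))).comp this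

lemma tendsto_lintegral_pow_progeny {P : Measure Ω} [IsProbabilityMeasure P]
    (hm : ∀ j, Measurable (ξ j)) {s : ℝ≥0∞} (hs : s < 1) (z : ℕ × ℕ) :
    Tendsto (fun N => ∫⁻ ω, s ^ progeny ξ z N ω ∂P) atTop
      (𝓝 (∑' m : ℕ, P {ω | totalProgeny ξ z ω = m} * s ^ m)) := by
  have hset : ∀ m : ℕ, MeasurableSet {ω | totalProgeny ξ z ω = m} := fun m =>
    measurable_totalProgeny hm z (measurableSet_singleton _)
  have hsum : ∑' m : ℕ, P {ω | totalProgeny ξ z ω = m} * s ^ m =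
      ∫⁻ ω, ∑' m : ℕ, {ω | totalProgeny ξ z ω = m}.indicator (fun _ => s ^ m) ω ∂P := by
    rw [lintegral_tsum fun m => (measurable_const.indicator (hset m)).aemeasurable]
    refine tsum_congr fun m => ?_
    rw [lintegral_indicator_const (hset m), mul_comm]
  rw [hsum]
  refine tendsto_lintegral_of_dominated_convergence (fun _ => 1) (fun N => ?_)
    (fun N => Eventually.of_forall fun ω => pow_le_one₀ zero_le hs.le) (by simp)
    (Eventually.of_forall fun ω => tendsto_pow_progeny hs z ω)
  exact (measurable_of_countable fun n : ℕ => s ^ n).comp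
    (measurable_progeny z N fun g k i _ => hm (g, k, i))

end totalProgeny

namespace IsSubcritical

variable {α β γ : ℝ} (h : IsSubcritical ν α β γ)
include h

lemma tendsto_gen_male {X Y : ℕ → ℝ} {a b : ℝ} (hX : ∀ n, X n ∈ Set.Icc (0 : ℝ) 1)
    (hY : ∀ n, Y n ∈ Set.Icc (0 : ℝ) 1) (ha : Tendsto X atTop (𝓝 a)) (hb : Tendsto Y atTop (𝓝 b)) :
    Tendsto (fun n => gen (maleWeight ν) (X n) (Y n)) atTop (𝓝 (gen (maleWeight ν) a b)) := by
  have ha' := isClosed_Icc.mem_of_tendsto ha (Eventually.of_forall hX)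
  have hb' := isClosed_Icc.mem_of_tendsto hb (Eventually.of_forall hY)
  rw [tendsto_iff_dist_tendsto_zero]
  refine squeeze_zero (fun _ => dist_nonneg)
    (fun n => h.abs_gen_male_sub_le (hX n) (hY n) ha' hb') ?_
  have h1 := ((tendsto_iff_dist_tendsto_zero.1 ha).const_mul γ).add
    ((tendsto_iff_dist_tendsto_zero.1 hb).const_mul β)
  simpa [Real.dist_eq] using h1

lemma tendsto_gen_female {X Y : ℕ → ℝ} {a b : ℝ} (hX : ∀ n, X n ∈ Set.Icc (0 : ℝ) 1)
    (hY : ∀ n, Y n ∈ Set.Icc (0 : ℝ) 1) (ha : Tendsto X atTop (𝓝 a)) (hb : Tendsto Y atTop (𝓝 b)) :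
    Tendsto (fun n => gen (femaleWeight ν) (X n) (Y n)) atTop (𝓝 (gen (femaleWeight ν) a b)) := by
  have ha' := isClosed_Icc.mem_of_tendsto ha (Eventually.of_forall hX)
  have hb' := isClosed_Icc.mem_of_tendsto hb (Eventually.of_forall hY)
  rw [tendsto_iff_dist_tendsto_zero]
  refine squeeze_zero (fun _ => dist_nonneg)
    (fun n => h.abs_gen_female_sub_le (hX n) (hY n) ha' hb') ?_
  have h1 := ((tendsto_iff_dist_tendsto_zero.1 ha).const_mul α).add
    ((tendsto_iff_dist_tendsto_zero.1 hb).const_mul γ)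
  simpa [Real.dist_eq] using h1

lemma gen_male_mono {X Y X' Y' : ℝ} (hX : X ∈ Set.Icc (0 : ℝ) 1) (hY : Y ∈ Set.Icc (0 : ℝ) 1)
    (hX' : X' ∈ Set.Icc (0 : ℝ) 1) (hY' : Y' ∈ Set.Icc (0 : ℝ) 1) (h1 : X ≤ X') (h2 : Y ≤ Y') :
    gen (maleWeight ν) X Y ≤ gen (maleWeight ν) X' Y' := by
  have := genFemale_mono (ν := ν) (ENNReal.ofReal_le_ofReal h1) (ENNReal.ofReal_le_ofReal h2)
  rwa [h.genFemale_ofReal hX hY, h.genFemale_ofReal hX' hY',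
    ENNReal.ofReal_le_ofReal_iff (gen_nonneg maleWeight_nonneg hX'.1 hY'.1)] at this

lemma gen_female_mono {X Y X' Y' : ℝ} (hX : X ∈ Set.Icc (0 : ℝ) 1) (hY : Y ∈ Set.Icc (0 : ℝ) 1)
    (hX' : X' ∈ Set.Icc (0 : ℝ) 1) (hY' : Y' ∈ Set.Icc (0 : ℝ) 1) (h1 : X ≤ X') (h2 : Y ≤ Y') :
    gen (femaleWeight ν) X Y ≤ gen (femaleWeight ν) X' Y' := by
  have := genMale_mono (ν := ν) (ENNReal.ofReal_le_ofReal h1) (ENNReal.ofReal_le_ofReal h2)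
  rwa [h.genMale_ofReal hX hY, h.genMale_ofReal hX' hY',
    ENNReal.ofReal_le_ofReal_iff (gen_nonneg femaleWeight_nonneg hX'.1 hY'.1)] at this

lemma gen_male_mem {X Y : ℝ} (hX : X ∈ Set.Icc (0 : ℝ) 1) (hY : Y ∈ Set.Icc (0 : ℝ) 1) :
    gen (maleWeight ν) X Y ∈ Set.Icc (0 : ℝ) 1 :=
  ⟨gen_nonneg maleWeight_nonneg hX.1 hY.1, (h.gen_male_mono hX hY (by simp) (by simp) hX.2
    hY.2).trans_eq h.gen_male_one⟩

lemma gen_female_mem {X Y : ℝ} (hX : X ∈ Set.Icc (0 : ℝ) 1) (hY : Y ∈ Set.Icc (0 : ℝ) 1) :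
    gen (femaleWeight ν) X Y ∈ Set.Icc (0 : ℝ) 1 :=
  ⟨gen_nonneg femaleWeight_nonneg hX.1 hY.1, (h.gen_female_mono hX hY (by simp) (by simp) hX.2
    hY.2).trans_eq h.gen_female_one⟩

/-- The iterates of the scaled generating functions decrease to a fixed point. -/
lemma exists_tendsto_iterate {s : ℝ} (hs : s ∈ Set.Icc (0 : ℝ) 1) :
    ∃ a ∈ Set.Icc (0 : ℝ) 1, ∃ b ∈ Set.Icc (0 : ℝ) 1, a = s * gen (maleWeight ν) a b ∧
      b = s * gen (femaleWeight ν) a b ∧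
      Tendsto (fun N => ((fun y : ℝ≥0∞ × ℝ≥0∞ => (ENNReal.ofReal s * genFemale ν y.1 y.2,
        ENNReal.ofReal s * genMale ν y.1 y.2))^[N] (1, 1)).1 *
        ((fun y : ℝ≥0∞ × ℝ≥0∞ => (ENNReal.ofReal s * genFemale ν y.1 y.2,
        ENNReal.ofReal s * genMale ν y.1 y.2))^[N] (1, 1)).2) atTop
        (𝓝 (ENNReal.ofReal (a * b))) := by
  set Φ : ℝ × ℝ → ℝ × ℝ := fun y => (s * gen (maleWeight ν) y.1 y.2,
    s * gen (femaleWeight ν) y.1 y.2) with hΦ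
  set w : ℕ → ℝ × ℝ := fun N => Φ^[N] (1, 1) with hw
  have hstep : ∀ N, w (N + 1) = Φ (w N) := fun N => Function.iterate_succ_apply' _ _ _
  have hmul : ∀ x ∈ Set.Icc (0 : ℝ) 1, s * x ∈ Set.Icc (0 : ℝ) 1 := fun x hx =>
    ⟨mul_nonneg hs.1 hx.1, mul_le_one₀ hs.2 hx.1 hx.2⟩
  have hmem : ∀ N, (w N).1 ∈ Set.Icc (0 : ℝ) 1 ∧ (w N).2 ∈ Set.Icc (0 : ℝ) 1 := fun N => by
    induction N with
    | zero => simp [hw]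
    | succ N ih =>
      rw [hstep]
      exact ⟨hmul _ (h.gen_male_mem ih.1 ih.2), hmul _ (h.gen_female_mem ih.1 ih.2)⟩
  have hanti : ∀ N, (w (N + 1)).1 ≤ (w N).1 ∧ (w (N + 1)).2 ≤ (w N).2 := fun N => by
    induction N with
    | zero => exact ⟨(hmem 1).1.2, (hmem 1).2.2⟩
    | succ N ih =>
      rw [hstep (N + 1), hstep N]
      rw [hstep N] at ih
      have m1 := hmem (N + 1)
      rw [hstep N] at m1
      exact ⟨mul_le_mul_of_nonneg_left
          (h.gen_male_mono m1.1 m1.2 (hmem N).1 (hmem N).2 ih.1 ih.2) hs.1,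
        mul_le_mul_of_nonneg_left
          (h.gen_female_mono m1.1 m1.2 (hmem N).1 (hmem N).2 ih.1 ih.2) hs.1⟩
  have ha : Tendsto (fun N => (w N).1) atTop (𝓝 (⨅ N, (w N).1)) :=
    tendsto_atTop_ciInf (antitone_nat_of_succ_le fun N => (hanti N).1)
      ⟨0, by rintro _ ⟨N, rfl⟩; exact (hmem N).1.1⟩
  have hb : Tendsto (fun N => (w N).2) atTop (𝓝 (⨅ N, (w N).2)) :=
    tendsto_atTop_ciInf (antitone_nat_of_succ_le fun N => (hanti N).2)
      ⟨0, by rintro _ ⟨N, rfl⟩; exact (hmem N).2.1⟩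
  have hX := fun N => (hmem N).1
  have hY := fun N => (hmem N).2
  refine ⟨_, isClosed_Icc.mem_of_tendsto ha (Eventually.of_forall hX), _,
    isClosed_Icc.mem_of_tendsto hb (Eventually.of_forall hY), ?_, ?_, ?_⟩
  · refine tendsto_nhds_unique ((tendsto_add_atTop_iff_nat 1).2 ha) ?_
    simp only [hstep, hΦ]
    exact (h.tendsto_gen_male hX hY ha hb).const_mul s
  · refine tendsto_nhds_unique ((tendsto_add_atTop_iff_nat 1).2 hb) ?_
    simp only [hstep, hΦ]
    exact (h.tendsto_gen_female hX hY ha hb).const_mul s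
  · have hcoe : ∀ N, (fun y : ℝ≥0∞ × ℝ≥0∞ => (ENNReal.ofReal s * genFemale ν y.1 y.2,
        ENNReal.ofReal s * genMale ν y.1 y.2))^[N] (1, 1) =
        (ENNReal.ofReal (w N).1, ENNReal.ofReal (w N).2) := fun N => by
      induction N with
      | zero => simp [hw]
      | succ N ih =>
        rw [Function.iterate_succ_apply', ih, hstep, h.genFemale_ofReal (hX N) (hY N),
          h.genMale_ofReal (hX N) (hY N), ← ENNReal.ofReal_mul hs.1, ← ENNReal.ofReal_mul hs.1]
    simp only [hcoe]
    refine (ENNReal.tendsto_ofReal (ha.mul hb)).congr fun N => ?_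
    rw [ENNReal.ofReal_mul (hX N).1]

/-- The generating function of the total progeny, started from one male and one female. -/
theorem exists_genProgeny {μ : ℕ × ℕ → ℝ} (hμ : ∀ x, (ν x : ℝ) = μ x) {Ω : Type*}
    [MeasurableSpace Ω] {P : Measure Ω} {ξ : Gender × ℕ × ℕ → Ω → ℕ × ℕ}
    (hξ : IsOffspringFamily (offspringLaw μ) ξ P) (hm : ∀ j, Measurable (ξ j)) {s : ℝ}
    (hs : s ∈ Set.Ico (0 : ℝ) 1) :
    ∃ a ∈ Set.Icc (0 : ℝ) 1, ∃ b ∈ Set.Icc (0 : ℝ) 1, a = s * gen (maleWeight ν) a b ∧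
      b = s * gen (femaleWeight ν) a b ∧
      ∑' m : ℕ, P {ω | totalProgeny ξ (1, 1) ω = m} * ENNReal.ofReal s ^ m =
        ENNReal.ofReal (a * b) := by
  have : IsProbabilityMeasure P := hξ.indep.isProbabilityMeasure
  obtain ⟨a, ha, b, hb, hfa, hfb, hlim⟩ := h.exists_tendsto_iterate (Set.Ico_subset_Icc_self hs)
  refine ⟨a, ha, b, hb, hfa, hfb, tendsto_nhds_unique
    (tendsto_lintegral_pow_progeny hm (ENNReal.ofReal_lt_one.2 hs.2) (1, 1)) (hlim.congr fun N => ?_)⟩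
  have := hξ.lintegral_progeny hm (ENNReal.ofReal s) N (1, 1)
  simp only [genMeasure_male hμ, genMeasure_female hμ, monomialWeight, one_pow, mul_one] at this
  exact this.symm

/-- The total progeny in terms of the concentrations of armless particles. -/
lemma tsum_progeny_eq {μ : ℕ × ℕ → ℝ} (hμ : ∀ x, (ν x : ℝ) = μ x) {Ω : Type*}
    [MeasurableSpace Ω] {P : Measure Ω} {ξ : Gender × ℕ × ℕ → Ω → ℕ × ℕ}
    (hξ : IsOffspringFamily (offspringLaw μ) ξ P) (hm : ∀ j, Measurable (ξ j)) {s : ℝ}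
    (hs : s ∈ Set.Ioo (0 : ℝ) 1) :
    ∑' m : ℕ, P {ω | totalProgeny ξ (1, 1) ω = m} * ENNReal.ofReal s ^ m =
      ENNReal.ofReal s ^ 2 *
        ∑' n : ℕ, ENNReal.ofReal ((n + 1) * treeConc ν (0, 0, (n + 1).succPNat) * s ^ n) := by
  obtain ⟨a, ha, b, hb, hfa, hfb, hsum⟩ := h.exists_genProgeny hμ hξ hm (Set.Ioo_subset_Ico_self hs)
  have hs0 := hs.1.ne'
  have hz : 0 + s ≤ 1 := by linarith [hs.2]
  have hqa : s * gen (maleWeight ν) a b = a := hfa.symm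
  have hqb : s * gen (femaleWeight ν) a b = b := hfb.symm
  -- The values `a / s` and `b / s` are written without division. They solve the equations for `Q`
  -- and `P` at `(0, 0, s)`, where the solution is unique.
  have hfix : IsFixedPoint ν 0 0 s (gen (femaleWeight ν) a b) (gen (maleWeight ν) a b) := by
    refine ⟨h.gen_female_mem ha hb, h.gen_male_mem ha hb, ?_, ?_⟩ <;>
    rw [zero_add, zero_add, hqa, hqb]
  obtain ⟨e1, e2⟩ := (h.isFixedPoint_val le_rfl le_rfl hs.1.le hz hz).unique h le_rfl le_rfl
    hs.1.le hs.2 hz hz hfix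
  obtain ⟨v1, v2⟩ := h.val_le_one le_rfl le_rfl hs.1.le hz hz
  rw [hsum, tsum_armless_eq hs.1.le, ← ENNReal.ofReal_toReal (v1.trans_lt ENNReal.one_lt_top).ne,
    ← ENNReal.ofReal_toReal (v2.trans_lt ENNReal.one_lt_top).ne, e1, e2,
    ← ENNReal.ofReal_pow hs.1.le, ← ENNReal.ofReal_mul (h.gen_female_mem ha hb).1,
    ← ENNReal.ofReal_mul (by positivity)]
  congr 1
  calc a * b = (s * gen (maleWeight ν) a b) * (s * gen (femaleWeight ν) a b) := by rw [hqa, hqb]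
    _ = _ := by ring

end IsSubcritical


/-! ### Comparison of coefficients -/

lemma summable_mul_pow_of_bounded {d : ℕ → ℝ} {C : ℝ} (hd : ∀ m, |d m| ≤ C) {s : ℝ}
    (hs : s ∈ Set.Ioo (0 : ℝ) 1) : Summable fun m => d m * s ^ m := by
  refine ((summable_geometric_of_lt_one hs.1.le hs.2).mul_left C).of_norm_bounded fun m => ?_
  rw [norm_mul, Real.norm_eq_abs, Real.norm_of_nonneg (pow_nonneg hs.1.le m)]
  exact mul_le_mul_of_nonneg_right (hd m) (pow_nonneg hs.1.le m)

/-- A power series with bounded coefficients which vanishes on `(0, 1)` is zero. -/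
lemma eq_zero_of_forall_tsum_eq_zero {C : ℝ} (k : ℕ) : ∀ {d : ℕ → ℝ}, (∀ m, |d m| ≤ C) →
    (∀ s ∈ Set.Ioo (0 : ℝ) 1, ∑' m, d m * s ^ m = 0) → d k = 0 := by
  -- The constant coefficient vanishes on letting `s → 0`; division by `s` then shifts the series,
  -- and the uniform bound `C` is inherited.
  have hshift : ∀ {d : ℕ → ℝ}, (∀ m, |d m| ≤ C) → (∀ s ∈ Set.Ioo (0 : ℝ) 1,
      ∑' m, d m * s ^ m = 0) → ∀ s ∈ Set.Ioo (0 : ℝ) 1,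
      d 0 + s * ∑' m, d (m + 1) * s ^ m = 0 := by
    intro d hd h0 s hs
    rw [← h0 s hs, (summable_mul_pow_of_bounded hd hs).tsum_eq_zero_add, ← tsum_mul_left, pow_zero,
      mul_one]
    congr 1
    refine tsum_congr fun m => ?_
    ring
  have hzero : ∀ {d : ℕ → ℝ}, (∀ m, |d m| ≤ C) → (∀ s ∈ Set.Ioo (0 : ℝ) 1,
      ∑' m, d m * s ^ m = 0) → d 0 = 0 := by
    intro d hd h0
    have hC : 0 ≤ C := (abs_nonneg _).trans (hd 0)
    have hle : ∀ s ∈ Set.Ioo (0 : ℝ) 1, |d 0| ≤ s * (C * (1 - s)⁻¹) := by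
      intro s hs
      have h1 := hshift hd h0 s hs
      have h2 : ‖∑' m, d (m + 1) * s ^ m‖ ≤ C * (1 - s)⁻¹ := by
        refine tsum_of_norm_bounded ((hasSum_geometric_of_lt_one hs.1.le hs.2).mul_left C)
          fun m => ?_
        rw [norm_mul, Real.norm_eq_abs, Real.norm_of_nonneg (pow_nonneg hs.1.le m)]
        exact mul_le_mul_of_nonneg_right (hd _) (pow_nonneg hs.1.le m)
      rw [eq_neg_of_add_eq_zero_left h1, abs_neg, abs_mul, abs_of_pos hs.1]
      exact mul_le_mul_of_nonneg_left h2 hs.1.le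
    have hlim : Tendsto (fun s : ℝ => s * (C * (1 - s)⁻¹)) (𝓝[>] 0) (𝓝 0) := by
      have : ContinuousAt (fun s : ℝ => s * (C * (1 - s)⁻¹)) 0 := by
        refine continuousAt_id.mul (continuousAt_const.mul (ContinuousAt.inv₀ ?_ (by simp)))
        fun_prop
      have := this.tendsto
      rw [zero_mul] at this
      exact this.mono_left nhdsWithin_le_nhds
    have : |d 0| ≤ 0 := by
      refine ge_of_tendsto hlim ?_
      filter_upwards [Ioo_mem_nhdsGT (zero_lt_one (α := ℝ))] with s hs using hle s hs
    exact abs_nonpos_iff.1 this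
  induction k with
  | zero => exact fun hd h0 => hzero hd h0
  | succ k ih =>
    intro d hd h0
    refine ih (d := fun m => d (m + 1)) (fun m => hd _) fun s hs => ?_
    have h1 := hshift hd h0 s hs
    rw [hzero hd h0, zero_add] at h1
    exact (mul_eq_zero.1 h1).resolve_left hs.1.ne'

/-- `(m - 1)` times the limiting concentration of particles of mass `m`. -/
def progenyLaw (ν : ℕ × ℕ → ℝ≥0) : ℕ → ℝ
  -- With two ancestors, the total progeny is never `0` or `1`.
  | 0 => 0
  | 1 => 0
  | n + 2 => (n + 1) * treeConc ν (0, 0, (n + 1).succPNat)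

lemma progenyLaw_nonneg (m : ℕ) : 0 ≤ progenyLaw ν m := by
  rcases m with _ | _ | n
  · exact le_rfl
  · exact le_rfl
  · exact mul_nonneg (by positivity) (treeConc_nonneg _)

lemma progenyLaw_coe (m : ℕ+) (hm : 2 ≤ m) :
    progenyLaw ν m = ((m : ℝ) - 1) * treeConc ν (0, 0, m) := by
  have h2 : 2 ≤ (m : ℕ) := by exact_mod_cast hm
  obtain ⟨n, hn⟩ : ∃ n, (m : ℕ) = n + 2 := ⟨m - 2, by omega⟩
  have hm' : m = (n + 1).succPNat := PNat.eq (by simpa using hn)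
  rw [hn, progenyLaw, ← hm']
  push_cast
  ring

lemma tsum_progenyLaw {s : ℝ} (hs : 0 ≤ s) :
    ∑' m, ENNReal.ofReal (progenyLaw ν m * s ^ m) = ENNReal.ofReal s ^ 2 *
      ∑' n : ℕ, ENNReal.ofReal ((n + 1) * treeConc ν (0, 0, (n + 1).succPNat) * s ^ n) := by
  rw [← ENNReal.summable.sum_add_tsum_nat_add' (k := 2), ← ENNReal.tsum_mul_left]
  simp only [Finset.sum_range_succ, Finset.sum_range_zero, progenyLaw, zero_mul,
    ENNReal.ofReal_zero, zero_add]
  refine tsum_congr fun n => ?_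
  rw [← ENNReal.ofReal_pow hs, ← ENNReal.ofReal_mul (by positivity)]
  congr 1
  ring

namespace IsSubcritical

variable {α β γ : ℝ} (h : IsSubcritical ν α β γ)
include h

lemma progenyLaw_le_one (m : ℕ) : progenyLaw ν m ≤ 1 := by
  rcases m with _ | _ | n
  · exact zero_le_one
  · exact zero_le_one
  · refine le_trans ?_ (h.sum_armless_le (n + 1))
    exact Finset.single_le_sum
      (f := fun n : ℕ => ((n : ℝ) + 1) * treeConc ν (0, 0, (n + 1).succPNat))
      (fun i _ => mul_nonneg (by positivity) (treeConc_nonneg _)) (Finset.self_mem_range_succ n)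

variable {μ : ℕ × ℕ → ℝ} (hμ : ∀ x, (ν x : ℝ) = μ x) {Ω : Type*} [MeasurableSpace Ω]
  {P : Measure Ω} {ξ : Gender × ℕ × ℕ → Ω → ℕ × ℕ}
  (hξ : IsOffspringFamily (offspringLaw μ) ξ P) (hm : ∀ j, Measurable (ξ j))
include hμ hξ hm

/-- The law of the total progeny, on the integers. -/
theorem measureReal_totalProgeny_eq (m : ℕ) :
    P.real {ω | totalProgeny ξ (1, 1) ω = m} = progenyLaw ν m := by
  have : IsProbabilityMeasure P := hξ.indep.isProbabilityMeasure
  refine sub_eq_zero.1 (eq_zero_of_forall_tsum_eq_zero (C := 1) m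
    (d := fun m => P.real {ω | totalProgeny ξ (1, 1) ω = m} - progenyLaw ν m) (fun m => ?_)
    fun s hs => ?_)
  · rw [abs_le]
    constructor <;> linarith [h.progenyLaw_le_one m, progenyLaw_nonneg (ν := ν) m,
      measureReal_nonneg (μ := P) (s := {ω | totalProgeny ξ (1, 1) ω = m}),
      measureReal_le_one (μ := P) (s := {ω | totalProgeny ξ (1, 1) ω = m})]
  · obtain ⟨a, ha, b, hb, -, -, hsum⟩ :=
      h.exists_genProgeny hμ hξ hm (Set.Ioo_subset_Ico_self hs)
    have hpow : ∀ m, 0 ≤ s ^ m := fun m => pow_nonneg hs.1.le m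
    have h1 : HasSum (fun m : ℕ => P.real {ω | totalProgeny ξ (1, 1) ω = m} * s ^ m) (a * b) := by
      refine hasSum_of_tsum_ofReal (fun m => mul_nonneg measureReal_nonneg (hpow m))
        (mul_nonneg ha.1 hb.1) ?_
      rw [← hsum]
      refine tsum_congr fun m => ?_
      rw [ENNReal.ofReal_mul measureReal_nonneg, ofReal_measureReal, ENNReal.ofReal_pow hs.1.le]
    have h2 : HasSum (fun m : ℕ => progenyLaw ν m * s ^ m) (a * b) := by
      refine hasSum_of_tsum_ofReal (fun m => mul_nonneg (progenyLaw_nonneg m) (hpow m))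
        (mul_nonneg ha.1 hb.1) ?_
      rw [tsum_progenyLaw hs.1.le, ← h.tsum_progeny_eq hμ hξ hm hs, hsum]
    have h3 := h1.sub h2
    simp only [← sub_mul, sub_self] at h3
    exact h3.tsum_eq

/-- Infinite progeny does not contribute to the generating function, and `s^m ≤ 1`, so its value
bounds the probability of a finite progeny from below. -/
lemma ofReal_mul_le_measure {s : ℝ} (hs : s ∈ Set.Ico (0 : ℝ) 1) :
    ∃ a ∈ Set.Icc (0 : ℝ) 1, ∃ b ∈ Set.Icc (0 : ℝ) 1, a = s * gen (maleWeight ν) a b ∧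
      b = s * gen (femaleWeight ν) a b ∧
      ENNReal.ofReal (a * b) ≤ P {ω | totalProgeny ξ (1, 1) ω < ⊤} := by
  obtain ⟨a, ha, b, hb, hfa, hfb, hsum⟩ := h.exists_genProgeny hμ hξ hm hs
  refine ⟨a, ha, b, hb, hfa, hfb, ?_⟩
  have hset : ∀ m : ℕ, MeasurableSet {ω | totalProgeny ξ (1, 1) ω = m} := fun m =>
    measurable_totalProgeny hm (1, 1) (measurableSet_singleton _)
  have hdisj : Pairwise (Function.onFun Disjoint
      fun m : ℕ => {ω | totalProgeny ξ (1, 1) ω = m}) := fun m n hmn =>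
    Set.disjoint_left.2 fun ω h1 h2 => hmn (by
      have : (m : ℝ≥0∞) = n := h1.symm.trans h2
      exact_mod_cast this)
  calc ENNReal.ofReal (a * b)
      = ∑' m : ℕ, P {ω | totalProgeny ξ (1, 1) ω = m} * ENNReal.ofReal s ^ m := hsum.symm
    _ ≤ ∑' m : ℕ, P {ω | totalProgeny ξ (1, 1) ω = m} := ENNReal.tsum_le_tsum fun m =>
        mul_le_of_le_one_right zero_le (pow_le_one₀ zero_le (ENNReal.ofReal_le_one.2 hs.2.le))
    _ = P (⋃ m : ℕ, {ω | totalProgeny ξ (1, 1) ω = m}) := (measure_iUnion hdisj hset).symm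
    _ ≤ _ := measure_mono (Set.iUnion_subset fun m ω hω => by
        change totalProgeny ξ (1, 1) ω = m at hω
        simp [hω])

/-- Unless `μ` is degenerate, the Galton–Watson process dies out. -/
theorem ae_totalProgeny_lt_top (hdeg : ¬ IsDegenerate μ) :
    ∀ᵐ ω ∂P, totalProgeny ξ (1, 1) ω < ⊤ := by
  have : IsProbabilityMeasure P := hξ.indep.isProbabilityMeasure
  set s : ℕ → ℝ := fun n => 1 - 1 / ((n : ℝ) + 1) with hsdef
  have hs : ∀ n, s n ∈ Set.Ico (0 : ℝ) 1 := fun n => by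
    have h1 : 0 < 1 / ((n : ℝ) + 1) := by positivity
    have h2 : 1 / ((n : ℝ) + 1) ≤ 1 := by
      rw [div_le_one (by positivity)]
      linarith [n.cast_nonneg (α := ℝ)]
    exact ⟨sub_nonneg.2 h2, sub_lt_self _ h1⟩
  have hslim : Tendsto s atTop (𝓝 1) := by
    simpa only [sub_zero] using (tendsto_one_div_add_atTop_nhds_zero_nat (𝕜 := ℝ)).const_sub 1
  choose a ha b hb hfa hfb hP using fun n => h.ofReal_mul_le_measure hμ hξ hm (hs n)
  -- Compactness replaces monotonicity in `s`: along a subsequence the solutions converge to a fixed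
  -- point for `s = 1`, which can only be `(1, 1)`.
  obtain ⟨x, hx, φ, hφ, hlim⟩ := (isCompact_Icc.prod isCompact_Icc).tendsto_subseq
    (x := fun n => (a n, b n)) fun n => Set.mk_mem_prod (ha n) (hb n)
  have hla : Tendsto (fun n => a (φ n)) atTop (𝓝 x.1) := (continuous_fst.tendsto x).comp hlim
  have hlb : Tendsto (fun n => b (φ n)) atTop (𝓝 x.2) := (continuous_snd.tendsto x).comp hlim
  have hls := hslim.comp hφ.tendsto_atTop
  have hmA := h.tendsto_gen_male (fun n => ha (φ n)) (fun n => hb (φ n)) hla hlb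
  have hmB := h.tendsto_gen_female (fun n => ha (φ n)) (fun n => hb (φ n)) hla hlb
  have e1 : x.1 = gen (maleWeight ν) x.1 x.2 := by
    refine tendsto_nhds_unique hla ?_
    have := hls.mul hmA
    rw [one_mul] at this
    exact this.congr fun n => (hfa (φ n)).symm
  have e2 : x.2 = gen (femaleWeight ν) x.1 x.2 := by
    refine tendsto_nhds_unique hlb ?_
    have := hls.mul hmB
    rw [one_mul] at this
    exact this.congr fun n => (hfb (φ n)).symm
  obtain ⟨x1, x2⟩ := h.fixedPoint_eq_one hμ hdeg hx.1 hx.2 e1 e2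
  have hone : 1 ≤ P {ω | totalProgeny ξ (1, 1) ω < ⊤} := by
    have := ENNReal.tendsto_ofReal (hla.mul hlb)
    rw [x1, x2, mul_one, ENNReal.ofReal_one] at this
    exact le_of_tendsto' this fun n => hP (φ n)
  exact (mem_ae_iff_prob_eq_one
    (measurable_totalProgeny hm (1, 1) measurableSet_Iio)).2 (le_antisymm prob_le_one hone)

end IsSubcritical

/-! ### Measurable versions of the offspring variables -/

lemma galtonWatson_congr {Ω : Type*} {ξ ξ' : Gender × ℕ × ℕ → Ω → ℕ × ℕ} {ω : Ω}
    (h : ∀ j, ξ j ω = ξ' j ω) (z : ℕ × ℕ) (n : ℕ) :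
    galtonWatson ξ z n ω = galtonWatson ξ' z n ω := by
  induction n with
  | zero => rfl
  | succ n ih => simp only [galtonWatson, ih, h]

/-- `HasLaw` provides only almost everywhere measurability. There are countably many variables, so
replacing all of them changes the process on a null set. -/
lemma IsOffspringFamily.exists_measurable {Ω : Type*} [MeasurableSpace Ω]
    {L : Gender → Measure (ℕ × ℕ)} {ξ : Gender × ℕ × ℕ → Ω → ℕ × ℕ} {P : Measure Ω}
    (h : IsOffspringFamily L ξ P) :
    ∃ ξ' : Gender × ℕ × ℕ → Ω → ℕ × ℕ, (∀ j, Measurable (ξ' j)) ∧ IsOffspringFamily L ξ' P ∧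
      ∀ z, totalProgeny ξ z =ᵐ[P] totalProgeny ξ' z := by
  refine ⟨fun j => (h.law j).aemeasurable.mk, fun j => (h.law j).aemeasurable.measurable_mk,
    ⟨fun j => (h.law j).congr (h.law j).aemeasurable.ae_eq_mk.symm,
      h.indep.congr fun j => (h.law j).aemeasurable.ae_eq_mk⟩, fun z => ?_⟩
  have hae : ∀ g, ∀ᵐ ω ∂P, ∀ x : ℕ × ℕ, ξ (g, x) ω = (h.law (g, x)).aemeasurable.mk (ξ (g, x)) ω :=
    fun g => ae_all_iff.2 fun x => (h.law (g, x)).aemeasurable.ae_eq_mk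
  filter_upwards [hae .male, hae .female] with ω h1 h2
  refine tsum_congr fun n => ?_
  rw [galtonWatson_congr (ξ' := fun j => (h.law j).aemeasurable.mk) fun j => ?_]
  obtain ⟨_ | _, x⟩ := j
  exacts [h1 x, h2 x]

/-! ### Limiting concentrations and total progeny -/

lemma TendstoL1.congr_of_nonneg {c c' : ℝ → Particle → ℝ} {d : Particle → ℝ}
    (h : TendstoL1 c d) (hcc : ∀ t, 0 ≤ t → c' t = c t) : TendstoL1 c' d := by
  refine Tendsto.congr' ?_ h
  filter_upwards [eventually_ge_atTop 0] with t ht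
  rw [hcc t ht]

/-- The limiting concentrations of the coagulation equation with monodisperse initial data are
given by the law of the total progeny of a two-type Galton–Watson process. -/
theorem mainTheorem3 {Ω : Type*} [MeasurableSpace Ω] (P : Measure Ω) [IsProbabilityMeasure P]
    (μ : ℕ × ℕ → ℝ) (hμ : IsAdmissible (monodisperse μ))
    (hTc : criticalTime (monodisperse μ) = ⊤)
    (ξ : Gender × ℕ × ℕ → Ω → ℕ × ℕ) (hξ : IsOffspringFamily (offspringLaw μ) ξ P) :
    (∃ c : ℝ → Particle → ℝ, IsSolution (monodisperse μ) ⊤ c) ∧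
    (∀ c : ℝ → Particle → ℝ, IsSolution (monodisperse μ) ⊤ c →
      ∃ cInf : ℕ+ → ℝ, TendstoL1 c (armless cInf) ∧
        ∀ m : ℕ+, 2 ≤ m →
          P.real {ω | totalProgeny ξ (1, 1) ω = ((m : ℕ) : ℝ≥0∞)} = ((m : ℝ) - 1) * cInf m) ∧
    (¬ IsDegenerate μ → ∀ᵐ ω ∂P, totalProgeny ξ (1, 1) ω < ⊤) := by
  have hμ0 : ∀ x, 0 ≤ μ x := fun x => by simpa [monodisperse] using hμ.nonneg (x.1, x.2, 1)
  obtain ⟨ν, hν⟩ : ∃ ν : ℕ × ℕ → ℝ≥0, ∀ x, (ν x : ℝ) = μ x :=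
    ⟨fun x => (μ x).toNNReal, fun x => Real.coe_toNNReal _ (hμ0 x)⟩
  obtain ⟨α, β, γ, h⟩ := isSubcritical_of_criticalTime_eq_top hμ hTc hν
  obtain ⟨ξ', hm, hξ', hae⟩ := hξ.exists_measurable
  refine ⟨⟨_, h.isSolution_explicitSolution hν⟩, fun c hc => ⟨fun m => treeConc ν (0, 0, m),
    h.tendstoL1_explicitSolution.congr_of_nonneg fun t ht =>
      hc.eq_explicitSolution hν h hμ ht, fun m hm2 => ?_⟩, fun hdeg => ?_⟩
  · rw [← progenyLaw_coe m hm2, ← h.measureReal_totalProgeny_eq hν hξ' hm m]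
    refine measureReal_congr ?_
    filter_upwards [hae (1, 1)] with ω hω
    exact congrArg (· = ((m : ℕ) : ℝ≥0∞)) hω
  · filter_upwards [hae (1, 1), h.ae_totalProgeny_lt_top hν hξ' hm hdeg] with ω h1 h2
    rwa [h1]

end
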